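/- **Setting.** Let $\mathfrak g=V_1\oplus\dots\oplus V_m$ be an $n$-dimensional real Lie algebra, $m\le 2$, $V_m\neq 0$, with $[V_1,V_j]=V_{j+1}$ for $1\le j<m$ and $[V_1,V_m]=0$, and suppose that some basis of $\mathfrak g$ has rational structure constants. Identify $\mathfrak g$ with $\mathbb R^n$ through a basis $v_1,\dots,v_n$ adapted to the stratification, $v_i\in V_{\deg i}$. The associated connected and simply connected group $G=(\mathbb R^n,*_G)$ (rational, stratified, of step at most two), in exponential coordinates, has the product $x*_Gy=x+y+\tfrac12[x,y]$, the dilations $D_r(x)=(r^{\deg i}x_i)_i$ and the homogeneous dimension $Q=\sum_i\deg i=\sum_j j\dim V_j$. A *homogeneous quasi-norm* is a continuous function $\|\cdot\|:\mathbb R^n\to[0,\infty)$ with $\|D_rx\|=r\|x\|$ for $r>0$, $\|-x\|=\|x\|$, and $\|x\|=0$ only for $x=0$; put $B(c,R)=\{x:\|(-c)*_Gx\|<R\}$. For $0\le\alpha<1$, a *generalized $\alpha$-covering* is a family $(P_i)_{i\in I}$ of non-empty open connected sets covering $\mathbb R^n$ such that $\sup_i\#\{j:P_i\cap P_j\ne\emptyset\}<\infty$,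 $|P_i|\asymp(1+\|\xi\|^2)^{\alpha Q/2}$ uniformly in $i\in I$ and $\xi\in P_i$, and, for some $K\ge 1$ and all $i$, the infimum of the radii of the balls containing $P_i$ is at most $K$ times the supremum of the radii of the balls contained in $P_i$. A *BAPU* subordinate to it is a family of non-negative functions $\psi_i\in C_c^\infty(\mathbb R^n)$ with $\operatorname{supp}\psi_i\subset P_i$, $\sum_i\psi_i\equiv1$ and $\sup_i\|\mathcal F^{-1}\psi_i\|_{L^1}<\infty$. Let $Z(\mathbb R^n)=\mathcal F(C_c^\infty(\mathbb R^n))$ with the topology transported by the Fourier transform $\mathcal F$, let $Z'(\mathbb R^n)$ be its dual, and define $\mathcal F:Z'\to\mathcal D'$ by $(\mathcal Ff)(\varphi)=f(\mathcal F\varphi)$. Given a homogeneous quasi-norm, a generalized $\alpha$-covering $(P_i)$, a BAPU $(\psi_i)$ subordinate to it and points $\xi_i\in P_i$, the space $M^{s,\alpha}_{p,q}(G)$, for $s\in\mathbb R$ and $1\le p,q\le\infty$, consists of all $f\in Z'(\mathbb R^n)$ with $$\|f\|_{M^{s,\alpha}_{p,q}(G)}=\Big\|\big((1+\|\xi_i\|^2)^{s/2}\,\|\mathcal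 F^{-1}(\psi_i\cdot\mathcal Ff)\|_{L^p}\big)_{i\in I}\Big\|_{\ell^q(I)}<\infty .$$ **Proposition.** Let $1\le p,q<\infty$, $s\in\mathbb R$, $0\le\alpha<1$ and $\frac1p+\frac1{p'}=\frac1q+\frac1{q'}=1$. The dual space of $M^{s,\alpha}_{p,q}(G)$ is identified with $M^{-s,\alpha}_{p',q'}(G)$ by the extension of the sesquilinear pairing $\int\overline f\,g$. Precisely, for any choices (possibly different for the two spaces) of the quasi-norm, the covering, the BAPU and the points $\xi_i$, there is a conjugate-linear bijection $$\Lambda:M^{-s,\alpha}_{p',q'}(G)\to\big(M^{s,\alpha}_{p,q}(G)\big)^*,$$ continuous with continuous inverse, such that every $g\in Z(\mathbb R^n)$ (acting on $Z(\mathbb R^n)$ by $z\mapsto\int gz$) belongs to $M^{s,\alpha}_{p,q}(G)$ and $\Lambda(f)(g)=\overline{f(\overline g)}$ for all $f\in M^{-s,\alpha}_{p',q'}(G)$. -/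

import Mathlib

open MeasureTheory FourierTransform
open scoped ENNReal Distributions SchwartzMap ComplexConjugate

noncomputable section

namespace GenAlphaMod

/-- The space `ℝⁿ` with its Euclidean structure and Lebesgue measure. -/
abbrev E (n : ℕ) : Type := EuclideanSpace ℝ (Fin n)

/-! ### Admissible Lie groups -/

/-- The `j`-th layer `V_j` spanned by the basis vectors of degree `j`. -/
def layer {n : ℕ} {𝔤 : Type*} [LieRing 𝔤] [LieAlgebra ℝ 𝔤]
    (b : Module.Basis (Fin n) ℝ 𝔤) (deg : Fin n → ℕ) (j : ℕ) : Submodule ℝ 𝔤 :=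
  Submodule.span ℝ (b '' {i | deg i = j})

/-- An admissible Lie group of dimension `n`: a rational stratified Lie group of step at most two,
given by its Lie algebra `𝔤` with a stratification `𝔤 = V_1 ⊕ ⋯ ⊕ V_step` and a basis of `𝔤`
adapted to it (each basis vector has a degree, and `V_j` is spanned by those of degree `j`, so that
the sum of the layers is direct). -/
structure AdmissibleLieGroup (n : ℕ) (𝔤 : Type*) [LieRing 𝔤] [LieAlgebra ℝ 𝔤] where
  basis : Module.Basis (Fin n) ℝ 𝔤
  deg : Fin n → ℕ
  step : ℕ
  one_le_deg : ∀ i, 1 ≤ deg i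
  deg_le_step : ∀ i, deg i ≤ step
  /-- The top layer is not zero, so that `step` is indeed the step. -/
  exists_deg_eq_step : ∃ i, deg i = step
  /-- `[V_1, V_j] = V_{j+1}` for `1 ≤ j < step`. -/
  bracket_layer : ∀ j, 1 ≤ j → j < step →
    Submodule.span ℝ {z | ∃ x ∈ layer basis deg 1, ∃ y ∈ layer basis deg j, ⁅x, y⁆ = z} =
      layer basis deg (j + 1)
  /-- `[V_1, V_step] = 0`. -/
  bracket_top : ∀ x ∈ layer basis deg 1, ∀ y ∈ layer basis deg step, ⁅x, y⁆ = 0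
  step_le_two : step ≤ 2
  /-- Some basis of the Lie algebra has rational structure constants. -/
  rational : ∃ X : Module.Basis (Fin n) ℝ 𝔤, ∀ i j k, ∃ c : ℚ, X.repr ⁅X i, X j⁆ k = (c : ℝ)

namespace AdmissibleLieGroup

variable {n : ℕ} {𝔤 : Type*} [LieRing 𝔤] [LieAlgebra ℝ 𝔤] (G : AdmissibleLieGroup n 𝔤)

/-- The identification of the Lie algebra with `ℝⁿ` through the adapted basis. -/
def coord : 𝔤 ≃ₗ[ℝ] E n :=
  G.basis.equivFun.trans (WithLp.linearEquiv 2 ℝ (Fin n → ℝ)).symm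

/-- The group law on `ℝⁿ` in exponential coordinates. Since the step is at most two, the
Baker-Campbell-Hausdorff formula reads `x * y = x + y + [x, y] / 2`. The neutral element is `0` and
the inverse of `x` is `-x`. -/
def mul (x y : E n) : E n :=
  x + y + (1 / 2 : ℝ) • G.coord ⁅G.coord.symm x, G.coord.symm y⁆

/-- The dilations `D_r`, acting on the coordinate of degree `d` as multiplication by `r ^ d`. -/
def dil (r : ℝ) (x : E n) : E n := WithLp.toLp 2 fun i => r ^ G.deg i * x i

/-- The homogeneous dimension `∑ j, j * dim V_j`, that is the sum of all degrees. -/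
def homDim : ℕ := ∑ i, G.deg i

/-- Homogeneous quasi-norms: nonnegative continuous functions that are `1`-homogeneous,
symmetric, and vanish only at the neutral element. -/
structure IsHomQuasiNorm (ν : E n → ℝ) : Prop where
  continuous : Continuous ν
  nonneg : ∀ x, 0 ≤ ν x
  homogeneous : ∀ r : ℝ, 0 < r → ∀ x, ν (G.dil r x) = r * ν x
  symmetric : ∀ x, ν (-x) = ν x
  eq_zero : ∀ x, ν x = 0 → x = 0

/-- The ball of centre `c` and radius `R`: all `x` with `ν (c⁻¹ * x) < R`. -/
def ball (ν : E n → ℝ) (c : E n) (R : ℝ) : Set (E n) := {x | ν (G.mul (-c) x) < R}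

/-- The supremum of the radii of balls contained in `P`. -/
def innerRadius (ν : E n → ℝ) (P : Set (E n)) : ℝ≥0∞ :=
  ⨆ (c : E n) (r : ℝ) (_ : G.ball ν c r ⊆ P), ENNReal.ofReal r

/-- The infimum of the radii of balls containing `P`. -/
def outerRadius (ν : E n → ℝ) (P : Set (E n)) : ℝ≥0∞ :=
  ⨅ (c : E n) (R : ℝ) (_ : P ⊆ G.ball ν c R), ENNReal.ofReal R

end AdmissibleLieGroup

/-! ### Coverings and partitions of unity -/

/-- Admissible coverings of `ℝⁿ` by nonempty sets. -/
structure IsAdmissibleCovering {n : ℕ} {I : Type*} (P : I → Set (E n)) : Prop where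
  nonempty : ∀ i, (P i).Nonempty
  covers : ⋃ i, P i = Set.univ
  admissible : ∃ N : ℕ, ∀ i, {j | (P i ∩ P j).Nonempty}.encard ≤ N

/-- Generalized `α`-coverings for `G`, with respect to the homogeneous quasi-norm `ν`. -/
structure IsAlphaCovering {n : ℕ} {𝔤 : Type*} [LieRing 𝔤] [LieAlgebra ℝ 𝔤]
    (G : AdmissibleLieGroup n 𝔤) (ν : E n → ℝ) (α : ℝ) {I : Type*} (P : I → Set (E n)) : Prop
    extends IsAdmissibleCovering P where
  isOpen : ∀ i, IsOpen (P i)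
  isConnected : ∀ i, IsConnected (P i)
  /-- `|P i| ≍ (1 + ν(ξ)²) ^ (α Q / 2)` for all `ξ ∈ P i`, with constants independent of `i, ξ`. -/
  size : ∃ C : ℝ, 0 < C ∧ ∀ i, ∀ ξ ∈ P i,
    ENNReal.ofReal (C⁻¹ * (1 + ν ξ ^ 2) ^ (α * G.homDim / 2)) ≤ volume (P i) ∧
      volume (P i) ≤ ENNReal.ofReal (C * (1 + ν ξ ^ 2) ^ (α * G.homDim / 2))
  ratio : ∃ K : ℝ, 1 ≤ K ∧
    ∀ i, G.outerRadius ν (P i) ≤ ENNReal.ofReal K * G.innerRadius ν (P i)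

/-- Bounded admissible partitions of unity subordinate to a covering `P`, consisting of smooth
functions of compact support. -/
structure IsBAPU {n : ℕ} {I : Type*} (P : I → Set (E n))
    (ψ : I → 𝓓((⊤ : TopologicalSpace.Opens (E n)), ℝ)) : Prop where
  nonneg : ∀ i ξ, 0 ≤ ψ i ξ
  tsupport_subset : ∀ i, tsupport (ψ i) ⊆ P i
  hasSum_one : ∀ ξ, HasSum (fun i => ψ i ξ) 1
  bounded : ∃ C : ℝ, ∀ i,
    eLpNorm (𝓕⁻ (fun ξ => (ψ i ξ : ℂ))) 1 volume ≤ ENNReal.ofReal C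

/-- The choices made in the definition of the generalized `α`-modulation spaces of `G`: a
homogeneous quasi-norm `ν`, a generalized `α`-covering `P`, a partition of unity `ψ` subordinate
to `P`, and a point `ξ i` in each set `P i`. -/
structure AlphaModData {n : ℕ} {𝔤 : Type*} [LieRing 𝔤] [LieAlgebra ℝ 𝔤]
    (G : AdmissibleLieGroup n 𝔤) (α : ℝ) (I : Type*) where
  ν : E n → ℝ
  isHomQuasiNorm : G.IsHomQuasiNorm ν
  P : I → Set (E n)
  isAlphaCovering : IsAlphaCovering G ν α P
  ψ : I → 𝓓((⊤ : TopologicalSpace.Opens (E n)), ℝ)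
  isBAPU : IsBAPU P ψ
  ξ : I → E n
  ξ_mem : ∀ i, ξ i ∈ P i

/-! ### The Fourier type reservoir -/

/-- The space `C_c^∞(ℝⁿ)` of complex test functions with its usual (LF) topology. -/
abbrev Test (n : ℕ) : Type := 𝓓((⊤ : TopologicalSpace.Opens (E n)), ℂ)

/-- Test functions as Schwartz functions. -/
def testToSchwartz (n : ℕ) : Test n →ₗ[ℂ] 𝓢(E n, ℂ) where
  toFun φ := φ.hasCompactSupport.toSchwartzMap φ.contDiff
  map_add' _ _ := rfl
  map_smul' _ _ := rfl

/-- The Fourier transform of test functions. -/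
def fourierTest (n : ℕ) : Test n →ₗ[ℂ] 𝓢(E n, ℂ) where
  toFun φ := 𝓕 (testToSchwartz n φ)
  map_add' φ χ := by simp [FourierTransform.fourier_add]
  map_smul' c φ := by simp [FourierTransform.fourier_smul]

/-- The space `Z(ℝⁿ) = 𝓕(C_c^∞(ℝⁿ))`. -/
def ZSpace (n : ℕ) : Type := LinearMap.range (fourierTest n)

instance (n : ℕ) : AddCommGroup (ZSpace n) :=
  inferInstanceAs (AddCommGroup (LinearMap.range (fourierTest n)))

instance (n : ℕ) : Module ℂ (ZSpace n) :=
  inferInstanceAs (Module ℂ (LinearMap.range (fourierTest n)))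

/-- The Fourier transform as a (bijective) map from `C_c^∞(ℝⁿ)` to `Z(ℝⁿ)`. -/
def fourierZ (n : ℕ) : Test n →ₗ[ℂ] ZSpace n := (fourierTest n).rangeRestrict

/-- The topology transported from `C_c^∞(ℝⁿ)` by the Fourier transform. -/
instance (n : ℕ) : TopologicalSpace (ZSpace n) :=
  TopologicalSpace.coinduced (fourierZ n) inferInstance

lemma fourierTest_injective (n : ℕ) : Function.Injective (fourierTest n) := by
  intro φ χ h
  have h' : 𝓕⁻ (𝓕 (testToSchwartz n φ)) = 𝓕⁻ (𝓕 (testToSchwartz n χ)) := congrArg _ h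
  rw [FourierTransform.fourierInv_fourier_eq, FourierTransform.fourierInv_fourier_eq] at h'
  ext x
  exact DFunLike.congr_fun h' x

lemma fourierZ_injective (n : ℕ) : Function.Injective (fourierZ n) := fun _ _ h =>
  fourierTest_injective n (congrArg Subtype.val h)

lemma fourierZ_surjective (n : ℕ) : Function.Surjective (fourierZ n) :=
  (fourierTest n).surjective_rangeRestrict

/-- The Fourier type reservoir `Z'(ℝⁿ)`. -/
abbrev ZDual (n : ℕ) : Type := ZSpace n →L[ℂ] ℂ

/-- The Fourier transform `Z'(ℝⁿ) → 𝓓'(ℝⁿ)`, `(𝓕 f)(φ) = f (𝓕 φ)`. -/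
def ZDual.fourier {n : ℕ} (f : ZDual n) : Test n →L[ℂ] ℂ where
  toLinearMap := f.toLinearMap ∘ₗ fourierZ n
  cont := f.continuous.comp continuous_coinduced_rng

lemma integrable_mul_schwartz {n : ℕ} {p q : ℝ≥0∞} [ENNReal.HolderTriple p q 1] {h : E n → ℂ}
    (hh : MemLp h p volume) (g : 𝓢(E n, ℂ)) : Integrable (fun x => h x * g x) volume :=
  hh.integrable_mul (g.memLp q volume)

/-- The function `𝓕⁻¹ φ ∈ Z(ℝⁿ)`, for a test function `φ`, as the element
`z ↦ ∫ (𝓕⁻¹ φ) z` of `Z'(ℝⁿ)`. -/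
def zOfTest {n : ℕ} (φ : Test n) : ZDual n where
  toFun z := ∫ x, (𝓕⁻ (testToSchwartz n φ)) x * z.1 x
  map_add' z w := by
    have h : ∀ v : 𝓢(E n, ℂ), Integrable (fun x => (𝓕⁻ (testToSchwartz n φ)) x * v x) volume :=
      fun v => integrable_mul_schwartz (p := 2) (q := 2) (SchwartzMap.memLp _ _ _) v
    rw [← integral_add (h z.1) (h w.1)]
    exact integral_congr_ae (.of_forall fun x => mul_add _ _ _)
  map_smul' c z := by
    rw [RingHom.id_apply, smul_eq_mul, ← integral_const_mul]
    exact integral_congr_ae (.of_forall fun x => mul_left_comm _ _ _)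
  cont := by
    refine continuous_coinduced_dom.2 ?_
    refine (TestFunction.integralAgainstBilinCLM (ContinuousLinearMap.mul ℂ ℂ) volume
      (φ : E n → ℂ)).continuous.congr fun χ => ?_
    rw [TestFunction.integralAgainstBilinCLM_eq_integral
      (φ.continuous.locallyIntegrable.locallyIntegrableOn _)]
    have h := SchwartzMap.integral_fourier_mul_eq (testToSchwartz n χ)
      (𝓕⁻ (testToSchwartz n φ))
    rw [FourierTransform.fourier_fourierInv_eq] at h
    exact h.symm.trans (integral_congr_ae (.of_forall fun x => mul_comm _ _))

/-- The complex conjugate of a test function. -/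
def conjTest {n : ℕ} (φ : Test n) : Test n :=
  TestFunction.postcompCLM (𝕜 := ℝ) (Complex.conjCLE : ℂ →L[ℝ] ℂ) φ

/-! ### The generalized `α`-modulation spaces -/

/-- The product of a real test function with a Schwartz function, as a test function. -/
def mulTest {n : ℕ} (ψ : 𝓓((⊤ : TopologicalSpace.Opens (E n)), ℝ)) :
    𝓢(E n, ℂ) →ₗ[ℂ] Test n where
  toFun g :=
    { toFun := fun ξ => (ψ ξ : ℂ) * g ξ
      contDiff' := (Complex.ofRealCLM.contDiff.comp ψ.contDiff).mul (g.smooth _)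
      hasCompactSupport' := by
        have h : HasCompactSupport fun ξ => (ψ ξ : ℂ) :=
          ψ.hasCompactSupport.comp_left (g := fun r : ℝ => (r : ℂ)) Complex.ofReal_zero
        exact h.mul_right
      tsupport_subset' := fun _ _ => trivial }
  map_add' g h := by
    ext ξ
    exact mul_add _ _ _
  map_smul' c g := by
    ext ξ
    exact mul_left_comm _ _ _

/-- The tempered distribution `𝓕⁻¹ (ψ · 𝓕 f)`, that is `g ↦ (𝓕 f)(ψ · 𝓕⁻¹ g)`. -/
def freqBlock {n : ℕ} (ψ : 𝓓((⊤ : TopologicalSpace.Opens (E n)), ℝ)) (f : ZDual n) :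
    𝓢(E n, ℂ) →ₗ[ℂ] ℂ where
  toFun g := f.fourier (mulTest ψ (𝓕⁻ g))
  map_add' g h := by simp [FourierTransform.fourierInv_add]
  map_smul' c g := by simp [FourierTransform.fourierInv_smul]

/-- The `L^p` norm of a functional on Schwartz functions: the `L^p` norm of the (almost everywhere
unique) function `h` in `L^p` that represents it, and `∞` if there is none. -/
def distLpENorm {n : ℕ} (p : ℝ≥0∞) (u : 𝓢(E n, ℂ) →ₗ[ℂ] ℂ) : ℝ≥0∞ :=
  ⨅ (h : E n → ℂ) (_ : MemLp h p volume) (_ : ∀ g : 𝓢(E n, ℂ), u g = ∫ x, h x * g x),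
    eLpNorm h p volume

/-- The `ℓ^q` norm of a family of extended nonnegative reals. -/
def lqENorm {I : Type*} (q : ℝ≥0∞) (a : I → ℝ≥0∞) : ℝ≥0∞ :=
  if q = ∞ then ⨆ i, a i else (∑' i, a i ^ q.toReal) ^ (1 / q.toReal)

lemma lqENorm_mono {I : Type*} (q : ℝ≥0∞) {a b : I → ℝ≥0∞} (h : ∀ i, a i ≤ b i) :
    lqENorm q a ≤ lqENorm q b := by
  unfold lqENorm
  split_ifs with hq
  · exact iSup_mono h
  · have h0 := ENNReal.toReal_nonneg (a := q)
    gcongr with i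
    exact h i

lemma lqENorm_add_le {I : Type*} {q : ℝ≥0∞} (hq : 1 ≤ q) (a b : I → ℝ≥0∞) :
    lqENorm q (fun i => a i + b i) ≤ lqENorm q a + lqENorm q b := by
  unfold lqENorm
  split_ifs with h
  · exact iSup_le fun i => add_le_add (le_iSup a i) (le_iSup b i)
  · have h1 : 1 ≤ q.toReal := by simpa using ENNReal.toReal_mono h hq
    have h0 : 0 < q.toReal := by linarith
    have key : ∀ F : Finset I, ∑ i ∈ F, (a i + b i) ^ q.toReal ≤
        ((∑' i, a i ^ q.toReal) ^ (1 / q.toReal) +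
          (∑' i, b i ^ q.toReal) ^ (1 / q.toReal)) ^ q.toReal := by
      intro F
      have h2 := ENNReal.Lp_add_le F a b h1
      have h3 : (∑ i ∈ F, (a i + b i) ^ q.toReal) ^ (1 / q.toReal) ≤
          (∑' i, a i ^ q.toReal) ^ (1 / q.toReal) + (∑' i, b i ^ q.toReal) ^ (1 / q.toReal) := by
        refine h2.trans ?_
        gcongr <;> exact ENNReal.sum_le_tsum F
      rwa [one_div, ENNReal.rpow_inv_le_iff h0, ← one_div] at h3
    rw [one_div, ENNReal.rpow_inv_le_iff h0, ← one_div, ENNReal.tsum_eq_iSup_sum]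
    exact iSup_le key

lemma lqENorm_const_mul {I : Type*} {q : ℝ≥0∞} (hq : 1 ≤ q) (c : ℝ≥0∞) (a : I → ℝ≥0∞) :
    lqENorm q (fun i => c * a i) = c * lqENorm q a := by
  unfold lqENorm
  split_ifs with h
  · rw [ENNReal.mul_iSup]
  · have h1 : 1 ≤ q.toReal := by simpa using ENNReal.toReal_mono h hq
    have h0 : 0 < q.toReal := by linarith
    simp_rw [ENNReal.mul_rpow_of_nonneg _ _ h0.le]
    rw [ENNReal.tsum_mul_left, ENNReal.mul_rpow_of_nonneg _ _ (by positivity), ← ENNReal.rpow_mul,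
      mul_one_div_cancel h0.ne', ENNReal.rpow_one]

lemma eq_zero_of_lqENorm_eq_zero {I : Type*} {q : ℝ≥0∞} (hq : 1 ≤ q) {a : I → ℝ≥0∞}
    (h : lqENorm q a = 0) (i : I) : a i = 0 := by
  unfold lqENorm at h
  split_ifs at h with hq'
  · exact le_antisymm ((le_iSup a i).trans h.le) zero_le
  · have h1 : 1 ≤ q.toReal := by simpa using ENNReal.toReal_mono hq' hq
    have h0 : 0 < q.toReal := by linarith
    rw [ENNReal.rpow_eq_zero_iff_of_pos (by positivity), ENNReal.tsum_eq_zero] at h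
    exact (ENNReal.rpow_eq_zero_iff_of_pos h0).1 (h i)

lemma distLpENorm_zero {n : ℕ} (p : ℝ≥0∞) :
    distLpENorm p (0 : 𝓢(E n, ℂ) →ₗ[ℂ] ℂ) = 0 := by
  refine le_antisymm ?_ zero_le
  refine iInf_le_of_le 0 (iInf_le_of_le MemLp.zero (iInf_le_of_le ?_ ?_)) <;> simp

lemma distLpENorm_add_le {n : ℕ} {p : ℝ≥0∞} [hp : Fact (1 ≤ p)] (u v : 𝓢(E n, ℂ) →ₗ[ℂ] ℂ) :
    distLpENorm p (u + v) ≤ distLpENorm p u + distLpENorm p v := by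
  unfold distLpENorm
  simp only [ENNReal.iInf_add, ENNReal.add_iInf]
  refine le_iInf fun k => le_iInf fun hk => le_iInf fun hku => le_iInf fun h => le_iInf fun hh =>
    le_iInf fun hhu => ?_
  have := ENNReal.HolderConjugate.conjExponent hp.out
  refine iInf_le_of_le (h + k) (iInf_le_of_le (hh.add hk) (iInf_le_of_le (fun g => ?_)
    (eLpNorm_add_le hh.1 hk.1 hp.out)))
  rw [LinearMap.add_apply, hku, hhu, ← integral_add
    (integrable_mul_schwartz (q := p.conjExponent) hh g)
    (integrable_mul_schwartz (q := p.conjExponent) hk g)]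
  exact integral_congr_ae (.of_forall fun x => (add_mul _ _ _).symm)

lemma distLpENorm_smul_le {n : ℕ} {p : ℝ≥0∞} (c : ℂ) (u : 𝓢(E n, ℂ) →ₗ[ℂ] ℂ) :
    distLpENorm p (c • u) ≤ ‖c‖ₑ * distLpENorm p u := by
  rcases eq_or_ne c 0 with rfl | hc
  · simp [distLpENorm_zero]
  have hc0 : ‖c‖ₑ ≠ 0 := by simpa using hc
  have hct : ‖c‖ₑ ≠ ∞ := enorm_ne_top
  unfold distLpENorm
  simp only [ENNReal.mul_iInf_of_ne hc0 hct]
  refine le_iInf fun h => le_iInf fun hh => le_iInf fun hhu => ?_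
  refine iInf_le_of_le (c • h) (iInf_le_of_le (hh.const_smul c) (iInf_le_of_le (fun g => ?_)
    (eLpNorm_const_smul c h p volume).le))
  rw [LinearMap.smul_apply, hhu, smul_eq_mul, ← integral_const_mul]
  exact integral_congr_ae (.of_forall fun x => (mul_assoc _ _ _).symm)

lemma eq_zero_of_distLpENorm_eq_zero {n : ℕ} {p : ℝ≥0∞} [hp : Fact (1 ≤ p)]
    {u : 𝓢(E n, ℂ) →ₗ[ℂ] ℂ} (hu : distLpENorm p u = 0) : u = 0 := by
  ext g
  rw [LinearMap.zero_apply, ← enorm_eq_zero]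
  have key : ∀ h : E n → ℂ, MemLp h p volume → (∀ g : 𝓢(E n, ℂ), u g = ∫ x, h x * g x) →
      ‖u g‖ₑ ≤ eLpNorm g p.conjExponent volume * eLpNorm h p volume := by
    intro h hh hhu
    rw [hhu g, mul_comm]
    refine (enorm_integral_le_lintegral_enorm _).trans ?_
    rw [← eLpNorm_one_eq_lintegral_enorm]
    exact eLpNorm_smul_le_mul_eLpNorm (φ := h) (f := g) (p := p) (q := p.conjExponent)
      g.continuous.aestronglyMeasurable hh.1
  have hg : eLpNorm g p.conjExponent volume ≠ ∞ := (g.memLp _ _).2.ne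
  rcases eq_or_ne (eLpNorm g p.conjExponent volume) 0 with h0 | h0
  · by_contra hne
    refine ENNReal.zero_ne_top (hu.symm.trans ?_)
    refine iInf_eq_top.2 fun h => iInf_eq_top.2 fun hh => iInf_eq_top.2 fun hhu => ?_
    have h1 := key h hh hhu
    rw [h0, zero_mul] at h1
    exact absurd (le_antisymm h1 zero_le) hne
  · have h1 : ‖u g‖ₑ ≤ eLpNorm g p.conjExponent volume * distLpENorm p u := by
      unfold distLpENorm
      simp only [ENNReal.mul_iInf_of_ne h0 hg]
      exact le_iInf fun h => le_iInf fun hh => le_iInf fun hhu => key h hh hhu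
    rw [hu, mul_zero] at h1
    exact le_antisymm h1 zero_le

lemma freqBlock_zero {n : ℕ} (ψ : 𝓓((⊤ : TopologicalSpace.Opens (E n)), ℝ)) :
    freqBlock ψ 0 = 0 := rfl

lemma freqBlock_add {n : ℕ} (ψ : 𝓓((⊤ : TopologicalSpace.Opens (E n)), ℝ)) (f g : ZDual n) :
    freqBlock ψ (f + g) = freqBlock ψ f + freqBlock ψ g := rfl

lemma freqBlock_smul {n : ℕ} (ψ : 𝓓((⊤ : TopologicalSpace.Opens (E n)), ℝ)) (c : ℂ)
    (f : ZDual n) : freqBlock ψ (c • f) = c • freqBlock ψ f := rfl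

/-- A Fourier type distribution all of whose frequency blocks vanish is zero. -/
lemma eq_zero_of_freqBlock_eq_zero {n : ℕ} {I : Type*} {P : I → Set (E n)}
    (hP : IsAdmissibleCovering P) (hPo : ∀ i, IsOpen (P i))
    {ψ : I → 𝓓((⊤ : TopologicalSpace.Opens (E n)), ℝ)} (hψ : IsBAPU P ψ) {f : ZDual n}
    (hf : ∀ i, freqBlock (ψ i) f = 0) : f = 0 := by
  classical
  have h0 : ∀ φ : Test n, f.fourier φ = 0 := by
    intro φ
    obtain ⟨N, hN⟩ := hP.admissible
    have hK : IsCompact (tsupport φ) := φ.hasCompactSupport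
    obtain ⟨J, hJ⟩ := hK.elim_finite_subcover P hPo (by rw [hP.covers]; exact Set.subset_univ _)
    have hfin : (⋃ j ∈ J, {i | (P j ∩ P i).Nonempty}).Finite :=
      J.finite_toSet.biUnion fun j _ =>
        Set.finite_of_encard_le_coe (hN j)
    have hsum : φ = ∑ i ∈ hfin.toFinset, mulTest (ψ i) (testToSchwartz n φ) := by
      ext ξ
      have hev : (∑ i ∈ hfin.toFinset, mulTest (ψ i) (testToSchwartz n φ)) ξ =
          ∑ i ∈ hfin.toFinset, (ψ i ξ : ℂ) * φ ξ := by
        rw [FunLike.coe_sum, Finset.sum_apply]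
        rfl
      rw [hev, ← Finset.sum_mul]
      rcases eq_or_ne (φ ξ) 0 with hz | hz
      · simp [hz]
      have hξ : ξ ∈ ⋃ j ∈ J, P j := hJ (subset_tsupport _ hz)
      obtain ⟨j, hj, hξj⟩ := Set.mem_iUnion₂.1 hξ
      have h1 : ∑ i ∈ hfin.toFinset, ψ i ξ = 1 := by
        refine (hasSum_sum_of_ne_finset_zero fun i hi => ?_).unique (hψ.hasSum_one ξ)
        by_contra hne
        refine hi (hfin.mem_toFinset.2 (Set.mem_iUnion₂.2 ⟨j, hj, ξ, hξj, ?_⟩))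
        exact hψ.tsupport_subset i (subset_tsupport _ hne)
      have h2 : ∑ i ∈ hfin.toFinset, (ψ i ξ : ℂ) = 1 := by exact_mod_cast h1
      rw [h2, one_mul]
    rw [hsum, map_sum]
    refine Finset.sum_eq_zero fun i _ => ?_
    have h3 := LinearMap.congr_fun (hf i) (𝓕 (testToSchwartz n φ))
    change f.fourier (mulTest (ψ i) (𝓕⁻ (𝓕 (testToSchwartz n φ)))) = 0 at h3
    rwa [FourierTransform.fourierInv_fourier_eq] at h3
  ext z
  obtain ⟨φ, rfl⟩ := fourierZ_surjective n z
  exact h0 φ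

section Spaces

variable {n : ℕ} {𝔤 : Type*} [LieRing 𝔤] [LieAlgebra ℝ 𝔤]
  {G : AdmissibleLieGroup n 𝔤} {α : ℝ} {I : Type*}

/-- The (possibly infinite) norm of `M^{s,α}_{p,q}(G)`. -/
def alphaModENorm (d : AlphaModData G α I) (s : ℝ) (p q : ℝ≥0∞) (f : ZDual n) : ℝ≥0∞ :=
  lqENorm q fun i =>
    ENNReal.ofReal ((1 + d.ν (d.ξ i) ^ 2) ^ (s / 2)) * distLpENorm p (freqBlock (d.ψ i) f)


variable (d : AlphaModData G α I) (s : ℝ) (p q : ℝ≥0∞) [hp : Fact (1 ≤ p)] [hq : Fact (1 ≤ q)]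

lemma alphaModENorm_zero : alphaModENorm d s p q 0 = 0 := by
  have h := lqENorm_const_mul (I := I) hq.out 0 0
  simp only [zero_mul] at h
  simp only [alphaModENorm, freqBlock_zero, distLpENorm_zero, mul_zero]
  exact h

lemma alphaModENorm_add_le (f g : ZDual n) :
    alphaModENorm d s p q (f + g) ≤ alphaModENorm d s p q f + alphaModENorm d s p q g := by
  refine (lqENorm_mono q fun i => ?_).trans (lqENorm_add_le hq.out _ _)
  rw [freqBlock_add, ← mul_add]
  gcongr
  exact distLpENorm_add_le _ _

lemma alphaModENorm_smul_le (c : ℂ) (f : ZDual n) :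
    alphaModENorm d s p q (c • f) ≤ ‖c‖ₑ * alphaModENorm d s p q f := by
  refine (lqENorm_mono q fun i => ?_).trans (lqENorm_const_mul hq.out _ _).le
  rw [freqBlock_smul, mul_left_comm]
  gcongr
  exact distLpENorm_smul_le _ _

lemma alphaModENorm_smul (c : ℂ) (f : ZDual n) :
    alphaModENorm d s p q (c • f) = ‖c‖ₑ * alphaModENorm d s p q f := by
  rcases eq_or_ne c 0 with rfl | hc
  · rw [zero_smul ℂ f, alphaModENorm_zero, enorm_zero, zero_mul]
  refine le_antisymm (alphaModENorm_smul_le d s p q c f) ?_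
  have h := alphaModENorm_smul_le d s p q c⁻¹ (c • f)
  rw [inv_smul_smul₀ hc] at h
  calc ‖c‖ₑ * alphaModENorm d s p q f
      ≤ ‖c‖ₑ * (‖c⁻¹‖ₑ * alphaModENorm d s p q (c • f)) := by gcongr
    _ = alphaModENorm d s p q (c • f) := by
      rw [← mul_assoc, ← enorm_mul, mul_inv_cancel₀ hc, enorm_one, one_mul]

lemma eq_zero_of_alphaModENorm_eq_zero {f : ZDual n} (hf : alphaModENorm d s p q f = 0) :
    f = 0 := by
  refine eq_zero_of_freqBlock_eq_zero d.isAlphaCovering.toIsAdmissibleCovering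
    d.isAlphaCovering.isOpen d.isBAPU fun i => eq_zero_of_distLpENorm_eq_zero (p := p) ?_
  have h := eq_zero_of_lqENorm_eq_zero hq.out hf i
  have hw : ENNReal.ofReal ((1 + d.ν (d.ξ i) ^ 2) ^ (s / 2)) ≠ 0 := by
    rw [Ne, ENNReal.ofReal_eq_zero, not_le]
    positivity
  exact (mul_eq_zero.1 h).resolve_left hw

/-- `M^{s,α}_{p,q}(G)` as a linear subspace of `Z'(ℝⁿ)`. -/
def alphaModSubmodule : Submodule ℂ (ZDual n) where
  carrier := {f | alphaModENorm d s p q f < ∞}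
  zero_mem' := by simp [alphaModENorm_zero]
  add_mem' {f g} hf hg :=
    (alphaModENorm_add_le d s p q f g).trans_lt (ENNReal.add_lt_top.2 ⟨hf, hg⟩)
  smul_mem' c f hf :=
    (alphaModENorm_smul_le d s p q c f).trans_lt (ENNReal.mul_lt_top enorm_lt_top hf)

/-- The generalized `α`-modulation space `M^{s,α}_{p,q}(G)`, with its norm. -/
def AlphaModSpace : Type := alphaModSubmodule d s p q

instance : AddCommGroup (AlphaModSpace d s p q) :=
  inferInstanceAs (AddCommGroup (alphaModSubmodule d s p q))

instance : Module ℂ (AlphaModSpace d s p q) :=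
  inferInstanceAs (Module ℂ (alphaModSubmodule d s p q))

instance : Norm (AlphaModSpace d s p q) where
  norm f := (alphaModENorm d s p q f.1).toReal

lemma alphaMod_core : NormedSpace.Core ℂ (AlphaModSpace d s p q) where
  norm_nonneg _ := ENNReal.toReal_nonneg
  norm_smul c f := by
    change (alphaModENorm d s p q (c • f.1)).toReal = _ * (alphaModENorm d s p q f.1).toReal
    rw [alphaModENorm_smul, ENNReal.toReal_mul, toReal_enorm]
  norm_triangle f g := by
    change (alphaModENorm d s p q (f.1 + g.1)).toReal ≤ _
    refine (ENNReal.toReal_mono ?_ (alphaModENorm_add_le d s p q f.1 g.1)).trans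
      ENNReal.toReal_add_le
    exact (ENNReal.add_lt_top.2 ⟨f.2, g.2⟩).ne
  norm_eq_zero_iff f := by
    constructor
    · intro h
      refine Subtype.ext (eq_zero_of_alphaModENorm_eq_zero d s p q ?_)
      exact ((ENNReal.toReal_eq_zero_iff _).1 h).resolve_right (ne_of_lt f.2)
    · rintro rfl
      change (alphaModENorm d s p q 0).toReal = 0
      rw [alphaModENorm_zero, ENNReal.toReal_zero]

instance : NormedAddCommGroup (AlphaModSpace d s p q) :=
  NormedAddCommGroup.ofCore (alphaMod_core d s p q)

instance : NormedSpace ℂ (AlphaModSpace d s p q) :=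
  NormedSpace.ofCore (alphaMod_core d s p q)

end Spaces

end GenAlphaMod

end

open GenAlphaMod

/-!
On the Fourier side, the pairing of `f` and `g` is the sum over `i`, `j` of the pairings of the
frequency blocks `ψ'_j ℱ f` and `ψ_i ℱ g`, and only the pairs with `P_i ∩ P'_j ≠ ∅` contribute.
Since the number of such pairs is bounded for each `i` and for each `j`, and the weights of the two
coverings are comparable on them, Hölder's inequality in `L^p` and in `ℓ^q` bounds the pairing by
the product of the two norms. As `p` and `q` are finite, `Z` is dense: cut `g` to finitely many
blocks and approximate each of them by Schwartz functions. Hence the pairing extends.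

Conversely, a bounded functional `ℓ` restricts to a continuous functional on `Z`, that is, to an
element `f` of `Z'`. Applying `ℓ` to finite sums of functions with Fourier transforms `ψ'_j ℱ g_j`,
for arbitrary Schwartz functions `g_j`, tests the blocks of `f` against finitely supported
sequences, and the duality of `ℓ^q(L^p)` with `ℓ^{q'}(L^{p'})` bounds the norm of `f` by `‖ℓ‖`.
-/

noncomputable section

namespace GenAlphaMod

open Filter Topology

/-! ### The dual of `L^p` -/

section LpDual

variable {X : Type*} [MeasurableSpace X] {μ : Measure X} {p p' : ℝ≥0∞}

lemma exists_pos_memLp [SigmaFinite μ] (h1 : 1 ≤ p) (hp : p ≠ ∞) :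
    ∃ G : X → ℝ, Measurable G ∧ (∀ x, 0 < G x) ∧ MemLp G p μ := by
  obtain ⟨g, hg0, hgm, hgi⟩ := exists_pos_lintegral_lt_of_sigmaFinite μ one_ne_zero
  have hm : Measurable fun x => min (g x : ℝ) 1 := hgm.coe_nnreal_real.min measurable_const
  have hpos : ∀ x, 0 < min (g x : ℝ) 1 := fun x => lt_min (by exact_mod_cast hg0 x) one_pos
  refine ⟨fun x => min (g x : ℝ) 1, hm, hpos, ?_⟩
  have hpr : 1 ≤ p.toReal := by simpa using ENNReal.toReal_mono hp h1
  rw [← integrable_norm_rpow_iff hm.aestronglyMeasurable (zero_lt_one.trans_le h1).ne' hp]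
  have hgint : Integrable (fun x => (g x : ℝ)) μ :=
    ⟨hgm.coe_nnreal_real.aestronglyMeasurable,
      by simpa [HasFiniteIntegral] using hgi.trans ENNReal.one_lt_top⟩
  refine hgint.mono' (hm.norm.pow_const _).aestronglyMeasurable (.of_forall fun x => ?_)
  rw [Real.norm_of_nonneg (by positivity), Real.norm_of_nonneg (hpos x).le]
  calc (min (g x : ℝ) 1) ^ p.toReal ≤ (min (g x : ℝ) 1) ^ (1 : ℝ) :=
        Real.rpow_le_rpow_of_exponent_ge (hpos x) (min_le_right _ _) hpr
    _ ≤ g x := (Real.rpow_one _).trans_le (min_le_left _ _)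

lemma tendsto_eLpNorm_sub_of_dominated {ι F : Type*} [NormedAddCommGroup F] {l : Filter ι}
    [l.IsCountablyGenerated] (h1 : 1 ≤ p) (hp : p ≠ ∞) {u : ι → X → F} {f : X → F} {g : X → ℝ}
    (hu : ∀ k, AEStronglyMeasurable (u k) μ) (hf : AEStronglyMeasurable f μ) (hg : MemLp g p μ)
    (hug : ∀ k x, ‖u k x‖ ≤ g x) (hfg : ∀ x, ‖f x‖ ≤ g x)
    (hlim : ∀ x, Tendsto (fun k => u k x) l (𝓝 (f x))) :
    Tendsto (fun k => eLpNorm (u k - f) p μ) l (𝓝 0) := by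
  have hp0 : p ≠ 0 := (zero_lt_one.trans_le h1).ne'
  have hpr : 0 < p.toReal := ENNReal.toReal_pos hp0 hp
  have hcont : ∀ r : ℝ, 0 < r → Tendsto (fun a : ℝ≥0∞ => a ^ r) (𝓝 0) (𝓝 0) := fun r hr => by
    simpa only [ENNReal.zero_rpow_of_pos hr] using
      (ENNReal.continuous_rpow_const (y := r)).tendsto 0
  simp_rw [eLpNorm_eq_lintegral_rpow_enorm_toReal hp0 hp]
  refine (hcont _ (by positivity)).comp ?_
  rw [← lintegral_zero (μ := μ)]
  refine tendsto_lintegral_filter_of_dominated_convergence' (fun x => ‖2 * g x‖ₑ ^ p.toReal)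
    (.of_forall fun k => ((hu k).sub hf).enorm.pow_const _)
    (.of_forall fun k => .of_forall fun x => ?_)
    (lintegral_rpow_enorm_lt_top_of_eLpNorm_lt_top hp0 hp (hg.const_mul 2).2).ne
    (.of_forall fun x => (hcont _ hpr).comp ?_)
  · gcongr
    rw [enorm_le_iff_norm_le, Pi.sub_apply, Real.norm_eq_abs]
    linarith [norm_sub_le (u k x) (f x), hug k x, hfg x, le_abs_self (2 * g x)]
  · simpa using ((hlim x).sub_const (f x)).enorm

lemma map_toLp_of_ae_eq_zero [Fact (1 ≤ p)] (L : Lp ℂ p μ →L[ℂ] ℂ) {F : X → ℂ} (hF : MemLp F p μ)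
    (h0 : F =ᵐ[μ] 0) : L hF.toLp = 0 := by
  rw [Lp.eq_zero_iff_ae_eq_zero.2 (hF.coeFn_toLp.trans h0), map_zero]

lemma hasSum_functional_indicator [Fact (1 ≤ p)] (hp : p ≠ ∞) (L : Lp ℂ p μ →L[ℂ] ℂ) {G : X → ℂ}
    (hG : MemLp G p μ) {A : ℕ → Set X} (hA : ∀ i, MeasurableSet (A i))
    (hd : Pairwise (Function.onFun Disjoint A)) :
    HasSum (fun i => L (hG.indicator (hA i)).toLp)
      (L (hG.indicator (MeasurableSet.iUnion hA)).toLp) := by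
  refine HasSum.mapL L ?_
  have hU : ∀ s : Finset ℕ, MeasurableSet (⋃ i ∈ s, A i) := fun s =>
    s.measurableSet_biUnion fun i _ => hA i
  have hsum : ∀ s : Finset ℕ, ∑ i ∈ s, (hG.indicator (hA i)).toLp =
      (hG.indicator (hU s)).toLp := by
    intro s
    refine Lp.ext ((Lp.coeFn_finsetSum _ _).trans ?_)
    filter_upwards [(hG.indicator (hU s)).coeFn_toLp, (ae_ball_iff s.countable_toSet).2
      fun i _ => (hG.indicator (hA i)).coeFn_toLp] with x hxU hx
    rw [hxU, Finset.sum_apply, Finset.indicator_biUnion_apply s A fun i _ j _ hij => hd hij]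
    exact Finset.sum_congr rfl hx
  simp only [HasSum, SummationFilter.unconditional_filter, hsum]
  rw [Lp.tendsto_Lp_iff_tendsto_eLpNorm'']
  exact tendsto_eLpNorm_sub_of_dominated Fact.out hp (fun s => (hG.indicator (hU s)).1)
    (hG.indicator (MeasurableSet.iUnion hA)).1 hG.norm
    (fun s x => norm_indicator_le_norm_self _ _) (fun x => norm_indicator_le_norm_self _ _)
    fun x => (tendsto_indicator_biUnion_finset A G x).mono_right (pure_le_nhds _)

/-- The complex measure `A ↦ L (1_A G)` attached to a functional `L` on `L^p` and a function `G` in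
`L^p`. For an infinite measure `μ` the indicator functions alone would not do. -/
def functionalMeasure [Fact (1 ≤ p)] (hp : p ≠ ∞) (L : Lp ℂ p μ →L[ℂ] ℂ) {G : X → ℂ}
    (hG : MemLp G p μ) : ComplexMeasure X := by
  classical exact
  { measureOf' := fun A => if hA : MeasurableSet A then L (hG.indicator hA).toLp else 0
    empty' := by
      rw [dif_pos MeasurableSet.empty]
      exact map_toLp_of_ae_eq_zero L _ (.of_forall fun x => by simp)
    not_measurable' := fun A hA => dif_neg hA
    m_iUnion' := fun A hA hd => by
      simp_rw [dif_pos (hA _), dif_pos (MeasurableSet.iUnion hA)]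
      exact hasSum_functional_indicator hp L hG hA hd }

lemma functionalMeasure_apply [Fact (1 ≤ p)] (hp : p ≠ ∞) (L : Lp ℂ p μ →L[ℂ] ℂ) {G : X → ℂ}
    (hG : MemLp G p μ) {A : Set X} (hA : MeasurableSet A) :
    functionalMeasure hp L hG A = L (hG.indicator hA).toLp := dif_pos hA

lemma functionalMeasure_absolutelyContinuous [Fact (1 ≤ p)] (hp : p ≠ ∞) (L : Lp ℂ p μ →L[ℂ] ℂ)
    {G : X → ℂ} (hG : MemLp G p μ) :
    functionalMeasure hp L hG ≪ᵥ μ.toENNRealVectorMeasure := by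
  refine VectorMeasure.AbsolutelyContinuous.mk fun A hA h0 => ?_
  rw [Measure.toENNRealVectorMeasure_apply_measurable hA] at h0
  rw [functionalMeasure_apply hp L hG hA]
  exact map_toLp_of_ae_eq_zero L _ (indicator_meas_zero h0)

lemma exists_integrable_forall_eq_setIntegral [SigmaFinite μ] {c : ComplexMeasure X}
    (hc : c ≪ᵥ μ.toENNRealVectorMeasure) :
    ∃ h : X → ℂ, Measurable h ∧ Integrable h μ ∧ ∀ A, MeasurableSet A → c A = ∫ x in A, h x ∂μ := by
  obtain ⟨hre, him⟩ := (ComplexMeasure.absolutelyContinuous_ennreal_iff c _).1 hc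
  have hder : ∀ m : SignedMeasure X, m ≪ᵥ μ.toENNRealVectorMeasure →
      ∀ A, MeasurableSet A → m A = ∫ x in A, m.rnDeriv μ x ∂μ := fun m hm A hA => by
    rw [← withDensityᵥ_apply (SignedMeasure.integrable_rnDeriv _ _) hA,
      SignedMeasure.withDensityᵥ_rnDeriv_eq _ _ hm]
  refine ⟨c.rnDeriv μ, Complex.measurableEquivRealProd.symm.measurable.comp
    ((SignedMeasure.measurable_rnDeriv _ _).prodMk (SignedMeasure.measurable_rnDeriv _ _)),
    c.integrable_rnDeriv μ, fun A hA => ?_⟩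
  rw [← integral_re_add_im (c.integrable_rnDeriv μ).integrableOn]
  exact (Complex.re_add_im (c A)).symm.trans
    (congrArg₂ (fun a b : ℝ => (a : ℂ) + b * Complex.I) (hder _ hre A hA) (hder _ him A hA))

end LpDual

section LpDual

variable {X : Type*} [MeasurableSpace X] {μ : Measure X} {p p' : ℝ≥0∞}

lemma functional_simpleFunc_mul_eq_integral [Fact (1 ≤ p)] {L : Lp ℂ p μ →L[ℂ] ℂ} {G : X → ℂ}
    (hG : MemLp G p μ) {h : X → ℂ} (hi : Integrable h μ)
    (hL : ∀ (A : Set X) (hA : MeasurableSet A), L (hG.indicator hA).toLp = ∫ x in A, h x ∂μ)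
    (t : SimpleFunc X ℂ) (ht : MemLp (fun x => t x * G x) p μ) :
    L ht.toLp = ∫ x, h x * t x ∂μ := by
  induction t using SimpleFunc.induction with
  | @const c A hA =>
    have htG : ht.toLp = c • (hG.indicator hA).toLp := by
      rw [← MemLp.toLp_const_smul]
      refine MemLp.toLp_congr _ _ (.of_forall fun x => ?_)
      by_cases hx : x ∈ A <;> simp [hx]
    rw [htG, map_smul, hL A hA, smul_eq_mul, ← integral_const_mul, ← integral_indicator hA]
    refine integral_congr_ae (.of_forall fun x => ?_)
    by_cases hx : x ∈ A <;> simp [hx, mul_comm]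
  | @add f g _ hf hg =>
    have hmem : ∀ r : SimpleFunc X ℂ, MemLp (fun x => r x * G x) p μ := fun r => by
      obtain ⟨C, hC⟩ := r.exists_forall_norm_le
      refine hG.of_le_mul (c := C) (r.aestronglyMeasurable.mul hG.1) (.of_forall fun x => ?_)
      rw [norm_mul]
      gcongr
      exact hC x
    have hint : ∀ r : SimpleFunc X ℂ, Integrable (fun x => h x * r x) μ := fun r => by
      obtain ⟨C, hC⟩ := r.exists_forall_norm_le
      exact hi.mul_bdd r.aestronglyMeasurable (.of_forall hC)
    have hadd : ht.toLp = (hmem f).toLp + (hmem g).toLp := by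
      rw [← MemLp.toLp_add]
      exact MemLp.toLp_congr _ _ (.of_forall fun x => add_mul _ _ _)
    rw [hadd, map_add, hf, hg, ← integral_add (hint f) (hint g)]
    exact integral_congr_ae (.of_forall fun x => (mul_add _ _ _).symm)

lemma functional_eq_integral_div_mul [Fact (1 ≤ p)] (hp : p ≠ ∞) {L : Lp ℂ p μ →L[ℂ] ℂ}
    {G : X → ℝ} (hGm : Measurable G) (hG0 : ∀ x, 0 < G x) (hG : MemLp (fun x => (G x : ℂ)) p μ)
    {h : X → ℂ} (hi : Integrable h μ)
    (hL : ∀ (A : Set X) (hA : MeasurableSet A), L (hG.indicator hA).toLp = ∫ x in A, h x ∂μ)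
    {F : X → ℂ} (hFm : Measurable F) {c : ℝ} (hc : 0 ≤ c) (hF : ∀ x, ‖F x‖ ≤ c * G x)
    (hFp : MemLp F p μ) : L hFp.toLp = ∫ x, h x / G x * F x ∂μ := by
  have hGne : ∀ x, (G x : ℂ) ≠ 0 := fun x => by exact_mod_cast (hG0 x).ne'
  have hGnorm : ∀ x, ‖(G x : ℂ)‖ = G x := fun x => Complex.norm_of_nonneg (hG0 x).le
  have hFG : StronglyMeasurable fun x => F x / (G x : ℂ) :=
    (hFm.div hGm.complex_ofReal).stronglyMeasurable
  set t := hFG.approxBounded c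
  have htc : ∀ k x, ‖t k x‖ ≤ c := hFG.norm_approxBounded_le hc
  have htF : ∀ x, Tendsto (fun k => t k x) atTop (𝓝 (F x / (G x : ℂ))) := fun x =>
    hFG.tendsto_approxBounded_of_norm_le (by rw [norm_div, hGnorm, div_le_iff₀ (hG0 x)]; exact hF x)
  have htG : ∀ k x, ‖t k x * (G x : ℂ)‖ ≤ c * G x := fun k x => by
    rw [norm_mul, hGnorm]
    exact mul_le_mul_of_nonneg_right (htc k x) (hG0 x).le
  have hcG : MemLp (fun x => c * G x) p μ := hG.re.const_mul c
  have hmem : ∀ k, MemLp (fun x => t k x * (G x : ℂ)) p μ := fun k =>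
    hcG.mono' ((t k).measurable.mul hGm.complex_ofReal).aestronglyMeasurable (.of_forall (htG k))
  have hleft : Tendsto (fun k => L (hmem k).toLp) atTop (𝓝 (L hFp.toLp)) := by
    refine (L.continuous.tendsto _).comp ((Lp.tendsto_Lp_iff_tendsto_eLpNorm'' _ hmem _ hFp).2 ?_)
    refine tendsto_eLpNorm_sub_of_dominated Fact.out hp (fun k => (hmem k).1) hFp.1 hcG htG hF
      fun x => ?_
    simpa only [div_mul_cancel₀ _ (hGne x)] using (htF x).mul_const (G x : ℂ)
  have hright : Tendsto (fun k => ∫ x, h x * t k x ∂μ) atTop (𝓝 (∫ x, h x / G x * F x ∂μ)) := by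
    refine tendsto_integral_of_dominated_convergence (fun x => ‖h x‖ * c)
      (fun k => hi.1.mul (t k).aestronglyMeasurable) (hi.norm.mul_const c)
      (fun k => .of_forall fun x => ?_) (.of_forall fun x => ?_)
    · rw [norm_mul]
      gcongr
      exact htc k x
    · simpa only [div_mul_eq_mul_div, mul_div_assoc] using (htF x).const_mul (h x)
  refine tendsto_nhds_unique hleft (hright.congr fun k => ?_)
  exact (functional_simpleFunc_mul_eq_integral hG hi hL (t k) (hmem k)).symm

lemma lintegral_enorm_mul_enorm_le_of_forall_enorm_integral_mul_le [IsFiniteMeasure μ] {h : X → ℂ}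
    (hm : Measurable h) {M : ℝ} (hM : ∀ x, ‖h x‖ ≤ M) {C : ℝ≥0∞}
    (hb : ∀ F : X → ℂ, Measurable F → (∃ c, ∀ x, ‖F x‖ ≤ c) →
      ‖∫ x, h x * F x ∂μ‖ₑ ≤ C * eLpNorm F p μ)
    {w : X → ℝ} (hw : Measurable w) (hw0 : ∀ x, 0 ≤ w x) {c : ℝ} (hwc : ∀ x, w x ≤ c) :
    ∫⁻ x, ‖h x‖ₑ * ‖w x‖ₑ ∂μ ≤ C * eLpNorm w p μ := by
  set F : X → ℂ := fun x => conj (h x) / ‖h x‖ * w x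
  have hFm : Measurable F := by fun_prop
  have hFw : ∀ x, ‖F x‖ ≤ ‖w x‖ := fun x => by
    rw [norm_mul, norm_div, RCLike.norm_conj, Complex.norm_real, Complex.norm_real, norm_norm]
    exact mul_le_of_le_one_left (norm_nonneg _) (div_self_le_one _)
  have hhF : ∀ x, h x * F x = ((‖h x‖ * w x : ℝ) : ℂ) := fun x => by
    rcases eq_or_ne (h x) 0 with h0 | h0
    · simp [F, h0]
    · have : (‖h x‖ : ℂ) ≠ 0 := by simpa using h0
      simp only [F]
      rw [← mul_assoc, ← mul_div_assoc, Complex.mul_conj', sq, mul_div_cancel_right₀ _ this,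
        Complex.ofReal_mul]
  have hint : Integrable (fun x => ‖h x‖ * w x) μ := by
    refine .of_bound (hm.norm.mul hw).aestronglyMeasurable (M * c) (.of_forall fun x => ?_)
    rw [norm_mul, norm_norm, Real.norm_of_nonneg (hw0 x)]
    exact mul_le_mul (hM x) (hwc x) (hw0 x) ((norm_nonneg _).trans (hM x))
  calc ∫⁻ x, ‖h x‖ₑ * ‖w x‖ₑ ∂μ = ∫⁻ x, ENNReal.ofReal (‖h x‖ * w x) ∂μ := by
        refine lintegral_congr fun x => ?_
        rw [ENNReal.ofReal_mul (norm_nonneg _), ofReal_norm, Real.enorm_of_nonneg (hw0 x)]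
    _ = ‖∫ x, h x * F x ∂μ‖ₑ := by
        simp_rw [hhF]
        rw [← ofReal_integral_eq_lintegral_ofReal hint
          (.of_forall fun x => mul_nonneg (norm_nonneg _) (hw0 x)), integral_complex_ofReal,
          ← ofReal_norm, Complex.norm_of_nonneg
          (integral_nonneg fun x => mul_nonneg (norm_nonneg _) (hw0 x))]
    _ ≤ C * eLpNorm F p μ :=
        hb F hFm ⟨c, fun x => ((hFw x).trans_eq (Real.norm_of_nonneg (hw0 x))).trans (hwc x)⟩
    _ ≤ C * eLpNorm w p μ := by
        gcongr
        exact eLpNorm_mono hFw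

lemma rpow_inv_le_of_le_mul_rpow_inv {a b : ℝ} (hab : a.HolderConjugate b) {x C : ℝ≥0∞}
    (hx : x ≠ ∞) (h : x ≤ C * x ^ a⁻¹) : x ^ b⁻¹ ≤ C := by
  rcases eq_or_ne x 0 with rfl | hx0
  · rw [ENNReal.zero_rpow_of_pos hab.symm.inv_pos]
    exact zero_le
  have hsplit : x = x ^ b⁻¹ * x ^ a⁻¹ := by
    rw [← ENNReal.rpow_add _ _ hx0 hx, add_comm, hab.inv_add_inv_eq_one, ENNReal.rpow_one]
  refine (ENNReal.mul_le_mul_iff_left (c := x ^ a⁻¹) ?_ ?_).1 (hsplit.symm.trans_le h)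
  · simp [ENNReal.rpow_eq_zero_iff, hx0, hx]
  · simp [ENNReal.rpow_eq_top_iff, hx0, hx]

lemma eLpNorm_top_le_of_forall_bounded_enorm_integral_mul_le [IsFiniteMeasure μ]
    {h : X → ℂ} (hm : Measurable h) {M : ℝ} (hM : ∀ x, ‖h x‖ ≤ M) {C : ℝ≥0∞}
    (hb : ∀ F : X → ℂ, Measurable F → (∃ c, ∀ x, ‖F x‖ ≤ c) →
      ‖∫ x, h x * F x ∂μ‖ₑ ≤ C * eLpNorm F 1 μ) :
    eLpNorm h ∞ μ ≤ C := by
  rw [eLpNorm_exponent_top]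
  refine essSup_le_of_ae_le _ (ae_le_of_forall_setLIntegral_le_of_sigmaFinite hm.enorm
    fun A hA _ => ?_)
  calc ∫⁻ x in A, ‖h x‖ₑ ∂μ = ∫⁻ x, ‖h x‖ₑ * ‖A.indicator (1 : X → ℝ) x‖ₑ ∂μ := by
        rw [← lintegral_indicator hA]
        refine lintegral_congr fun x => ?_
        by_cases hx : x ∈ A <;> simp [hx]
    _ ≤ C * eLpNorm (A.indicator (1 : X → ℝ)) 1 μ :=
        lintegral_enorm_mul_enorm_le_of_forall_enorm_integral_mul_le hm hM hb
          (measurable_one.indicator hA) (Set.indicator_nonneg fun _ _ => zero_le_one)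
          (Set.indicator_le_self' fun _ _ => zero_le_one)
    _ = ∫⁻ _ in A, C ∂μ := by
        rw [eLpNorm_indicator_eq_eLpNorm_restrict hA, eLpNorm_one_eq_lintegral_enorm]
        simp

lemma eLpNorm_le_of_ne_top_of_forall_bounded_enorm_integral_mul_le [IsFiniteMeasure μ]
    [hpp : p.HolderConjugate p'] {h : X → ℂ} (hm : Measurable h) {M : ℝ} (hM : ∀ x, ‖h x‖ ≤ M)
    (hp : p ≠ ∞) (hp' : p' ≠ ∞) {C : ℝ≥0∞} (hb : ∀ F : X → ℂ, Measurable F → (∃ c, ∀ x, ‖F x‖ ≤ c) →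
      ‖∫ x, h x * F x ∂μ‖ₑ ≤ C * eLpNorm F p μ) :
    eLpNorm h p' μ ≤ C := by
  have hpq : p.toReal.HolderConjugate p'.toReal := hpp.toReal_of_ne_top hp hp'
  have hr : 0 < p'.toReal - 1 := hpq.symm.sub_one_pos
  have hpow : ∀ x, ‖‖h x‖ ^ (p'.toReal - 1)‖ₑ = ‖h x‖ₑ ^ (p'.toReal - 1) := fun x => by
    rw [Real.enorm_rpow_of_nonneg (norm_nonneg _) hr.le, enorm_norm]
  have hp0 : p ≠ 0 := hpp.ne_zero
  have hp'0 : p' ≠ 0 := hpp.symm.ne_zero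
  have hfin : ∫⁻ x, ‖h x‖ₑ ^ p'.toReal ∂μ < ∞ :=
    lintegral_rpow_enorm_lt_top_of_eLpNorm_lt_top hp'0 hp'
      (MemLp.of_bound hm.aestronglyMeasurable M (.of_forall hM)).2
  rw [eLpNorm_eq_lintegral_rpow_enorm_toReal hp'0 hp', one_div]
  refine rpow_inv_le_of_le_mul_rpow_inv hpq hfin.ne ?_
  calc ∫⁻ x, ‖h x‖ₑ ^ p'.toReal ∂μ = ∫⁻ x, ‖h x‖ₑ * ‖‖h x‖ ^ (p'.toReal - 1)‖ₑ ∂μ := by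
        refine lintegral_congr fun x => ?_
        rw [hpow, mul_comm]
        nth_rw 3 [← ENNReal.rpow_one ‖h x‖ₑ]
        rw [← ENNReal.rpow_add_of_nonneg _ _ hr.le zero_le_one, sub_add_cancel]
    _ ≤ C * eLpNorm (fun x => ‖h x‖ ^ (p'.toReal - 1)) p μ :=
        lintegral_enorm_mul_enorm_le_of_forall_enorm_integral_mul_le hm hM hb
          (hm.norm.pow_const _) (fun x => Real.rpow_nonneg (norm_nonneg _) _)
          (fun x => Real.rpow_le_rpow (norm_nonneg _) (hM x) hr.le)
    _ = C * (∫⁻ x, ‖h x‖ₑ ^ p'.toReal ∂μ) ^ p.toReal⁻¹ := by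
        rw [eLpNorm_eq_lintegral_rpow_enorm_toReal hp0 hp, one_div]
        simp_rw [hpow, ← ENNReal.rpow_mul, hpq.symm.sub_one_mul_conj]

lemma eLpNorm_le_of_forall_bounded_enorm_integral_mul_le [IsFiniteMeasure μ]
    [hpp : p.HolderConjugate p'] {h : X → ℂ} (hm : Measurable h) {M : ℝ} (hM : ∀ x, ‖h x‖ ≤ M)
    (hp : p ≠ ∞) {C : ℝ≥0∞} (hb : ∀ F : X → ℂ, Measurable F → (∃ c, ∀ x, ‖F x‖ ≤ c) →
      ‖∫ x, h x * F x ∂μ‖ₑ ≤ C * eLpNorm F p μ) :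
    eLpNorm h p' μ ≤ C := by
  rcases eq_or_ne p' ∞ with rfl | hp'
  · obtain rfl := (ENNReal.HolderConjugate.eq_top_iff_eq_one ∞ p).1 rfl
    exact eLpNorm_top_le_of_forall_bounded_enorm_integral_mul_le hm hM hb
  · exact eLpNorm_le_of_ne_top_of_forall_bounded_enorm_integral_mul_le hm hM hp hp' hb

lemma eLpNorm_indicator_le_of_forall_enorm_integral_mul_le [hpp : p.HolderConjugate p']
    (hp : p ≠ ∞) {G : X → ℝ} (hG : MemLp G p μ) {h : X → ℂ} (hm : Measurable h) {C : ℝ≥0∞}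
    (hb : ∀ F : X → ℂ, Measurable F → (∃ c, 0 ≤ c ∧ ∀ x, ‖F x‖ ≤ c * G x) →
      ‖∫ x, h x * F x ∂μ‖ₑ ≤ C * eLpNorm F p μ)
    (hG0 : ∀ x, 0 ≤ G x) {A : Set X} (hA : MeasurableSet A) {M : ℝ} (hM : ∀ x ∈ A, ‖h x‖ ≤ M)
    {ε : ℝ} (hε : 0 < ε) (hGA : ∀ x ∈ A, ε ≤ G x) : eLpNorm (A.indicator h) p' μ ≤ C := by
  have : IsFiniteMeasure (μ.restrict A) := by
    refine isFiniteMeasure_restrict.2 (measure_lt_top_of_subset (fun x hx => ?_)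
      (hG.meas_ge_lt_top'_enorm hpp.ne_zero hp (ENNReal.ofReal_pos.2 hε).ne' (by simp)).ne).ne
    exact (ENNReal.ofReal_le_ofReal (hGA x hx)).trans_eq (Real.enorm_of_nonneg (hG0 x)).symm
  have hAM : ∀ x, ‖A.indicator h x‖ ≤ |M| := fun x => by
    by_cases hx : x ∈ A
    · simpa [hx] using (hM x hx).trans (le_abs_self M)
    · simp [hx]
  rw [eLpNorm_indicator_eq_eLpNorm_restrict hA, ← eLpNorm_congr_ae (indicator_ae_eq_restrict hA)]
  refine eLpNorm_le_of_forall_bounded_enorm_integral_mul_le (hm.indicator hA) hAM hp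
    fun F hF ⟨c, hc⟩ => ?_
  rw [← eLpNorm_indicator_eq_eLpNorm_restrict hA, ← integral_indicator hA]
  have hFG : ∀ x, ‖A.indicator F x‖ ≤ |c| / ε * G x := fun x => by
    by_cases hx : x ∈ A
    · rw [Set.indicator_of_mem hx, div_mul_eq_mul_div, le_div_iff₀ hε]
      exact mul_le_mul ((hc x).trans (le_abs_self c)) (hGA x hx) hε.le (abs_nonneg c)
    · have := hG0 x
      rw [Set.indicator_of_notMem hx, norm_zero]
      positivity
  refine (congrArg _ (integral_congr_ae (.of_forall fun x => ?_))).trans_le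
    (hb _ (hF.indicator hA) ⟨_, by positivity, hFG⟩)
  by_cases hx : x ∈ A <;> simp [hx]

lemma eLpNorm_le_of_forall_enorm_integral_mul_le [p.HolderConjugate p'] (hp : p ≠ ∞)
    {G : X → ℝ} (hGm : Measurable G) (hG0 : ∀ x, 0 < G x) (hG : MemLp G p μ) {h : X → ℂ}
    (hm : Measurable h) {C : ℝ≥0∞} (hb : ∀ F : X → ℂ, Measurable F →
      (∃ c, 0 ≤ c ∧ ∀ x, ‖F x‖ ≤ c * G x) → ‖∫ x, h x * F x ∂μ‖ₑ ≤ C * eLpNorm F p μ) :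
    eLpNorm h p' μ ≤ C := by
  set A : ℕ → Set X := fun k => {x | ‖h x‖ ≤ k ∧ (k + 1 : ℝ)⁻¹ ≤ G x}
  have hA : ∀ k, MeasurableSet (A k) := fun k =>
    (measurableSet_le hm.norm measurable_const).inter (measurableSet_le measurable_const hGm)
  have hlim : ∀ x, Tendsto (fun k => (A k).indicator h x) atTop (𝓝 (h x)) := fun x => by
    obtain ⟨k, hk⟩ := exists_nat_ge (max ‖h x‖ (G x)⁻¹)
    refine tendsto_const_nhds.congr' ?_
    filter_upwards [eventually_ge_atTop k] with j hj
    have hkj : max ‖h x‖ (G x)⁻¹ ≤ j := hk.trans (by exact_mod_cast hj)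
    have hjA : x ∈ A j := ⟨(le_max_left _ _).trans hkj,
      inv_le_of_inv_le₀ (hG0 x) (((le_max_right _ _).trans hkj).trans (lt_add_one _).le)⟩
    exact (Set.indicator_of_mem hjA h).symm
  refine (Lp.eLpNorm_lim_le_liminf_eLpNorm
    (fun k => (hm.indicator (hA k)).aestronglyMeasurable) h (.of_forall hlim)).trans
    (liminf_le_of_frequently_le' (.of_forall fun k => ?_))
  exact eLpNorm_indicator_le_of_forall_enorm_integral_mul_le hp hG hm hb (fun x => (hG0 x).le)
    (hA k) (fun x hx => hx.1) (inv_pos.2 (by positivity)) fun x hx => hx.2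

lemma tendsto_toLp_indicator [Fact (1 ≤ p)] (hp : p ≠ ∞) {g : X → ℂ} (hg : MemLp g p μ)
    {A : ℕ → Set X} (hA : ∀ k, MeasurableSet (A k)) (hgA : ∀ x, ∀ᶠ k in atTop, x ∈ A k) :
    Tendsto (fun k => (hg.indicator (hA k)).toLp) atTop (𝓝 hg.toLp) := by
  rw [Lp.tendsto_Lp_iff_tendsto_eLpNorm'']
  refine tendsto_eLpNorm_sub_of_dominated Fact.out hp (fun k => (hg.indicator (hA k)).1) hg.1
    hg.norm (fun k x => norm_indicator_le_norm_self _ _) (fun x => le_rfl) fun x => ?_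
  refine tendsto_const_nhds.congr' ?_
  filter_upwards [hgA x] with k hk
  exact (Set.indicator_of_mem hk g).symm

lemma exists_continuousLinearMap_eq_integral_mul [Fact (1 ≤ p)] [hpp : p.HolderConjugate p']
    {h : X → ℂ} (hh : MemLp h p' μ) :
    ∃ T : Lp ℂ p μ →L[ℂ] ℂ, ∀ f, T f = ∫ x, h x * f x ∂μ := by
  have : Fact (1 ≤ p') := ⟨hpp.symm.one_le⟩
  refine ⟨(ContinuousLinearMap.mul ℂ ℂ).lpPairing μ p' p hh.toLp, fun f => ?_⟩
  rw [ContinuousLinearMap.lpPairing_eq_integral]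
  refine integral_congr_ae ?_
  filter_upwards [hh.coeFn_toLp] with x hx
  rw [ContinuousLinearMap.mul_apply', hx]

lemma functional_eq_integral_of_forall_dominated [Fact (1 ≤ p)] [p.HolderConjugate p']
    (hp : p ≠ ∞) {L : Lp ℂ p μ →L[ℂ] ℂ} {G : X → ℝ} (hGm : Measurable G)
    (hG0 : ∀ x, 0 < G x) {h : X → ℂ} (hh : MemLp h p' μ)
    (hL : ∀ F : X → ℂ, Measurable F → (∃ c, 0 ≤ c ∧ ∀ x, ‖F x‖ ≤ c * G x) →
      ∀ hF : MemLp F p μ, L hF.toLp = ∫ x, h x * F x ∂μ) (f : Lp ℂ p μ) :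
    L f = ∫ x, h x * f x ∂μ := by
  obtain ⟨T, hT⟩ := exists_continuousLinearMap_eq_integral_mul (p := p) hh
  rw [← hT f]
  obtain ⟨g, hgm, hfg⟩ := Lp.aestronglyMeasurable f
  have hg : MemLp g p μ := (Lp.memLp f).ae_eq hfg
  obtain rfl : f = hg.toLp :=
    (Lp.toLp_coeFn f (Lp.memLp f)).symm.trans (MemLp.toLp_congr _ _ hfg)
  set A : ℕ → Set X := fun k => {x | ‖g x‖ ≤ k * G x}
  have hA : ∀ k, MeasurableSet (A k) := fun k =>
    measurableSet_le hgm.measurable.norm (hGm.const_mul _)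
  have hlim := tendsto_toLp_indicator hp hg hA fun x => by
    obtain ⟨k, hk⟩ := exists_nat_ge (‖g x‖ / G x)
    filter_upwards [eventually_ge_atTop k] with j hj
    exact (div_le_iff₀ (hG0 x)).1 (hk.trans (by exact_mod_cast hj))
  refine tendsto_nhds_unique ((L.continuous.tendsto _).comp hlim)
    (((T.continuous.tendsto _).comp hlim).congr fun k => ?_)
  have hgk : ∀ x, ‖(A k).indicator g x‖ ≤ k * G x := fun x => by
    by_cases hx : x ∈ A k
    · rwa [Set.indicator_of_mem hx]
    · have := hG0 x
      rw [Set.indicator_of_notMem hx, norm_zero]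
      positivity
  rw [Function.comp_apply, Function.comp_apply, hT,
    hL _ (hgm.measurable.indicator (hA k)) ⟨k, by positivity, hgk⟩]
  refine integral_congr_ae ?_
  filter_upwards [(hg.indicator (hA k)).coeFn_toLp] with x hx
  rw [hx]

lemma exists_memLp_forall_eq_integral [SigmaFinite μ] [Fact (1 ≤ p)] [p.HolderConjugate p']
    (hp : p ≠ ∞) (L : Lp ℂ p μ →L[ℂ] ℂ) :
    ∃ h : X → ℂ, MemLp h p' μ ∧ eLpNorm h p' μ ≤ ‖L‖ₑ ∧
      ∀ f : Lp ℂ p μ, L f = ∫ x, h x * f x ∂μ := by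
  obtain ⟨G, hGm, hG0, hG⟩ := exists_pos_memLp (μ := μ) Fact.out hp
  obtain ⟨h, hm, hi, hc⟩ := exists_integrable_forall_eq_setIntegral
    (functionalMeasure_absolutelyContinuous hp L (hG.ofReal (K := ℂ)))
  have hL : ∀ F : X → ℂ, Measurable F → (∃ c, 0 ≤ c ∧ ∀ x, ‖F x‖ ≤ c * G x) →
      ∀ hF : MemLp F p μ, L hF.toLp = ∫ x, h x / G x * F x ∂μ := fun F hFm ⟨c, hc0, hFc⟩ hF =>
    functional_eq_integral_div_mul hp hGm hG0 hG.ofReal hi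
      (fun A hA => (functionalMeasure_apply hp L hG.ofReal hA).symm.trans (hc A hA)) hFm hc0 hFc hF
  have hdm : Measurable fun x => h x / (G x : ℂ) := hm.div hGm.complex_ofReal
  have hle : eLpNorm (fun x => h x / G x) p' μ ≤ ‖L‖ₑ := by
    refine eLpNorm_le_of_forall_enorm_integral_mul_le hp hGm hG0 hG hdm fun F hFm hF => ?_
    have hFp : MemLp F p μ := by
      obtain ⟨c, -, hFc⟩ := hF
      exact (hG.const_mul c).mono' hFm.aestronglyMeasurable (.of_forall hFc)
    rw [← hL F hFm hF hFp, ← Lp.enorm_toLp hFp]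
    exact L.le_opENorm _
  have hmem : MemLp (fun x => h x / G x) p' μ :=
    ⟨hdm.aestronglyMeasurable, hle.trans_lt enorm_lt_top⟩
  exact ⟨_, hmem, hle, functional_eq_integral_of_forall_dominated hp hGm hG0 hmem hL⟩

end LpDual

/-! ### Young's inequality -/

section Convolution

variable {V : Type*} [AddCommGroup V] [MeasurableSpace V] [MeasurableAdd₂ V]
  {ν : Measure V} [SFinite ν] [ν.IsAddLeftInvariant]

lemma lintegral_mul_rpow_le {X : Type*} [MeasurableSpace X] {μ : Measure X} {k a : X → ℝ≥0∞}
    (hk : AEMeasurable k μ) (ha : AEMeasurable a μ) {r : ℝ} (hr : 1 ≤ r) :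
    (∫⁻ t, k t * a t ∂μ) ^ r ≤ (∫⁻ t, k t ∂μ) ^ (r - 1) * ∫⁻ t, k t * a t ^ r ∂μ := by
  have hr0 : 0 < r := by linarith
  have hr' : 0 ≤ 1 - r⁻¹ := sub_nonneg.2 (inv_le_one_of_one_le₀ hr)
  have hsplit : ∀ t, k t * a t = k t ^ (1 - r⁻¹) * (k t * a t ^ r) ^ r⁻¹ := fun t => by
    rw [ENNReal.mul_rpow_of_nonneg _ _ (by positivity), ENNReal.rpow_rpow_inv hr0.ne',
      ← mul_assoc, ← ENNReal.rpow_add_of_nonneg _ _ hr' (by positivity), sub_add_cancel,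
      ENNReal.rpow_one]
  have hHolder := ENNReal.lintegral_mul_norm_pow_le hk (hk.mul (ha.pow_const r)) hr'
    (by positivity) (sub_add_cancel 1 r⁻¹)
  calc (∫⁻ t, k t * a t ∂μ) ^ r = (∫⁻ t, k t ^ (1 - r⁻¹) * (k t * a t ^ r) ^ r⁻¹ ∂μ) ^ r := by
        simp_rw [← hsplit]
    _ ≤ ((∫⁻ t, k t ∂μ) ^ (1 - r⁻¹) * (∫⁻ t, k t * a t ^ r ∂μ) ^ r⁻¹) ^ r :=
        ENNReal.rpow_le_rpow hHolder hr0.le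
    _ = (∫⁻ t, k t ∂μ) ^ (r - 1) * ∫⁻ t, k t * a t ^ r ∂μ := by
        rw [ENNReal.mul_rpow_of_nonneg _ _ hr0.le, ENNReal.rpow_inv_rpow hr0.ne',
          ← ENNReal.rpow_mul, sub_mul, one_mul, inv_mul_cancel₀ hr0.ne']

lemma integrable_mul_mul_comp_add {p p' : ℝ≥0∞} [hpp : p.HolderConjugate p'] {k h g : V → ℂ}
    (hkm : Measurable k) (hk : Integrable k ν) (hhm : Measurable h) (hh : MemLp h p ν)
    (hgm : Measurable g) (hg : MemLp g p' ν) :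
    Integrable (fun z : V × V => h z.2 * (k z.1 * g (z.2 + z.1))) (ν.prod ν) := by
  have hme : Measurable fun z : V × V => h z.2 * (k z.1 * g (z.2 + z.1)) :=
    (hhm.comp measurable_snd).mul ((hkm.comp measurable_fst).mul
      (hgm.comp (measurable_snd.add measurable_fst)))
  have hHolder : ∀ t, ∫⁻ x, ‖h x‖ₑ * ‖g (x + t)‖ₑ ∂ν ≤ eLpNorm h p ν * eLpNorm g p' ν := fun t => by
    have htrans : eLpNorm (fun x => g (x + t)) p' ν = eLpNorm g p' ν :=
      eLpNorm_comp_measurePreserving hg.1 (measurePreserving_add_right ν t)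
    have := eLpNorm_smul_le_mul_eLpNorm (p := p) (q := p') (r := 1)
      (hgm.comp (measurable_add_const t)).aestronglyMeasurable hh.1
    rw [eLpNorm_one_eq_lintegral_enorm] at this
    simpa only [Pi.smul_apply', smul_eq_mul, enorm_mul, Function.comp_def, htrans] using this
  refine ⟨hme.aestronglyMeasurable, ?_⟩
  rw [HasFiniteIntegral, lintegral_prod _ hme.enorm.aemeasurable]
  calc ∫⁻ t, ∫⁻ x, ‖h x * (k t * g (x + t))‖ₑ ∂ν ∂ν
      = ∫⁻ t, ‖k t‖ₑ * ∫⁻ x, ‖h x‖ₑ * ‖g (x + t)‖ₑ ∂ν ∂ν := by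
        refine lintegral_congr fun t => ?_
        rw [← lintegral_const_mul _ (by fun_prop)]
        exact lintegral_congr fun x => by rw [enorm_mul, enorm_mul, mul_left_comm]
    _ ≤ ∫⁻ t, ‖k t‖ₑ * (eLpNorm h p ν * eLpNorm g p' ν) ∂ν :=
        lintegral_mono fun t => mul_le_mul_right (hHolder t) _
    _ < ∞ := by
        rw [lintegral_mul_const _ hkm.enorm]
        exact ENNReal.mul_lt_top hk.2 (ENNReal.mul_lt_top hh.2 hg.2)

variable [MeasurableNeg V]

lemma lintegral_convolution_rpow_le {k a : V → ℝ≥0∞} (hk : Measurable k) (ha : Measurable a)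
    {r : ℝ} (hr : 1 ≤ r) :
    ∫⁻ y, (∫⁻ t, k t * a (y - t) ∂ν) ^ r ∂ν ≤ (∫⁻ t, k t ∂ν) ^ r * ∫⁻ y, a y ^ r ∂ν := by
  have hmeas : Measurable fun z : V × V => k z.2 * a (z.1 - z.2) ^ r :=
    (hk.comp measurable_snd).mul ((ha.comp (measurable_fst.sub measurable_snd)).pow_const r)
  calc ∫⁻ y, (∫⁻ t, k t * a (y - t) ∂ν) ^ r ∂ν
      ≤ ∫⁻ y, (∫⁻ t, k t ∂ν) ^ (r - 1) * ∫⁻ t, k t * a (y - t) ^ r ∂ν ∂ν :=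
        lintegral_mono fun y => lintegral_mul_rpow_le hk.aemeasurable
          (ha.comp (measurable_const.sub measurable_id)).aemeasurable hr
    _ = (∫⁻ t, k t ∂ν) ^ (r - 1) * ∫⁻ t, ∫⁻ y, k t * a (y - t) ^ r ∂ν ∂ν := by
        rw [lintegral_const_mul _ hmeas.lintegral_prod_right',
          lintegral_lintegral_swap hmeas.aemeasurable]
    _ = (∫⁻ t, k t ∂ν) ^ (r - 1) * ((∫⁻ t, k t ∂ν) * ∫⁻ y, a y ^ r ∂ν) := by
        have htrans : ∀ t, ∫⁻ y, k t * a (y - t) ^ r ∂ν = k t * ∫⁻ y, a y ^ r ∂ν := fun t => by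
          rw [lintegral_const_mul _ (by fun_prop)]
          exact congrArg _ (lintegral_sub_right_eq_self (fun y => a y ^ r) t)
        simp_rw [htrans]
        rw [lintegral_mul_const _ hk]
    _ = (∫⁻ t, k t ∂ν) ^ r * ∫⁻ y, a y ^ r ∂ν := by
        rw [← mul_assoc]
        nth_rw 2 [← ENNReal.rpow_one (∫⁻ t, k t ∂ν)]
        rw [← ENNReal.rpow_add_of_nonneg _ _ (by linarith) zero_le_one, sub_add_cancel]

lemma eLpNorm_integral_mul_sub_le {p : ℝ≥0∞} (h1 : 1 ≤ p) (hp : p ≠ ∞) {k h : V → ℂ}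
    (hk : Measurable k) (hh : Measurable h) :
    eLpNorm (fun y => ∫ t, k t * h (y - t) ∂ν) p ν ≤ eLpNorm k 1 ν * eLpNorm h p ν := by
  have hp0 : p ≠ 0 := (zero_lt_one.trans_le h1).ne'
  have hpr : 1 ≤ p.toReal := by simpa using ENNReal.toReal_mono hp h1
  rw [eLpNorm_eq_lintegral_rpow_enorm_toReal hp0 hp,
    eLpNorm_eq_lintegral_rpow_enorm_toReal hp0 hp, one_div,
    ENNReal.rpow_inv_le_iff (by linarith), ENNReal.mul_rpow_of_nonneg _ _ (by linarith),
    ENNReal.rpow_inv_rpow (by linarith), eLpNorm_one_eq_lintegral_enorm]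
  refine le_trans ?_ (lintegral_convolution_rpow_le hk.enorm hh.enorm hpr)
  gcongr with y
  refine (enorm_integral_le_lintegral_enorm _).trans_eq ?_
  simp only [enorm_mul]

lemma integral_mul_integral_mul_comp_add {p p' : ℝ≥0∞} [p.HolderConjugate p'] {k h g : V → ℂ}
    (hkm : Measurable k) (hk : Integrable k ν) (hhm : Measurable h) (hh : MemLp h p ν)
    (hgm : Measurable g) (hg : MemLp g p' ν) :
    ∫ x, h x * ∫ t, k t * g (x + t) ∂ν ∂ν = ∫ y, (∫ t, k t * h (y - t) ∂ν) * g y ∂ν := by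
  have hint := integrable_mul_mul_comp_add hkm hk hhm hh hgm hg
  have hshear : Integrable (fun z : V × V => h (z.2 - z.1) * (k z.1 * g z.2)) (ν.prod ν) := by
    simpa only [Function.comp_def, neg_add_eq_sub, sub_add_cancel] using
      (measurePreserving_prod_neg_add ν ν).integrable_comp_of_integrable hint
  calc ∫ x, h x * ∫ t, k t * g (x + t) ∂ν ∂ν = ∫ x, ∫ t, h x * (k t * g (x + t)) ∂ν ∂ν := by
        simp only [integral_const_mul]
    _ = ∫ t, ∫ x, h x * (k t * g (x + t)) ∂ν ∂ν :=
        (integral_integral_swap (f := fun t x => h x * (k t * g (x + t))) hint).symm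
    _ = ∫ t, ∫ y, h (y - t) * (k t * g y) ∂ν ∂ν := by
        refine integral_congr_ae (.of_forall fun t => ?_)
        simpa only [sub_add_cancel] using
          (integral_sub_right_eq_self (fun x => h x * (k t * g (x + t))) t).symm
    _ = ∫ y, ∫ t, h (y - t) * (k t * g y) ∂ν ∂ν :=
        integral_integral_swap (f := fun t y => h (y - t) * (k t * g y)) hshear
    _ = ∫ y, (∫ t, k t * h (y - t) ∂ν) * g y ∂ν := by
        simp_rw [← integral_mul_const, mul_left_comm (h _), mul_assoc]

end Convolution

/-! ### Fourier multipliers on functionals of class `L^p` -/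

section Schwartz

variable {n : ℕ} {p p' : ℝ≥0∞}

lemma exists_memLp_eq_integral_of_distLpENorm_lt_top {u : 𝓢(E n, ℂ) →ₗ[ℂ] ℂ}
    (hu : distLpENorm p u < ∞) :
    ∃ h : E n → ℂ, Measurable h ∧ MemLp h p volume ∧ ∀ g : 𝓢(E n, ℂ), u g = ∫ x, h x * g x := by
  unfold distLpENorm at hu
  simp only [iInf_lt_iff] at hu
  obtain ⟨h, hh, hu, -⟩ := hu
  obtain ⟨k, hk, hhk⟩ := hh.1
  refine ⟨k, hk.measurable, hh.ae_eq hhk, fun g => (hu g).trans (integral_congr_ae ?_)⟩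
  filter_upwards [hhk] with x hx
  rw [hx]

lemma distLpENorm_eq_eLpNorm (h1 : 1 ≤ p) {u : 𝓢(E n, ℂ) →ₗ[ℂ] ℂ} {h : E n → ℂ}
    (hh : MemLp h p volume) (hu : ∀ g : 𝓢(E n, ℂ), u g = ∫ x, h x * g x) :
    distLpENorm p u = eLpNorm h p volume := by
  refine le_antisymm (iInf_le_of_le h (iInf_le_of_le hh (iInf_le_of_le hu le_rfl))) ?_
  refine le_iInf fun k => le_iInf fun hk => le_iInf fun hku => (eLpNorm_congr_ae ?_).le
  refine ae_eq_of_integral_contDiff_smul_eq (hh.locallyIntegrable h1) (hk.locallyIntegrable h1)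
    fun g hg hgc => ?_
  set g' : 𝓢(E n, ℂ) := HasCompactSupport.toSchwartzMap (f := fun x => (g x : ℂ))
    (hgc.comp_left (g := fun r : ℝ => (r : ℂ)) Complex.ofReal_zero)
    (Complex.ofRealCLM.contDiff.comp hg)
  have hsmul : ∀ f : E n → ℂ, ∫ x, g x • f x = ∫ x, f x * g' x := fun f =>
    integral_congr_ae (.of_forall fun x => (Complex.real_smul.trans (mul_comm _ _)))
  rw [hsmul, hsmul, ← hu g', hku g']

lemma distLpENorm_le_of_forall_enorm_le [Fact (1 ≤ p)] [hpp : p.HolderConjugate p']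
    (hp : p ≠ ∞) {u : 𝓢(E n, ℂ) →ₗ[ℂ] ℂ} {C : ℝ≥0∞}
    (hu : ∀ g : 𝓢(E n, ℂ), ‖u g‖ₑ ≤ C * eLpNorm g p volume) : distLpENorm p' u ≤ C := by
  rcases eq_or_ne C ∞ with rfl | hC
  · exact le_top
  set e : 𝓢(E n, ℂ) →ₗ[ℂ] Lp ℂ p (volume : Measure (E n)) :=
    (SchwartzMap.toLpCLM ℂ ℂ p volume).toLinearMap
  have hd : DenseRange e := SchwartzMap.denseRange_toLpCLM (F := ℂ) hp
  have hb : ∀ g, ‖u g‖ ≤ C.toReal * ‖e g‖ := fun g => by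
    have he : ‖e g‖ₑ = eLpNorm g p volume := by
      rw [Lp.enorm_def]
      exact eLpNorm_congr_ae (SchwartzMap.coeFn_toLp g p volume)
    have := ENNReal.toReal_mono (ENNReal.mul_ne_top hC enorm_ne_top) (he ▸ hu g)
    rwa [ENNReal.toReal_mul, toReal_enorm, toReal_enorm] at this
  obtain ⟨h, hh, hhL, hrep⟩ := exists_memLp_forall_eq_integral (p' := p') hp (u.extendOfNorm e)
  have hL : ‖u.extendOfNorm e‖ₑ ≤ C := by
    rw [← ofReal_norm]
    exact ENNReal.ofReal_le_of_le_toReal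
      (LinearMap.opNorm_extendOfNorm_le hd ENNReal.toReal_nonneg hb)
  refine (distLpENorm_eq_eLpNorm hpp.symm.one_le hh fun g => ?_).trans_le (hhL.trans hL)
  rw [← LinearMap.extendOfNorm_eq hd ⟨_, hb⟩, hrep]
  refine integral_congr_ae ?_
  filter_upwards [SchwartzMap.coeFn_toLp g p volume] with x hx
  exact congrArg (h x * ·) hx

/-- The Fourier multiplier `g ↦ 𝓕 (ψ · 𝓕⁻¹ g)` on Schwartz functions; its transpose is
`f ↦ 𝓕⁻¹ (ψ · 𝓕 f)`. -/
def freqMult (ψ : 𝓓((⊤ : TopologicalSpace.Opens (E n)), ℝ)) : 𝓢(E n, ℂ) →ₗ[ℂ] 𝓢(E n, ℂ) where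
  toFun g := fourierTest n (mulTest ψ (𝓕⁻ g))
  map_add' g h := by simp [FourierTransform.fourierInv_add]
  map_smul' c g := by simp [FourierTransform.fourierInv_smul]

/-- A real test function as a complex Schwartz function. -/
def realTestToSchwartz (ψ : 𝓓((⊤ : TopologicalSpace.Opens (E n)), ℝ)) : 𝓢(E n, ℂ) :=
  HasCompactSupport.toSchwartzMap (f := fun x => (ψ x : ℂ))
    (ψ.hasCompactSupport.comp_left (g := fun r : ℝ => (r : ℂ)) Complex.ofReal_zero)
    (Complex.ofRealCLM.contDiff.comp ψ.contDiff)

lemma fourierInv_realTestToSchwartz (ψ : 𝓓((⊤ : TopologicalSpace.Opens (E n)), ℝ)) :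
    ⇑(𝓕⁻ (realTestToSchwartz ψ) : 𝓢(E n, ℂ)) = 𝓕⁻ (fun ξ => (ψ ξ : ℂ)) :=
  SchwartzMap.fourierInv_coe _

lemma freqMult_apply (ψ : 𝓓((⊤ : TopologicalSpace.Opens (E n)), ℝ)) (g : 𝓢(E n, ℂ)) (x : E n) :
    freqMult ψ g x = ∫ t, (𝓕⁻ (realTestToSchwartz ψ) : 𝓢(E n, ℂ)) t * g (x + t) := by
  set k : 𝓢(E n, ℂ) := 𝓕⁻ (realTestToSchwartz ψ) with hk
  set R : 𝓢(E n, ℂ) :=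
    SchwartzMap.compCLMOfContinuousLinearEquiv ℂ (ContinuousLinearEquiv.neg ℝ) g
  have hFR : ∀ ξ, (𝓕 R : 𝓢(E n, ℂ)) ξ = (𝓕⁻ g : 𝓢(E n, ℂ)) ξ := fun ξ => by
    rw [SchwartzMap.fourier_coe, SchwartzMap.fourierInv_coe, Real.fourierInv_eq_fourier_comp_neg]
    rfl
  have hprod : SchwartzMap.pairing (ContinuousLinearMap.mul ℂ ℂ) (𝓕 k : 𝓢(E n, ℂ)) (𝓕 R) =
      testToSchwartz n (mulTest ψ (𝓕⁻ g)) := by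
    ext ξ
    rw [hk, FourierTransform.fourier_fourierInv_eq, SchwartzMap.pairing_apply_apply]
    exact congrArg ((ψ ξ : ℂ) * ·) (hFR ξ)
  calc freqMult ψ g x
      = SchwartzMap.convolution (ContinuousLinearMap.mul ℂ ℂ) k R (-x) := by
        change (𝓕 (testToSchwartz n (mulTest ψ (𝓕⁻ g))) : 𝓢(E n, ℂ)) x = (𝓕⁻
          (SchwartzMap.pairing (ContinuousLinearMap.mul ℂ ℂ) (𝓕 k : 𝓢(E n, ℂ)) (𝓕 R)) :
            𝓢(E n, ℂ)) (-x)
        rw [hprod, SchwartzMap.fourier_coe, SchwartzMap.fourierInv_coe,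
          Real.fourierInv_eq_fourier_neg, neg_neg]
    _ = ∫ t, k t * R (-x - t) :=
        SchwartzMap.convolution_apply (ContinuousLinearMap.mul ℂ ℂ) k R (-x)
    _ = ∫ t, k t * g (x + t) := by
        refine integral_congr_ae (.of_forall fun t => ?_)
        change k t * g (-(-x - t)) = _
        rw [neg_sub, sub_neg_eq_add, add_comm]

lemma freqMult_eq_zero_of_eLpNorm_eq_zero {ψ : 𝓓((⊤ : TopologicalSpace.Opens (E n)), ℝ)}
    (hψ : eLpNorm (𝓕⁻ (fun ξ => (ψ ξ : ℂ))) 1 volume = 0) : freqMult ψ = 0 := by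
  rw [← fourierInv_realTestToSchwartz,
    eLpNorm_eq_zero_iff (SchwartzMap.continuous _).aestronglyMeasurable one_ne_zero] at hψ
  ext g x
  rw [freqMult_apply]
  refine integral_eq_zero_of_ae ?_
  filter_upwards [hψ] with t ht
  simp [ht]

lemma distLpENorm_comp_freqMult_le [hp1 : Fact (1 ≤ p)] (hp : p ≠ ∞)
    (ψ : 𝓓((⊤ : TopologicalSpace.Opens (E n)), ℝ)) (u : 𝓢(E n, ℂ) →ₗ[ℂ] ℂ) :
    distLpENorm p (u ∘ₗ freqMult ψ) ≤
      eLpNorm (𝓕⁻ (fun ξ => (ψ ξ : ℂ))) 1 volume * distLpENorm p u := by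
  rcases eq_or_ne (eLpNorm (𝓕⁻ (fun ξ => (ψ ξ : ℂ))) 1 volume) 0 with hψ | hψ
  · rw [freqMult_eq_zero_of_eLpNorm_eq_zero hψ, LinearMap.comp_zero, distLpENorm_zero]
    exact zero_le
  by_cases hut : distLpENorm p u = ∞
  · rw [hut, ENNReal.mul_top hψ]
    exact le_top
  obtain ⟨h, hm, hh, hu⟩ := exists_memLp_eq_integral_of_distLpENorm_lt_top (lt_top_iff_ne_top.2 hut)
  have hpp : p.HolderConjugate p.conjExponent := ENNReal.HolderConjugate.conjExponent hp1.out
  set k : 𝓢(E n, ℂ) := 𝓕⁻ (realTestToSchwartz ψ)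
  have hkm : Measurable k := k.continuous.measurable
  set H : E n → ℂ := fun y => ∫ t, k t * h (y - t)
  have hHle : eLpNorm H p volume ≤ eLpNorm k 1 volume * eLpNorm h p volume :=
    eLpNorm_integral_mul_sub_le hp1.out hp hkm hm
  have hHm : StronglyMeasurable H :=
    StronglyMeasurable.integral_prod_right (f := fun y t => k t * h (y - t))
      ((hkm.comp measurable_snd).mul
        (hm.comp (measurable_fst.sub measurable_snd))).stronglyMeasurable
  have hHp : MemLp H p volume := ⟨hHm.aestronglyMeasurable,
    hHle.trans_lt (ENNReal.mul_lt_top (k.memLp 1 volume).2 hh.2)⟩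
  have hrep : ∀ g : 𝓢(E n, ℂ), (u ∘ₗ freqMult ψ) g = ∫ y, H y * g y := fun g => by
    rw [LinearMap.comp_apply, hu]
    simp_rw [freqMult_apply]
    exact integral_mul_integral_mul_comp_add hkm k.integrable hm hh g.continuous.measurable
      (g.memLp p.conjExponent volume)
  rwa [distLpENorm_eq_eLpNorm hp1.out hHp hrep, distLpENorm_eq_eLpNorm hp1.out hh hu,
    ← fourierInv_realTestToSchwartz]

end Schwartz

/-! ### Geometry of the group -/

namespace AdmissibleLieGroup

variable {n : ℕ} {𝔤 : Type*} [LieRing 𝔤] [LieAlgebra ℝ 𝔤] (G : AdmissibleLieGroup n 𝔤)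

lemma step_eq_one_or_two : G.step = 1 ∨ G.step = 2 := by
  obtain ⟨i, hi⟩ := G.exists_deg_eq_step
  have h1 := G.one_le_deg i
  have h2 := G.step_le_two
  omega

lemma deg_eq_one_or_two (i : Fin n) : G.deg i = 1 ∨ G.deg i = 2 := by
  have h1 := G.one_le_deg i
  have h2 := (G.deg_le_step i).trans G.step_le_two
  omega

lemma homDim_pos : 0 < G.homDim := by
  obtain ⟨i, -⟩ := G.exists_deg_eq_step
  exact Finset.sum_pos (fun j _ => G.one_le_deg j) ⟨i, Finset.mem_univ i⟩

lemma basis_mem_layer (i : Fin n) : G.basis i ∈ layer G.basis G.deg (G.deg i) :=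
  Submodule.subset_span ⟨i, rfl, rfl⟩

lemma layer_eq_bot_of_step_lt {k : ℕ} (hk : G.step < k) : layer G.basis G.deg k = ⊥ := by
  have hempty : {i | G.deg i = k} = ∅ :=
    Set.eq_empty_of_forall_notMem fun i hi => ((G.deg_le_step i).trans_lt hk).ne hi
  rw [layer, hempty, Set.image_empty, Submodule.span_empty]

lemma lie_eq_zero_of_mem_layer_one {x y : 𝔤} (hx : x ∈ layer G.basis G.deg 1)
    (hy : y ∈ layer G.basis G.deg 2) : ⁅x, y⁆ = 0 := by
  rcases G.step_eq_one_or_two with hs | hs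
  · rw [G.layer_eq_bot_of_step_lt (by omega), Submodule.mem_bot] at hy
    rw [hy, lie_zero]
  · exact G.bracket_top x hx y (hs ▸ hy)

lemma span_lie_layer_one :
    Submodule.span ℝ {z | ∃ x ∈ layer G.basis G.deg 1, ∃ y ∈ layer G.basis G.deg 1, ⁅x, y⁆ = z} =
      layer G.basis G.deg 2 := by
  rcases G.step_eq_one_or_two with hs | hs
  · rw [G.layer_eq_bot_of_step_lt (k := 2) (by omega), Submodule.span_eq_bot]
    rintro _ ⟨x, hx, y, hy, rfl⟩
    exact G.bracket_top x hx y (hs ▸ hy)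
  · exact G.bracket_layer 1 le_rfl (by omega)

lemma lie_basis_of_mem_layer_two (i : Fin n) {z : 𝔤} (hz : z ∈ layer G.basis G.deg 2) :
    ⁅G.basis i, z⁆ = 0 := by
  have hi := G.basis_mem_layer i
  rcases G.deg_eq_one_or_two i with h1 | h2
  · exact G.lie_eq_zero_of_mem_layer_one (h1 ▸ hi) hz
  rw [h2] at hi
  have hcomm : ∀ a ∈ layer G.basis G.deg 1, ⁅G.basis i, a⁆ = 0 := fun a ha => by
    rw [← lie_skew, G.lie_eq_zero_of_mem_layer_one ha hi, neg_zero]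
  suffices h : layer G.basis G.deg 2 ≤ LinearMap.ker (LieAlgebra.ad ℝ 𝔤 (G.basis i)) from h hz
  rw [← span_lie_layer_one, Submodule.span_le]
  rintro _ ⟨a, ha, b, hb, rfl⟩
  change ⁅G.basis i, ⁅a, b⁆⁆ = 0
  rw [leibniz_lie, hcomm a ha, hcomm b hb, zero_lie, lie_zero, add_zero]

lemma lie_of_mem_layer_two (x : 𝔤) {z : 𝔤} (hz : z ∈ layer G.basis G.deg 2) : ⁅x, z⁆ = 0 := by
  have had : (LieAlgebra.ad ℝ 𝔤 z : 𝔤 →ₗ[ℝ] 𝔤) = 0 := G.basis.ext fun i => by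
    rw [LieAlgebra.ad_apply, ← lie_skew, G.lie_basis_of_mem_layer_two i hz, neg_zero,
      LinearMap.zero_apply]
  rw [← lie_skew, ← LieAlgebra.ad_apply (R := ℝ), had, LinearMap.zero_apply, neg_zero]

lemma lie_basis_eq_zero_or_deg_eq_one (i j : Fin n) :
    ⁅G.basis i, G.basis j⁆ = 0 ∨ G.deg i = 1 ∧ G.deg j = 1 := by
  have hi := G.basis_mem_layer i
  have hj := G.basis_mem_layer j
  rcases G.deg_eq_one_or_two j with hj1 | hj2
  · rcases G.deg_eq_one_or_two i with hi1 | hi2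
    · exact .inr ⟨hi1, hj1⟩
    · exact .inl (by rw [← lie_skew, G.lie_of_mem_layer_two _ (hi2 ▸ hi), neg_zero])
  · exact .inl (G.lie_of_mem_layer_two _ (hj2 ▸ hj))

lemma lie_basis_mem_layer_two (i j : Fin n) :
    ⁅G.basis i, G.basis j⁆ ∈ layer G.basis G.deg 2 := by
  rcases G.lie_basis_eq_zero_or_deg_eq_one i j with h | ⟨hi, hj⟩
  · rw [h]
    exact Submodule.zero_mem _
  · rw [← span_lie_layer_one]
    exact Submodule.subset_span
      ⟨_, hi ▸ G.basis_mem_layer i, _, hj ▸ G.basis_mem_layer j, rfl⟩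

lemma lie_mem_layer_two (x y : 𝔤) : ⁅x, y⁆ ∈ layer G.basis G.deg 2 := by
  have hmkQ : (LieModule.toEnd ℝ 𝔤 𝔤 : 𝔤 →ₗ[ℝ] 𝔤 →ₗ[ℝ] 𝔤).compr₂
      (layer G.basis G.deg 2).mkQ = 0 :=
    LinearMap.ext_basis G.basis G.basis fun i j =>
      (Submodule.Quotient.mk_eq_zero _).2 (G.lie_basis_mem_layer_two i j)
  exact (Submodule.Quotient.mk_eq_zero _).1 (LinearMap.congr_fun₂ hmkQ x y)

/-- Half the Lie bracket in coordinates, the quadratic part of the group law. -/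
def halfLie : E n →ₗ[ℝ] E n →ₗ[ℝ] E n :=
  LinearMap.mk₂ ℝ (fun x y => (1 / 2 : ℝ) • G.coord ⁅G.coord.symm x, G.coord.symm y⁆)
    (fun x y z => by simp) (fun c x y => by simp [smul_comm c])
    (fun x y z => by simp) (fun c x y => by simp [smul_comm c])

lemma halfLie_apply (x y : E n) :
    G.halfLie x y = (1 / 2 : ℝ) • G.coord ⁅G.coord.symm x, G.coord.symm y⁆ := rfl

lemma mul_eq (x y : E n) : G.mul x y = x + y + G.halfLie x y := rfl

lemma halfLie_self (x : E n) : G.halfLie x x = 0 := by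
  simp [halfLie_apply]

lemma halfLie_swap (x y : E n) : G.halfLie x y = -G.halfLie y x := by
  rw [halfLie_apply, halfLie_apply, ← lie_skew, map_neg, smul_neg]

lemma halfLie_halfLie_right (x y z : E n) : G.halfLie x (G.halfLie y z) = 0 := by
  rw [G.halfLie_apply x, G.halfLie_apply y, map_smul, LinearEquiv.symm_apply_apply, lie_smul,
    G.lie_of_mem_layer_two _ (G.lie_mem_layer_two _ _), smul_zero, map_zero, smul_zero]

lemma halfLie_halfLie_left (x y z : E n) : G.halfLie (G.halfLie x y) z = 0 := by
  rw [halfLie_swap, halfLie_halfLie_right, neg_zero]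

/-- The dilation `D_r` as a linear map. -/
def dilₗ (r : ℝ) : E n →ₗ[ℝ] E n where
  toFun := G.dil r
  map_add' x y := by ext i; simp [dil, mul_add]
  map_smul' c x := by ext i; simp [dil, mul_left_comm]

lemma dilₗ_apply (r : ℝ) (x : E n) : G.dilₗ r x = G.dil r x := rfl

lemma coord_basis (i : Fin n) : G.coord (G.basis i) = EuclideanSpace.single i 1 := by
  ext j
  simp [coord, Finsupp.single_apply, eq_comm]

lemma dil_single (r : ℝ) (i : Fin n) :
    G.dil r (EuclideanSpace.single i 1) = r ^ G.deg i • EuclideanSpace.single i 1 := by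
  ext j
  by_cases h : j = i
  · subst h; simp [dil]
  · simp [dil, h]

lemma dil_coord_of_mem_layer (r : ℝ) (k : ℕ) {z : 𝔤} (hz : z ∈ layer G.basis G.deg k) :
    G.dil r (G.coord z) = r ^ k • G.coord z := by
  refine LinearMap.eqOn_span (f := G.dilₗ r ∘ₗ G.coord.toLinearMap)
    (g := r ^ k • G.coord.toLinearMap) ?_ hz
  rintro _ ⟨i, rfl, rfl⟩
  simp only [LinearMap.comp_apply, LinearEquiv.coe_coe, LinearMap.smul_apply, dilₗ_apply,
    coord_basis, dil_single]

lemma dil_coord_lie_basis (r : ℝ) (i j : Fin n) :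
    G.dil r (G.coord ⁅G.basis i, G.basis j⁆) =
      (r ^ G.deg i * r ^ G.deg j) • G.coord ⁅G.basis i, G.basis j⁆ := by
  rcases G.lie_basis_eq_zero_or_deg_eq_one i j with h | ⟨hi, hj⟩
  · rw [h, map_zero, smul_zero, ← dilₗ_apply, map_zero]
  · rw [G.dil_coord_of_mem_layer r 2 (G.lie_basis_mem_layer_two i j), hi, hj, pow_one, sq]

lemma halfLie_dil (r : ℝ) (x y : E n) :
    G.halfLie (G.dil r x) (G.dil r y) = G.dil r (G.halfLie x y) := by
  suffices h : G.halfLie.compl₁₂ (G.dilₗ r) (G.dilₗ r) = G.halfLie.compr₂ (G.dilₗ r) from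
    LinearMap.congr_fun₂ h x y
  refine LinearMap.ext_basis (G.basis.map G.coord) (G.basis.map G.coord) fun i j => ?_
  rw [LinearMap.compl₁₂_apply, LinearMap.compr₂_apply, Module.Basis.map_apply,
    Module.Basis.map_apply, dilₗ_apply, dilₗ_apply,
    G.dil_coord_of_mem_layer r _ (G.basis_mem_layer i),
    G.dil_coord_of_mem_layer r _ (G.basis_mem_layer j), LinearMap.map_smul₂, map_smul,
    halfLie_apply, LinearEquiv.symm_apply_apply, LinearEquiv.symm_apply_apply, map_smul, dilₗ_apply,
    dil_coord_lie_basis, smul_smul, smul_comm (1 / 2 : ℝ)]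

lemma mul_dil (r : ℝ) (x y : E n) :
    G.mul (G.dil r x) (G.dil r y) = G.dil r (G.mul x y) := by
  rw [mul_eq, mul_eq, halfLie_dil]
  simp only [← dilₗ_apply, map_add]

lemma mul_neg_mul_mul_neg_mul (a b c : E n) :
    G.mul (G.mul (-a) c) (G.mul (-c) b) = G.mul (-a) b := by
  simp only [mul_eq, map_add, LinearMap.map_neg, LinearMap.neg_apply, LinearMap.add_apply,
    halfLie_halfLie_right, halfLie_halfLie_left, halfLie_self, neg_zero, add_zero]
  abel

lemma dil_zero (r : ℝ) : G.dil r 0 = 0 := (G.dilₗ r).map_zero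

lemma dil_one_left (x : E n) : G.dil 1 x = x := by
  ext i
  simp [dil]

lemma dil_zero_left (x : E n) : G.dil 0 x = 0 := by
  ext i
  simp [dil, (Nat.one_le_iff_ne_zero.1 (G.one_le_deg i))]

lemma continuous_dil_left (x : E n) : Continuous fun r => G.dil r x :=
  (PiLp.continuous_toLp 2 _).comp (continuous_pi fun i => by fun_prop)

lemma continuous_mul : Continuous fun z : E n × E n => G.mul z.1 z.2 := by
  have hclm : Continuous fun x => (G.halfLie x).toContinuousLinearMap :=
    (LinearMap.toContinuousLinearMap.toLinearMap ∘ₗ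
      G.halfLie : E n →ₗ[ℝ] E n →L[ℝ] E n).continuous_of_finiteDimensional
  have h : Continuous fun z : E n × E n => G.halfLie z.1 z.2 :=
    (hclm.comp continuous_fst).clm_apply continuous_snd
  simp only [mul_eq]
  fun_prop

lemma sq_mul_norm_le_norm_dil {r : ℝ} (hr0 : 0 ≤ r) (hr1 : r ≤ 1) (x : E n) :
    r ^ 2 * ‖x‖ ≤ ‖G.dil r x‖ := by
  have hcoord : ∀ i, ‖(r ^ 2 • x) i‖ ≤ ‖(G.dil r x) i‖ := fun i => by
    simp only [dil, PiLp.smul_apply, smul_eq_mul, norm_mul, norm_pow]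
    rw [Real.norm_of_nonneg hr0]
    gcongr ?_ * _
    exact pow_le_pow_of_le_one hr0 hr1 ((G.deg_le_step i).trans G.step_le_two)
  calc r ^ 2 * ‖x‖ = ‖r ^ 2 • x‖ := by rw [norm_smul, norm_pow, Real.norm_of_nonneg hr0]
    _ ≤ ‖G.dil r x‖ := by
        rw [EuclideanSpace.norm_eq, EuclideanSpace.norm_eq]
        gcongr with i
        exact hcoord i

lemma exists_norm_dil_eq_one {x : E n} (hx : 1 < ‖x‖) :
    ∃ r : ℝ, 0 < r ∧ r ≤ 1 ∧ ‖G.dil r x‖ = 1 := by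
  have h1 : (1 : ℝ) ∈ Set.Icc ‖G.dil 0 x‖ ‖G.dil 1 x‖ := by
    rw [dil_zero_left, dil_one_left, norm_zero]
    exact ⟨zero_le_one, hx.le⟩
  obtain ⟨r, ⟨hr0, hr1⟩, hr⟩ :=
    intermediate_value_Icc zero_le_one (G.continuous_dil_left x).norm.continuousOn h1
  refine ⟨r, hr0.lt_of_ne ?_, hr1, hr⟩
  rintro rfl
  simp [dil_zero_left] at hr

lemma det_dilₗ (r : ℝ) : LinearMap.det (G.dilₗ r) = r ^ G.homDim := by
  have hdiag : LinearMap.toMatrix (EuclideanSpace.basisFun (Fin n) ℝ).toBasis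
      (EuclideanSpace.basisFun (Fin n) ℝ).toBasis (G.dilₗ r) =
      Matrix.diagonal fun i => r ^ G.deg i := by
    ext i j
    rw [LinearMap.toMatrix_apply, OrthonormalBasis.coe_toBasis, EuclideanSpace.basisFun_apply,
      dilₗ_apply, dil_single]
    by_cases h : i = j
    · subst h; simp
    · simp [h]
  rw [← LinearMap.det_toMatrix (EuclideanSpace.basisFun (Fin n) ℝ).toBasis, hdiag,
    Matrix.det_diagonal, homDim, Finset.prod_pow_eq_pow_sum]

lemma det_one_add_halfLie (c : E n) : LinearMap.det (1 + G.halfLie c) = 1 := by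
  have hnil : IsNilpotent (-(G.halfLie c) : Module.End ℝ (E n)) := by
    refine ⟨2, ?_⟩
    rw [neg_sq, sq]
    ext x : 1
    exact G.halfLie_halfLie_right _ _ _
  have heval := LinearMap.eval_charpoly (-(G.halfLie c) : Module.End ℝ (E n)) 1
  rw [(LinearMap.isNilpotent_iff_charpoly _).1 hnil] at heval
  simpa using heval.symm

lemma volume_preimage_mul (c : E n) (S : Set (E n)) :
    volume (G.mul c ⁻¹' S) = volume S := by
  have hmul : G.mul c ⁻¹' S =
      (1 + G.halfLie c : E n →ₗ[ℝ] E n) ⁻¹' ((fun x => c + x) ⁻¹' S) := by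
    ext x
    simp [mul_eq, add_assoc]
  rw [hmul, Measure.addHaar_preimage_linearMap _ (by rw [det_one_add_halfLie]; exact one_ne_zero),
    det_one_add_halfLie, measure_preimage_add]
  simp

lemma volume_ball {ν : E n → ℝ} (hν : G.IsHomQuasiNorm ν) (c : E n) {R : ℝ} (hR : 0 < R) :
    volume (G.ball ν c R) = ENNReal.ofReal (R ^ G.homDim) * volume {x | ν x < 1} := by
  have hball : G.ball ν c R = G.mul (-c) ⁻¹' (G.dilₗ R⁻¹ ⁻¹' {x | ν x < 1}) := by
    ext x
    change ν (G.mul (-c) x) < R ↔ ν (G.dil R⁻¹ (G.mul (-c) x)) < 1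
    rw [hν.homogeneous _ (inv_pos.2 hR), inv_mul_lt_iff₀ hR, mul_one]
  have hdet : LinearMap.det (G.dilₗ R⁻¹) ≠ 0 := by
    rw [det_dilₗ]; positivity
  rw [hball, volume_preimage_mul, Measure.addHaar_preimage_linearMap _ hdet, det_dilₗ, inv_pow,
    inv_inv, abs_of_pos (by positivity)]

/-- The left-invariant quasi-distance `ν (a⁻¹ * b)` of a homogeneous quasi-norm `ν`, whose balls
are the sets `G.ball ν a R`. -/
def quasiDist (ν : E n → ℝ) (a b : E n) : ℝ := ν (G.mul (-a) b)

lemma quasiDist_zero_left (ν : E n → ℝ) (x : E n) : G.quasiDist ν 0 x = ν x := by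
  simp [quasiDist, mul_eq]

namespace IsHomQuasiNorm

variable {G} {ν ν' : E n → ℝ}

lemma map_zero (hν : G.IsHomQuasiNorm ν) : ν 0 = 0 := by
  have := hν.homogeneous 2 two_pos 0
  rw [G.dil_zero] at this
  linarith

lemma pos (hν : G.IsHomQuasiNorm ν) {x : E n} (hx : x ≠ 0) : 0 < ν x :=
  (hν.nonneg x).lt_of_ne fun h => hx (hν.eq_zero x h.symm)

lemma isCompact_setOf_le_one (hν : G.IsHomQuasiNorm ν) : IsCompact {x | ν x ≤ 1} := by
  obtain ⟨m, hm0, hm⟩ := (isCompact_sphere (0 : E n) 1).exists_forall_le'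
    hν.continuous.continuousOn (a := 0) fun x hx => hν.pos (by rintro rfl; simp at hx)
  refine Metric.isCompact_of_isClosed_isBounded (isClosed_le hν.continuous continuous_const) ?_
  refine isBounded_iff_forall_norm_le.2 ⟨max 1 (1 / m ^ 2), fun x hx => ?_⟩
  rcases le_or_gt ‖x‖ 1 with hx1 | hx1
  · exact hx1.trans (le_max_left _ _)
  obtain ⟨r, hr0, hr1, hr⟩ := G.exists_norm_dil_eq_one hx1
  have hmr : m ≤ r := calc
    m ≤ ν (G.dil r x) := hm _ (by simpa using hr)
    _ = r * ν x := hν.homogeneous r hr0 x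
    _ ≤ r := mul_le_of_le_one_right hr0.le hx
  refine le_trans ?_ (le_max_right _ _)
  rw [le_div_iff₀' (by positivity)]
  calc m ^ 2 * ‖x‖ ≤ r ^ 2 * ‖x‖ := by gcongr
    _ ≤ ‖G.dil r x‖ := G.sq_mul_norm_le_norm_dil hr0.le hr1 x
    _ = 1 := hr

lemma dil_inv_le_one_iff (hν : G.IsHomQuasiNorm ν) {t : ℝ} (ht : 0 < t) {x : E n} :
    ν (G.dil t⁻¹ x) ≤ 1 ↔ ν x ≤ t := by
  rw [hν.homogeneous _ (inv_pos.2 ht), inv_mul_le_iff₀ ht, mul_one]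

lemma isCompact_setOf_le (hν : G.IsHomQuasiNorm ν) {t : ℝ} (ht : 0 < t) :
    IsCompact {x | ν x ≤ t} := by
  have himage : {x | ν x ≤ t} ⊆ G.dilₗ t '' {x | ν x ≤ 1} := fun x hx =>
    ⟨G.dil t⁻¹ x, (hν.dil_inv_le_one_iff ht).2 hx, by
      ext i
      simp [dilₗ_apply, dil, ht.ne']⟩
  exact (hν.isCompact_setOf_le_one.image
    (G.dilₗ t).continuous_of_finiteDimensional).of_isClosed_subset
    (isClosed_le hν.continuous continuous_const) himage

lemma volume_pos (hν : G.IsHomQuasiNorm ν) : 0 < volume {x | ν x < 1} :=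
  (isOpen_lt hν.continuous continuous_const).measure_pos volume ⟨0, by simp [hν.map_zero]⟩

lemma volume_lt_top (hν : G.IsHomQuasiNorm ν) : volume {x | ν x < 1} < ∞ :=
  (measure_mono fun x (hx : ν x < 1) => hx.le).trans_lt hν.isCompact_setOf_le_one.measure_lt_top

lemma exists_le_mul (hν : G.IsHomQuasiNorm ν) (hν' : G.IsHomQuasiNorm ν') :
    ∃ C, 1 ≤ C ∧ ∀ x, ν x ≤ C * ν' x := by
  obtain ⟨C, hC⟩ := hν'.isCompact_setOf_le_one.exists_bound_of_continuousOn
    hν.continuous.continuousOn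
  refine ⟨max 1 C, le_max_left _ _, fun x => ?_⟩
  rcases eq_or_ne x 0 with rfl | hx
  · rw [hν.map_zero, hν'.map_zero, mul_zero]
  have ht := hν'.pos hx
  have hbound := hC _ ((hν'.dil_inv_le_one_iff ht).2 le_rfl)
  rw [Real.norm_of_nonneg (hν.nonneg _), hν.homogeneous _ (inv_pos.2 ht),
    inv_mul_le_iff₀' ht] at hbound
  exact hbound.trans (mul_le_mul_of_nonneg_right (le_max_right _ _) ht.le)

lemma exists_mul_le (hν : G.IsHomQuasiNorm ν) :
    ∃ C, 1 ≤ C ∧ ∀ x y, ν (G.mul x y) ≤ C * (ν x + ν y) := by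
  obtain ⟨C, hC⟩ := (hν.isCompact_setOf_le_one.prod
    hν.isCompact_setOf_le_one).exists_bound_of_continuousOn
    (hν.continuous.comp G.continuous_mul).continuousOn
  refine ⟨max 1 C, le_max_left _ _, fun x y => ?_⟩
  have hx0 := hν.nonneg x
  have hy0 := hν.nonneg y
  rcases (add_nonneg hx0 hy0).eq_or_lt with h0 | ht
  · obtain rfl : x = 0 := hν.eq_zero x (by linarith)
    obtain rfl : y = 0 := hν.eq_zero y (by linarith)
    simp [mul_eq, hν.map_zero]
  have hbound := hC (G.dil (ν x + ν y)⁻¹ x, G.dil (ν x + ν y)⁻¹ y)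
    ⟨(hν.dil_inv_le_one_iff ht).2 (by linarith), (hν.dil_inv_le_one_iff ht).2 (by linarith)⟩
  rw [Function.comp_apply, G.mul_dil, Real.norm_of_nonneg (hν.nonneg _),
    hν.homogeneous _ (inv_pos.2 ht), inv_mul_le_iff₀' ht] at hbound
  exact hbound.trans (mul_le_mul_of_nonneg_right (le_max_right _ _) ht.le)

lemma quasiDist_comm (hν : G.IsHomQuasiNorm ν) (a b : E n) :
    G.quasiDist ν a b = G.quasiDist ν b a := by
  have hneg : -G.mul (-a) b = G.mul (-b) a := by
    rw [mul_eq, mul_eq, LinearMap.map_neg, LinearMap.map_neg, LinearMap.neg_apply,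
      LinearMap.neg_apply, G.halfLie_swap a b]
    abel
  rw [quasiDist, ← hν.symmetric, hneg, quasiDist]

lemma exists_quasiDist_le (hν : G.IsHomQuasiNorm ν) : ∃ C, 1 ≤ C ∧ ∀ a b c,
    G.quasiDist ν a b ≤ C * (G.quasiDist ν a c + G.quasiDist ν c b) := by
  obtain ⟨C, hC1, hC⟩ := hν.exists_mul_le
  refine ⟨C, hC1, fun a b c => ?_⟩
  rw [quasiDist, ← G.mul_neg_mul_mul_neg_mul a b c]
  exact hC _ _

lemma exists_one_add_sq_le (hν : G.IsHomQuasiNorm ν) (hν' : G.IsHomQuasiNorm ν') :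
    ∃ C : ℝ, 0 < C ∧ ∀ x, 1 + ν x ^ 2 ≤ C * (1 + ν' x ^ 2) := by
  obtain ⟨C, hC1, hC⟩ := hν.exists_le_mul hν'
  refine ⟨C ^ 2, by positivity, fun x => ?_⟩
  have hsq := pow_le_pow_left₀ (hν.nonneg x) (hC x) 2
  nlinarith

lemma innerRadius_le (hν : G.IsHomQuasiNorm ν) (P : Set (E n)) :
    G.innerRadius ν P ≤ (volume P / volume {x | ν x < 1}) ^ (G.homDim : ℝ)⁻¹ := by
  refine iSup_le fun c => iSup_le fun r => iSup_le fun hball => ?_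
  rcases le_or_gt r 0 with hr | hr
  · simp [ENNReal.ofReal_of_nonpos hr]
  rw [ENNReal.le_rpow_inv_iff (by exact_mod_cast G.homDim_pos), ENNReal.rpow_natCast,
    ← ENNReal.ofReal_pow hr.le,
    ENNReal.le_div_iff_mul_le (.inl hν.volume_pos.ne') (.inl hν.volume_lt_top.ne),
    ← G.volume_ball hν c hr]
  exact measure_mono hball

lemma exists_quasiDist_le_of_outerRadius_lt (hν : G.IsHomQuasiNorm ν) :
    ∃ T : ℝ, 0 < T ∧ ∀ (P : Set (E n)) (R : ℝ), G.outerRadius ν P < ENNReal.ofReal R →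
      ∀ ξ ∈ P, ∀ η ∈ P, G.quasiDist ν ξ η ≤ T * R := by
  obtain ⟨C, hC1, hC⟩ := hν.exists_quasiDist_le
  refine ⟨C * 2, by positivity, fun P R hR ξ hξ η hη => ?_⟩
  simp only [outerRadius, iInf_lt_iff] at hR
  obtain ⟨c, R', hball, hR'⟩ := hR
  have hdist : ∀ x ∈ P, G.quasiDist ν c x ≤ R := fun x hx =>
    (show G.quasiDist ν c x < R' from hball hx).le.trans
      (ENNReal.ofReal_lt_ofReal_iff'.1 hR').1.le
  calc G.quasiDist ν ξ η ≤ C * (G.quasiDist ν ξ c + G.quasiDist ν c η) := hC ξ η c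
    _ ≤ C * (R + R) := by
        gcongr
        · rw [hν.quasiDist_comm]
          exact hdist ξ hξ
        · exact hdist η hη
    _ = C * 2 * R := by ring

end IsHomQuasiNorm

end AdmissibleLieGroup

/-! ### Comparison of two coverings -/

lemma rpow_le_rpow_abs_mul_rpow {a b B : ℝ} (ha : 0 < a) (hb : 0 < b) (hB : 0 < B)
    (hab : a ≤ B * b) (hba : b ≤ B * a) (t : ℝ) : a ^ t ≤ B ^ |t| * b ^ t := by
  rcases le_total 0 t with ht | ht
  · rw [abs_of_nonneg ht, ← Real.mul_rpow hB.le hb.le]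
    exact Real.rpow_le_rpow ha.le hab ht
  · rw [abs_of_nonpos ht, Real.rpow_neg hB.le, ← Real.inv_rpow hB.le,
      ← Real.mul_rpow (inv_pos.2 hB).le hb.le]
    exact Real.rpow_le_rpow_of_nonpos (by positivity) ((inv_mul_le_iff₀ hB).2 hba) ht

lemma sum_measure_le_mul_measure {Ω I : Type*} [MeasurableSpace Ω] {μ : Measure Ω} {N : ℕ}
    {P : I → Set Ω} {F : Finset I} {U : Set Ω} (hP : ∀ i ∈ F, MeasurableSet (P i))
    (hU : ∀ i ∈ F, P i ⊆ U) (hN : ∀ x, {i | x ∈ P i}.encard ≤ N) :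
    ∑ i ∈ F, μ (P i) ≤ N * μ U := by
  classical
  calc ∑ i ∈ F, μ (P i) = ∫⁻ x, ∑ i ∈ F, (P i).indicator 1 x ∂μ := by
        rw [lintegral_finsetSum' _ fun i hi =>
          (measurable_one.indicator (hP i hi)).aemeasurable]
        exact Finset.sum_congr rfl fun i hi => (lintegral_indicator_one (hP i hi)).symm
    _ ≤ ∫⁻ x, U.indicator (fun _ => (N : ℝ≥0∞)) x ∂μ := by
        refine lintegral_mono fun x => ?_
        by_cases hx : x ∈ U
        · have hcard : (F.filter fun i => x ∈ P i).card ≤ N := by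
            rw [← ENat.natCast_le_natCast, ← Set.encard_coe_eq_coe_finsetCard]
            exact (Set.encard_le_encard fun i hi => (Finset.mem_filter.1 hi).2).trans (hN x)
          simp only [Set.indicator_apply, Pi.one_apply, Finset.sum_boole, if_pos hx]
          exact_mod_cast hcard
        · rw [Finset.sum_eq_zero fun i hi =>
            Set.indicator_of_notMem (fun hxi => hx (hU i hi hxi)) _]
          exact zero_le
    _ ≤ N * μ U := lintegral_indicator_const_le _ _

namespace AlphaModData

variable {n : ℕ} {𝔤 : Type*} [LieRing 𝔤] [LieAlgebra ℝ 𝔤]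
  {G : AdmissibleLieGroup n 𝔤} {α : ℝ} {I κ : Type*}
  (d : AlphaModData G α I) (d' : AlphaModData G α κ)

/-- The volume of the `i`-th set of the covering, as a real number. -/
def vol (i : I) : ℝ := (volume (d.P i)).toReal

/-- The size `1 + ν(ξᵢ)²` of the `i`-th point, which determines the weights of the spaces. -/
def bracketSq (i : I) : ℝ := 1 + d.ν (d.ξ i) ^ 2

lemma bracketSq_pos (i : I) : 0 < d.bracketSq i := by
  unfold bracketSq
  positivity

lemma volume_P (i : I) : volume (d.P i) = ENNReal.ofReal (d.vol i) := by
  obtain ⟨C, -, h⟩ := d.isAlphaCovering.size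
  exact (ENNReal.ofReal_toReal ((h i _ (d.ξ_mem i)).2.trans_lt ENNReal.ofReal_lt_top).ne).symm

lemma vol_pos (i : I) : 0 < d.vol i := by
  rw [← ENNReal.ofReal_pos, ← volume_P]
  exact (d.isAlphaCovering.isOpen i).measure_pos volume (d.isAlphaCovering.nonempty i)

lemma exists_vol_bounds : ∃ C : ℝ, 0 < C ∧ ∀ i, ∀ ξ ∈ d.P i,
    (1 + d.ν ξ ^ 2) ^ (α * G.homDim / 2) ≤ C * d.vol i ∧
      d.vol i ≤ C * (1 + d.ν ξ ^ 2) ^ (α * G.homDim / 2) := by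
  obtain ⟨C, hC, h⟩ := d.isAlphaCovering.size
  refine ⟨C, hC, fun i ξ hξ => ?_⟩
  have hsize := h i ξ hξ
  rwa [volume_P, ENNReal.ofReal_le_ofReal_iff (d.vol_pos i).le,
    ENNReal.ofReal_le_ofReal_iff (by positivity), inv_mul_le_iff₀ hC] at hsize

lemma exists_outerRadius_lt : ∃ A : ℝ, 0 < A ∧ ∀ i, G.outerRadius d.ν (d.P i) <
    ENNReal.ofReal (A * d.vol i ^ (G.homDim : ℝ)⁻¹) := by
  have hν := d.isHomQuasiNorm
  obtain ⟨K, hK1, hK⟩ := d.isAlphaCovering.ratio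
  set v₀ := (volume {x | d.ν x < 1}).toReal
  have hv₀ : 0 < v₀ := ENNReal.toReal_pos hν.volume_pos.ne' hν.volume_lt_top.ne
  have hinner : ∀ i, G.innerRadius d.ν (d.P i) ≤
      ENNReal.ofReal ((d.vol i / v₀) ^ (G.homDim : ℝ)⁻¹) := fun i => by
    refine (hν.innerRadius_le _).trans_eq ?_
    rw [volume_P, ← ENNReal.ofReal_toReal hν.volume_lt_top.ne, ← ENNReal.ofReal_div_of_pos hv₀,
      ENNReal.ofReal_rpow_of_nonneg (div_nonneg (d.vol_pos i).le hv₀.le) (by positivity)]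
  refine ⟨2 * K * (v₀ ^ (G.homDim : ℝ)⁻¹)⁻¹, by positivity, fun i => ?_⟩
  have hvol := d.vol_pos i
  calc G.outerRadius d.ν (d.P i)
      ≤ ENNReal.ofReal K * ENNReal.ofReal ((d.vol i / v₀) ^ (G.homDim : ℝ)⁻¹) :=
        (hK i).trans (mul_le_mul_right (hinner i) _)
    _ = ENNReal.ofReal (K * (v₀ ^ (G.homDim : ℝ)⁻¹)⁻¹ * d.vol i ^ (G.homDim : ℝ)⁻¹) := by
        rw [← ENNReal.ofReal_mul (by positivity), Real.div_rpow hvol.le hv₀.le,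
          div_eq_inv_mul, mul_assoc]
    _ < _ := by
        rw [ENNReal.ofReal_lt_ofReal_iff (by positivity), mul_assoc 2 K, mul_assoc 2]
        exact lt_two_mul_self (by positivity)

lemma exists_quasiDist_le_vol : ∃ A : ℝ, 0 < A ∧ ∀ i, ∀ ξ ∈ d.P i, ∀ η ∈ d.P i,
    G.quasiDist d.ν ξ η ≤ A * d.vol i ^ (G.homDim : ℝ)⁻¹ := by
  obtain ⟨T, hT, hdist⟩ := d.isHomQuasiNorm.exists_quasiDist_le_of_outerRadius_lt
  obtain ⟨A, hA, hrad⟩ := d.exists_outerRadius_lt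
  refine ⟨T * A, mul_pos hT hA, fun i ξ hξ η hη => ?_⟩
  rw [mul_assoc]
  exact hdist _ _ (hrad i) ξ hξ η hη

lemma exists_isCompact_superset (i : I) : ∃ K, IsCompact K ∧ d.P i ⊆ K := by
  have hν := d.isHomQuasiNorm
  obtain ⟨A, -, hdist⟩ := d.exists_quasiDist_le_vol
  obtain ⟨C, hC1, hC⟩ := hν.exists_quasiDist_le
  set t := C * (d.ν (d.ξ i) + A * d.vol i ^ (G.homDim : ℝ)⁻¹)
  refine ⟨{x | d.ν x ≤ max 1 t}, hν.isCompact_setOf_le (by positivity), fun x hx => ?_⟩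
  refine le_trans ?_ (le_max_right 1 t)
  have hx' := hdist i _ (d.ξ_mem i) x hx
  calc d.ν x = G.quasiDist d.ν 0 x := (G.quasiDist_zero_left _ _).symm
    _ ≤ C * (G.quasiDist d.ν 0 (d.ξ i) + G.quasiDist d.ν (d.ξ i) x) := hC _ _ _
    _ ≤ t := by
        rw [G.quasiDist_zero_left]
        simp only [t]
        gcongr

lemma finite_setOf_inter_nonempty {K : Set (E n)} (hK : IsCompact K) :
    {i | (K ∩ d.P i).Nonempty}.Finite := by
  obtain ⟨N, hN⟩ := d.isAlphaCovering.admissible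
  obtain ⟨J, hJ⟩ := hK.elim_finite_subcover d.P d.isAlphaCovering.isOpen
    (by rw [d.isAlphaCovering.covers]; exact Set.subset_univ _)
  refine (J.finite_toSet.biUnion fun j _ => Set.finite_of_encard_le_coe (hN j)).subset ?_
  rintro i ⟨x, hxK, hxi⟩
  obtain ⟨j, hj, hxj⟩ := Set.mem_iUnion₂.1 (hJ hxK)
  exact Set.mem_iUnion₂.2 ⟨j, hj, x, hxj, hxi⟩

lemma finite_setOf_P_inter_nonempty (i : I) : {j | (d.P i ∩ d'.P j).Nonempty}.Finite := by
  obtain ⟨K, hK, hiK⟩ := d.exists_isCompact_superset i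
  exact (d'.finite_setOf_inter_nonempty hK).subset fun j hj => hj.mono (by gcongr)

/-- The indices of the sets of the covering of `d'` that meet the `i`-th set of that of `d`. -/
def nbhd (i : I) : Finset κ := (d.finite_setOf_P_inter_nonempty d' i).toFinset

variable {d d'} in
@[simp]
lemma mem_nbhd {i : I} {j : κ} : j ∈ d.nbhd d' i ↔ (d.P i ∩ d'.P j).Nonempty :=
  Set.Finite.mem_toFinset _

variable {d d'} in
lemma mem_nbhd_comm {i : I} {j : κ} : j ∈ d.nbhd d' i ↔ i ∈ d'.nbhd d j := by
  rw [mem_nbhd, mem_nbhd, Set.inter_comm]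

lemma exists_vol_rpow_le (hα : α ≤ 1) : ∃ M : ℝ, 0 < M ∧ ∀ i, ∀ η ∈ d.P i,
    d.vol i ^ (G.homDim : ℝ)⁻¹ ≤ M * √(1 + d.ν η ^ 2) := by
  have hQ : (0 : ℝ) < G.homDim := by exact_mod_cast G.homDim_pos
  obtain ⟨C, hC, hvol⟩ := d.exists_vol_bounds
  refine ⟨C ^ (G.homDim : ℝ)⁻¹, by positivity, fun i η hη => ?_⟩
  have hexp : α * G.homDim / 2 * (G.homDim : ℝ)⁻¹ ≤ 1 / 2 := by
    field_simp
    exact hα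
  calc d.vol i ^ (G.homDim : ℝ)⁻¹
      ≤ (C * (1 + d.ν η ^ 2) ^ (α * G.homDim / 2)) ^ (G.homDim : ℝ)⁻¹ :=
        Real.rpow_le_rpow (d.vol_pos i).le (hvol i η hη).2 (by positivity)
    _ = C ^ (G.homDim : ℝ)⁻¹ *
          (1 + d.ν η ^ 2) ^ (α * G.homDim / 2 * (G.homDim : ℝ)⁻¹) := by
        rw [Real.mul_rpow hC.le (by positivity), ← Real.rpow_mul (by positivity)]
    _ ≤ C ^ (G.homDim : ℝ)⁻¹ * √(1 + d.ν η ^ 2) := by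
        rw [Real.sqrt_eq_rpow]
        gcongr
        exact le_add_of_nonneg_right (sq_nonneg _)

lemma exists_one_add_sq_le (hα : α ≤ 1) : ∃ B : ℝ, 0 < B ∧ ∀ i, ∀ ξ ∈ d.P i,
    ∀ η ∈ d.P i, 1 + d.ν ξ ^ 2 ≤ B * (1 + d.ν η ^ 2) := by
  have hν := d.isHomQuasiNorm
  obtain ⟨M, hM, hvol⟩ := d.exists_vol_rpow_le hα
  obtain ⟨A, hA, hdist⟩ := d.exists_quasiDist_le_vol
  obtain ⟨T, hT1, hT⟩ := hν.exists_quasiDist_le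
  refine ⟨1 + (T * (1 + A * M)) ^ 2, by positivity, fun i ξ hξ η hη => ?_⟩
  set J := √(1 + d.ν η ^ 2)
  have hJ : J ^ 2 = 1 + d.ν η ^ 2 := Real.sq_sqrt (by positivity)
  have hνξ : d.ν ξ ≤ T * (1 + A * M) * J := calc
    d.ν ξ = G.quasiDist d.ν 0 ξ := (G.quasiDist_zero_left _ _).symm
    _ ≤ T * (G.quasiDist d.ν 0 η + G.quasiDist d.ν η ξ) := hT 0 ξ η
    _ ≤ T * (J + A * (M * J)) := by
        gcongr
        · rw [G.quasiDist_zero_left]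
          exact Real.le_sqrt_of_sq_le (by linarith)
        · exact (hdist i η hη ξ hξ).trans (by gcongr; exact hvol i η hη)
    _ = T * (1 + A * M) * J := by ring
  calc 1 + d.ν ξ ^ 2 ≤ 1 + (T * (1 + A * M) * J) ^ 2 := by
        gcongr
        exact hν.nonneg ξ
    _ = 1 + (T * (1 + A * M)) ^ 2 * (1 + d.ν η ^ 2) := by rw [mul_pow, hJ]
    _ ≤ (1 + (T * (1 + A * M)) ^ 2) * (1 + d.ν η ^ 2) := by nlinarith [sq_nonneg (d.ν η)]

lemma exists_bracketSq_le (hα : α ≤ 1) : ∃ B : ℝ, 0 < B ∧ ∀ i, ∀ j ∈ d.nbhd d' i,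
    d.bracketSq i ≤ B * d'.bracketSq j := by
  obtain ⟨B₁, hB₁, h₁⟩ := d.exists_one_add_sq_le hα
  obtain ⟨B₂, hB₂, h₂⟩ := d'.exists_one_add_sq_le hα
  obtain ⟨C, hC, h⟩ := d.isHomQuasiNorm.exists_one_add_sq_le d'.isHomQuasiNorm
  refine ⟨B₁ * (C * B₂), by positivity, fun i j hij => ?_⟩
  obtain ⟨η, hi, hj⟩ := mem_nbhd.1 hij
  calc d.bracketSq i ≤ B₁ * (1 + d.ν η ^ 2) := h₁ i _ (d.ξ_mem i) η hi
    _ ≤ B₁ * (C * (1 + d'.ν η ^ 2)) := by gcongr; exact h η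
    _ ≤ B₁ * (C * (B₂ * d'.bracketSq j)) := by gcongr; exact h₂ j η hj _ (d'.ξ_mem j)
    _ = B₁ * (C * B₂) * d'.bracketSq j := by ring

lemma exists_bracketSq_rpow_le (hα : α ≤ 1) (t : ℝ) : ∃ B : ℝ, 0 < B ∧ ∀ i, ∀ j ∈ d.nbhd d' i,
    d.bracketSq i ^ t ≤ B * d'.bracketSq j ^ t := by
  obtain ⟨B₁, hB₁, h₁⟩ := d.exists_bracketSq_le d' hα
  obtain ⟨B₂, -, h₂⟩ := d'.exists_bracketSq_le d hα
  refine ⟨max B₁ B₂ ^ |t|, by positivity, fun i j hij => ?_⟩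
  have hi := d.bracketSq_pos i
  have hj := d'.bracketSq_pos j
  refine rpow_le_rpow_abs_mul_rpow hi hj (by positivity) ((h₁ i j hij).trans ?_)
    ((h₂ j i (mem_nbhd_comm.1 hij)).trans ?_) t <;> gcongr
  exacts [le_max_left _ _, le_max_right _ _]

lemma exists_vol_le (hα : α ≤ 1) : ∃ S : ℝ, 0 < S ∧ ∀ i, ∀ j ∈ d.nbhd d' i,
    d.vol i ≤ S * d'.vol j := by
  obtain ⟨C₁, hC₁, h₁⟩ := d.exists_vol_bounds
  obtain ⟨C₂, hC₂, h₂⟩ := d'.exists_vol_bounds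
  obtain ⟨B, hB, h⟩ := d.exists_bracketSq_rpow_le d' hα (α * G.homDim / 2)
  refine ⟨C₁ * (B * C₂), by positivity, fun i j hij => ?_⟩
  calc d.vol i ≤ C₁ * d.bracketSq i ^ (α * G.homDim / 2) := (h₁ i _ (d.ξ_mem i)).2
    _ ≤ C₁ * (B * d'.bracketSq j ^ (α * G.homDim / 2)) := by gcongr; exact h i j hij
    _ ≤ C₁ * (B * (C₂ * d'.vol j)) := by gcongr; exact (h₂ j _ (d'.ξ_mem j)).1
    _ = C₁ * (B * C₂) * d'.vol j := by ring

lemma exists_subset_ball (hα : α ≤ 1) : ∃ M : ℝ, 0 < M ∧ ∀ i, ∀ j ∈ d.nbhd d' i,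
    d'.P j ⊆ G.ball d.ν (d.ξ i) (M * d.vol i ^ (G.homDim : ℝ)⁻¹) := by
  obtain ⟨S, hS, hvol⟩ := d'.exists_vol_le d hα
  obtain ⟨A, hA, hdist⟩ := d.exists_quasiDist_le_vol
  obtain ⟨A', hA', hdist'⟩ := d'.exists_quasiDist_le_vol
  obtain ⟨T, hT1, hT⟩ := d.isHomQuasiNorm.exists_quasiDist_le
  obtain ⟨L, hL1, hL⟩ := d.isHomQuasiNorm.exists_le_mul d'.isHomQuasiNorm
  refine ⟨T * (A + L * (A' * S ^ (G.homDim : ℝ)⁻¹)) + 1, by positivity,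
    fun i j hij y hy => ?_⟩
  obtain ⟨η, hηi, hηj⟩ := mem_nbhd.1 hij
  have hvol_i := d.vol_pos i
  set τ := d.vol i ^ (G.homDim : ℝ)⁻¹
  have hτ : 0 < τ := by positivity
  have hτj : d'.vol j ^ (G.homDim : ℝ)⁻¹ ≤ S ^ (G.homDim : ℝ)⁻¹ * τ := by
    rw [← Real.mul_rpow hS.le hvol_i.le]
    exact Real.rpow_le_rpow (d'.vol_pos j).le (hvol j i (mem_nbhd_comm.1 hij)) (by positivity)
  have hηy : G.quasiDist d.ν η y ≤ L * (A' * (S ^ (G.homDim : ℝ)⁻¹ * τ)) := calc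
    G.quasiDist d.ν η y ≤ L * G.quasiDist d'.ν η y := hL _
    _ ≤ L * (A' * (S ^ (G.homDim : ℝ)⁻¹ * τ)) := by
        gcongr
        exact (hdist' j η hηj y hy).trans (by gcongr)
  calc G.quasiDist d.ν (d.ξ i) y
      ≤ T * (G.quasiDist d.ν (d.ξ i) η + G.quasiDist d.ν η y) := hT _ _ _
    _ ≤ T * (A * τ + L * (A' * (S ^ (G.homDim : ℝ)⁻¹ * τ))) := by
        gcongr
        exact hdist i _ (d.ξ_mem i) η hηi
    _ < T * (A * τ + L * (A' * (S ^ (G.homDim : ℝ)⁻¹ * τ))) + τ := lt_add_of_pos_right _ hτ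
    _ = (T * (A + L * (A' * S ^ (G.homDim : ℝ)⁻¹)) + 1) * τ := by ring

lemma exists_sum_volume_le : ∃ N : ℕ, ∀ (F : Finset I) (U : Set (E n)),
    (∀ i ∈ F, d.P i ⊆ U) → ∑ i ∈ F, volume (d.P i) ≤ N * volume U := by
  obtain ⟨N, hN⟩ := d.isAlphaCovering.admissible
  refine ⟨N, fun F U hU => sum_measure_le_mul_measure
    (fun i _ => (d.isAlphaCovering.isOpen i).measurableSet) hU fun x => ?_⟩
  obtain ⟨i, hi⟩ := Set.iUnion_eq_univ_iff.1 d.isAlphaCovering.covers x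
  have hsub : {j | x ∈ d.P j} ⊆ {j | (d.P i ∩ d.P j).Nonempty} := fun j hj => ⟨x, hi, hj⟩
  exact (Set.encard_le_encard hsub).trans (hN i)

lemma exists_card_nbhd_le (hα : α ≤ 1) : ∃ N : ℕ, ∀ i, (d.nbhd d' i).card ≤ N := by
  -- packing: the sets `P'_j` meeting `P_i` have bounded overlap and at least a fixed multiple of
  -- the volume of `P_i`, and they lie in one ball whose volume is a fixed multiple of that of `P_i`
  have hν := d.isHomQuasiNorm
  obtain ⟨N', hN'⟩ := d'.exists_sum_volume_le
  obtain ⟨S, hS, hvol⟩ := d.exists_vol_le d' hα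
  obtain ⟨M, hM, hball⟩ := d.exists_subset_ball d' hα
  set v₀ := (volume {x | d.ν x < 1}).toReal
  obtain ⟨N, hN⟩ := exists_nat_ge (N' * (M ^ G.homDim * v₀) * S)
  refine ⟨N, fun i => ?_⟩
  have hvol_i := d.vol_pos i
  have hvol_ball : volume (G.ball d.ν (d.ξ i) (M * d.vol i ^ (G.homDim : ℝ)⁻¹)) =
      ENNReal.ofReal (M ^ G.homDim * d.vol i * v₀) := by
    rw [G.volume_ball hν _ (by positivity), mul_pow,
      Real.rpow_inv_natCast_pow hvol_i.le G.homDim_pos.ne', ENNReal.ofReal_mul (q := v₀)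
      (by positivity), ENNReal.ofReal_toReal hν.volume_lt_top.ne]
  have hsum : ∑ j ∈ d.nbhd d' i, d'.vol j ≤ N' * (M ^ G.homDim * d.vol i * v₀) := by
    have := hN' (d.nbhd d' i) _ (hball i)
    simp only [volume_P, hvol_ball] at this
    rwa [← ENNReal.ofReal_sum_of_nonneg fun j _ => (d'.vol_pos j).le, ← ENNReal.ofReal_natCast,
      ← ENNReal.ofReal_mul (by positivity), ENNReal.ofReal_le_ofReal_iff (by positivity)] at this
  have hcard : ((d.nbhd d' i).card : ℝ) * d.vol i ≤ N * d.vol i := calc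
    ((d.nbhd d' i).card : ℝ) * d.vol i ≤ ∑ j ∈ d.nbhd d' i, S * d'.vol j := by
        rw [← nsmul_eq_mul]
        exact Finset.card_nsmul_le_sum _ _ _ (hvol i)
    _ ≤ S * (N' * (M ^ G.homDim * d.vol i * v₀)) := by
        rw [← Finset.mul_sum]
        gcongr
    _ = N' * (M ^ G.homDim * v₀) * S * d.vol i := by ring
    _ ≤ N * d.vol i := by gcongr
  exact_mod_cast le_of_mul_le_mul_right hcard hvol_i

/-- The weight `(1 + ν(ξᵢ)²)^{s/2}` in the norm of `M^{s,α}_{p,q}(G)`. -/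
def weight (s : ℝ) (i : I) : ℝ≥0∞ := ENNReal.ofReal (d.bracketSq i ^ (s / 2))

lemma weight_ne_top (s : ℝ) (i : I) : d.weight s i ≠ ∞ := ENNReal.ofReal_ne_top

lemma weight_ne_zero (s : ℝ) (i : I) : d.weight s i ≠ 0 :=
  (ENNReal.ofReal_pos.2 (Real.rpow_pos_of_pos (d.bracketSq_pos i) _)).ne'

lemma weight_mul_weight_neg (s : ℝ) (i : I) : d.weight s i * d.weight (-s) i = 1 := by
  have hpos := d.bracketSq_pos i
  rw [weight, weight, ← ENNReal.ofReal_mul (by positivity), ← Real.rpow_add hpos]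
  simp [neg_div]

lemma exists_weight_le (hα : α ≤ 1) (s : ℝ) : ∃ C : ℝ≥0∞, C ≠ ∞ ∧
    ∀ i, ∀ j ∈ d.nbhd d' i, d.weight s i ≤ C * d'.weight s j := by
  obtain ⟨B, hB, h⟩ := d.exists_bracketSq_rpow_le d' hα (s / 2)
  refine ⟨ENNReal.ofReal B, ENNReal.ofReal_ne_top, fun i j hij => ?_⟩
  rw [weight, weight, ← ENNReal.ofReal_mul hB.le]
  exact ENNReal.ofReal_le_ofReal (h i j hij)

end AlphaModData

/-! ### Estimates in `ℓ^q` -/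

section Lq

variable {I K : Type*} {q q' : ℝ≥0∞}

lemma lqENorm_of_ne_top (hq : q ≠ ∞) (a : I → ℝ≥0∞) :
    lqENorm q a = (∑' i, a i ^ q.toReal) ^ (1 / q.toReal) := if_neg hq

lemma lqENorm_top (a : I → ℝ≥0∞) : lqENorm ∞ a = ⨆ i, a i := if_pos rfl

lemma lqENorm_le_iff (hq0 : q ≠ 0) (hq : q ≠ ∞) {a : I → ℝ≥0∞} {M : ℝ≥0∞} :
    lqENorm q a ≤ M ↔ ∑' i, a i ^ q.toReal ≤ M ^ q.toReal := by
  rw [lqENorm_of_ne_top hq, one_div, ENNReal.rpow_inv_le_iff (ENNReal.toReal_pos hq0 hq)]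

lemma lqENorm_rpow (hq0 : q ≠ 0) (hq : q ≠ ∞) (a : I → ℝ≥0∞) :
    lqENorm q a ^ q.toReal = ∑' i, a i ^ q.toReal := by
  rw [lqENorm_of_ne_top hq, one_div, ENNReal.rpow_inv_rpow (ENNReal.toReal_pos hq0 hq).ne']

lemma lqENorm_eq_sum_of_support_subset (hq0 : q ≠ 0) (hq : q ≠ ∞) {F : Finset I}
    {a : I → ℝ≥0∞} (ha : ∀ i ∉ F, a i = 0) :
    lqENorm q a = (∑ i ∈ F, a i ^ q.toReal) ^ (1 / q.toReal) := by
  rw [lqENorm_of_ne_top hq, tsum_eq_sum fun i hi => by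
    rw [ha i hi, ENNReal.zero_rpow_of_pos (ENNReal.toReal_pos hq0 hq)]]

lemma le_lqENorm (hq0 : q ≠ 0) (a : I → ℝ≥0∞) (i : I) : a i ≤ lqENorm q a := by
  rcases eq_or_ne q ∞ with rfl | hq
  · rw [lqENorm_top]
    exact le_iSup a i
  · rw [lqENorm_of_ne_top hq, one_div, ENNReal.le_rpow_inv_iff (ENNReal.toReal_pos hq0 hq)]
    exact ENNReal.le_tsum i

lemma lqENorm_ne_top_of_support_subset (hq0 : q ≠ 0) {F : Finset I} {a : I → ℝ≥0∞}
    (h0 : ∀ i ∉ F, a i = 0) (ha : ∀ i, a i ≠ ∞) : lqENorm q a ≠ ∞ := by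
  rcases eq_or_ne q ∞ with rfl | hq
  · have hle : ⨆ i, a i ≤ ∑ i ∈ F, a i := by
      refine iSup_le fun i => ?_
      by_cases hi : i ∈ F
      · exact Finset.single_le_sum (fun _ _ => zero_le) hi
      · simp only [h0 i hi, zero_le]
    rw [lqENorm_top]
    exact (hle.trans_lt (ENNReal.sum_lt_top.2 fun i _ => (ha i).lt_top)).ne
  · rw [lqENorm_eq_sum_of_support_subset hq0 hq h0]
    exact ENNReal.rpow_ne_top_of_nonneg (by positivity) (ENNReal.sum_lt_top.2 fun i _ =>
      ENNReal.rpow_lt_top_of_nonneg ENNReal.toReal_nonneg (ha i)).ne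

lemma tsum_sum_le_mul_tsum {R : I → Finset K} {R' : K → Finset I}
    (hR : ∀ i k, k ∈ R i ↔ i ∈ R' k) {N : ℝ≥0∞} (hN : ∀ k, ((R' k).card : ℝ≥0∞) ≤ N)
    (a : K → ℝ≥0∞) : ∑' i, ∑ k ∈ R i, a k ≤ N * ∑' k, a k := by
  classical
  calc ∑' i, ∑ k ∈ R i, a k
      = ∑' i, ∑' k, if k ∈ R i then a k else 0 := tsum_congr fun i => by
        rw [tsum_eq_sum fun k hk => if_neg hk, ← Finset.sum_filter, Finset.filter_mem_eq_inter,
          Finset.inter_self]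
    _ = ∑' k, ∑' i, if i ∈ R' k then a k else 0 := by
        rw [ENNReal.tsum_comm]
        simp only [hR]
    _ = ∑' k, (R' k).card * a k := tsum_congr fun k => by
        rw [tsum_eq_sum fun i hi => if_neg hi, ← Finset.sum_filter, Finset.filter_mem_eq_inter,
          Finset.inter_self, Finset.sum_const, nsmul_eq_mul]
    _ ≤ ∑' k, N * a k := ENNReal.tsum_le_tsum fun k => by gcongr; exact hN k
    _ = N * ∑' k, a k := ENNReal.tsum_mul_left

lemma lqENorm_sum_le_mul_lqENorm (h1 : 1 ≤ q) {R : I → Finset K}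
    {R' : K → Finset I} (hR : ∀ i k, k ∈ R i ↔ i ∈ R' k) {N : ℝ≥0∞}
    (hN : ∀ i, ((R i).card : ℝ≥0∞) ≤ N) (hN' : ∀ k, ((R' k).card : ℝ≥0∞) ≤ N) (a : K → ℝ≥0∞) :
    lqENorm q (fun i => ∑ k ∈ R i, a k) ≤ N * lqENorm q a := by
  have hq0 : q ≠ 0 := (zero_lt_one.trans_le h1).ne'
  rcases eq_or_ne q ∞ with rfl | hq
  · rw [lqENorm_top]
    refine iSup_le fun i => ?_
    calc ∑ k ∈ R i, a k ≤ ∑ _k ∈ R i, lqENorm ∞ a :=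
          Finset.sum_le_sum fun k _ => le_lqENorm hq0 a k
      _ ≤ N * lqENorm ∞ a := by
          rw [Finset.sum_const, nsmul_eq_mul]
          gcongr
          exact hN i
  have hr : 1 ≤ q.toReal := by simpa only [ENNReal.toReal_one] using ENNReal.toReal_mono hq h1
  rw [lqENorm_le_iff hq0 hq, ENNReal.mul_rpow_of_nonneg _ _ ENNReal.toReal_nonneg,
    lqENorm_rpow hq0 hq]
  calc ∑' i, (∑ k ∈ R i, a k) ^ q.toReal
      ≤ ∑' i, N ^ (q.toReal - 1) * ∑ k ∈ R i, a k ^ q.toReal :=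
        ENNReal.tsum_le_tsum fun i =>
          (ENNReal.rpow_sum_le_const_mul_sum_rpow _ _ hr).trans (by gcongr; exact hN i)
    _ ≤ N ^ (q.toReal - 1) * (N * ∑' k, a k ^ q.toReal) := by
        rw [ENNReal.tsum_mul_left]
        gcongr
        exact tsum_sum_le_mul_tsum hR hN' _
    _ = N ^ q.toReal * ∑' k, a k ^ q.toReal := by
        rw [← mul_assoc]
        nth_rewrite 2 [← ENNReal.rpow_one N]
        rw [← ENNReal.rpow_add_of_nonneg _ _ (by linarith) zero_le_one, sub_add_cancel]

lemma sum_mul_le_lqENorm_mul_lqENorm [hqq : q.HolderConjugate q'] (hq : q ≠ ∞) (F : Finset I)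
    (a b : I → ℝ≥0∞) : ∑ i ∈ F, a i * b i ≤ lqENorm q a * lqENorm q' b := by
  rcases eq_or_ne q' ∞ with rfl | hq'
  · obtain rfl : q = 1 := by simpa using hqq.inv_add_inv_eq_inv
    have hone : lqENorm 1 a = ∑' i, a i := by simp [lqENorm_of_ne_top]
    calc ∑ i ∈ F, a i * b i ≤ ∑ i ∈ F, a i * ⨆ i, b i := by
          gcongr with i
          exact le_iSup b i
      _ ≤ lqENorm 1 a * lqENorm ∞ b := by
          rw [← Finset.sum_mul, hone, lqENorm_top]
          gcongr
          exact ENNReal.sum_le_tsum F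
  · rw [lqENorm_of_ne_top hq, lqENorm_of_ne_top hq']
    refine (ENNReal.inner_le_Lp_mul_Lq F a b (hqq.toReal_of_ne_top hq hq')).trans ?_
    gcongr <;> exact ENNReal.sum_le_tsum F

lemma exists_sum_rpow_le_one_and_sum_mul_eq {r r' : ℝ} (h : r.HolderConjugate r')
    (F : Finset I) (b : I → NNReal) :
    ∃ c : I → NNReal, ∑ i ∈ F, (c i : ℝ≥0∞) ^ r ≤ 1 ∧
      ∑ i ∈ F, (c i : ℝ≥0∞) * b i = (∑ i ∈ F, (b i : ℝ≥0∞) ^ r') ^ (1 / r') := by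
  obtain ⟨⟨c, hc, hcb⟩, -⟩ := NNReal.isGreatest_Lp F b h.symm
  refine ⟨c, ?_, ?_⟩
  · simp_rw [← ENNReal.coe_rpow_of_nonneg _ h.nonneg]
    exact_mod_cast hc
  · simp_rw [← ENNReal.coe_rpow_of_nonneg _ h.symm.nonneg]
    rw [← ENNReal.ofNNReal_finsetSum, ← ENNReal.coe_rpow_of_nonneg _ h.symm.one_div_nonneg, ← hcb]
    push_cast
    exact Finset.sum_congr rfl fun i _ => mul_comm _ _

lemma lqENorm_le_of_forall_sum_mul_le [hqq : q.HolderConjugate q'] (hq : q ≠ ∞)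
    {b : I → NNReal} {M : ℝ≥0∞}
    (h : ∀ (F : Finset I) (c : I → NNReal), ∑ i ∈ F, (c i : ℝ≥0∞) * b i ≤
      M * lqENorm q ((F : Set I).indicator fun i => (c i : ℝ≥0∞))) :
    lqENorm q' (fun i => (b i : ℝ≥0∞)) ≤ M := by
  have hq0 : q ≠ 0 := hqq.ne_zero
  have hnorm (F : Finset I) (c : I → NNReal) :
      lqENorm q ((F : Set I).indicator fun i => (c i : ℝ≥0∞)) =
        (∑ i ∈ F, (c i : ℝ≥0∞) ^ q.toReal) ^ (1 / q.toReal) := by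
    rw [lqENorm_eq_sum_of_support_subset hq0 hq fun i hi =>
      Set.indicator_of_notMem (Finset.mem_coe.not.2 hi) _]
    congr 1
    exact Finset.sum_congr rfl fun i hi => by
      rw [Set.indicator_of_mem (Finset.mem_coe.2 hi)]
  rcases eq_or_ne q' ∞ with rfl | hq'
  · rw [lqENorm_top]
    refine iSup_le fun i => ?_
    have hi := h {i} fun _ => 1
    rw [hnorm] at hi
    simpa using hi
  · have hrr := hqq.toReal_of_ne_top hq hq'
    rw [lqENorm_le_iff hqq.symm.ne_zero hq', ENNReal.tsum_eq_iSup_sum]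
    refine iSup_le fun F => ?_
    obtain ⟨c, hc, hcb⟩ := exists_sum_rpow_le_one_and_sum_mul_eq hrr F b
    rw [← ENNReal.rpow_inv_le_iff hrr.symm.pos, ← one_div, ← hcb]
    refine (h F c).trans (mul_le_of_le_one_right' ?_)
    rw [hnorm]
    exact ENNReal.rpow_le_one hc hrr.one_div_nonneg

lemma exists_finset_tsum_compl_le {e : I → ℝ≥0∞} (he : ∑' i, e i ≠ ∞) {η : ℝ≥0∞} (hη : η ≠ 0) :
    ∃ F : Finset I, ∑' i : {i // i ∉ F}, e i ≤ η :=
  ((ENNReal.tendsto_tsum_compl_atTop_zero he).eventually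
    (ge_mem_nhds (pos_iff_ne_zero.2 hη))).exists

lemma exists_natCast_mul_rpow_le {r : ℝ} (hr : 0 < r) (N : ℕ) {η : ℝ≥0∞} (hη : η ≠ 0) :
    ∃ δ : ℝ≥0∞, δ ≠ 0 ∧ N * δ ^ r ≤ η := by
  refine ⟨(η / (N + 1 : ℕ)) ^ r⁻¹, ?_, ?_⟩
  · rw [Ne, ENNReal.rpow_eq_zero_iff_of_pos (by positivity), ENNReal.div_eq_zero_iff, not_or]
    exact ⟨hη, ENNReal.natCast_ne_top _⟩
  · rw [ENNReal.rpow_inv_rpow hr.ne']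
    calc (N : ℝ≥0∞) * (η / (N + 1 : ℕ)) ≤ (N + 1 : ℕ) * (η / (N + 1 : ℕ)) := by
          gcongr
          exact Nat.le_succ _
      _ ≤ η := ENNReal.mul_div_le

lemma tsum_le_of_le_on_finset {F : Finset I} {b e : I → ℝ≥0∞} {δ η : ℝ≥0∞}
    (hb : ∀ i ∈ F, b i ≤ δ) (hb' : ∀ i ∉ F, b i ≤ e i)
    (hF : ∑' i : {i // i ∉ F}, e i ≤ η) : ∑' i, b i ≤ F.card * δ + η := by
  rw [← ENNReal.sum_add_tsum_compl F, ← nsmul_eq_mul]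
  exact add_le_add (Finset.sum_le_card_nsmul F b δ hb)
    ((ENNReal.tsum_le_tsum fun i : {i // i ∉ F} => hb' i i.2).trans hF)

lemma exists_finset_forall_lqENorm_le (hq0 : q ≠ 0) (hq : q ≠ ∞) {e : I → ℝ≥0∞}
    (he : lqENorm q e ≠ ∞) {ε : ℝ≥0∞} (hε : ε ≠ 0) :
    ∃ (F : Finset I) (δ : ℝ≥0∞), δ ≠ 0 ∧ ∀ b : I → ℝ≥0∞, (∀ i ∈ F, b i ≤ δ) →
      (∀ i ∉ F, b i ≤ e i) → lqENorm q b ≤ ε := by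
  have hr : 0 < q.toReal := ENNReal.toReal_pos hq0 hq
  have hsum : ∑' i, e i ^ q.toReal ≠ ∞ := by
    rw [← lqENorm_rpow hq0 hq]
    exact ENNReal.rpow_ne_top_of_nonneg hr.le he
  have hη : ε ^ q.toReal / 2 ≠ 0 :=
    ENNReal.div_ne_zero.2 ⟨((ENNReal.rpow_eq_zero_iff_of_pos hr).not).2 hε, ENNReal.ofNat_ne_top⟩
  obtain ⟨F, hF⟩ := exists_finset_tsum_compl_le hsum hη
  obtain ⟨δ, hδ0, hδ⟩ := exists_natCast_mul_rpow_le hr F.card hη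
  refine ⟨F, δ, hδ0, fun b hb hb' => (lqENorm_le_iff hq0 hq).2 ?_⟩
  calc ∑' i, b i ^ q.toReal ≤ F.card * δ ^ q.toReal + ε ^ q.toReal / 2 :=
        tsum_le_of_le_on_finset (fun i hi => ENNReal.rpow_le_rpow (hb i hi) hr.le)
          (fun i hi => ENNReal.rpow_le_rpow (hb' i hi) hr.le) hF
    _ ≤ ε ^ q.toReal / 2 + ε ^ q.toReal / 2 := by gcongr
    _ = ε ^ q.toReal := ENNReal.add_halves _

end Lq

namespace AlphaModData

variable {n : ℕ} {𝔤 : Type*} [LieRing 𝔤] [LieAlgebra ℝ 𝔤]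
  {G : AdmissibleLieGroup n 𝔤} {α : ℝ} {I κ : Type*}

lemma exists_lqENorm_weight_mul_sum_nbhd_le (d : AlphaModData G α I) (d' : AlphaModData G α κ)
    (hα : α ≤ 1) (s : ℝ) {q : ℝ≥0∞} (h1 : 1 ≤ q) :
    ∃ C : ℝ≥0∞, C ≠ ∞ ∧ ∀ e : κ → ℝ≥0∞,
      lqENorm q (fun i => d.weight s i * ∑ j ∈ d.nbhd d' i, e j) ≤
        C * lqENorm q fun j => d'.weight s j * e j := by
  obtain ⟨C, hC, hw⟩ := d.exists_weight_le d' hα s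
  obtain ⟨N, hN⟩ := d.exists_card_nbhd_le d' hα
  obtain ⟨N', hN'⟩ := d'.exists_card_nbhd_le d hα
  refine ⟨C * (N + N' : ℕ), by finiteness, fun e => ?_⟩
  calc lqENorm q (fun i => d.weight s i * ∑ j ∈ d.nbhd d' i, e j)
      ≤ lqENorm q (fun i => C * ∑ j ∈ d.nbhd d' i, d'.weight s j * e j) := by
        refine lqENorm_mono q fun i => ?_
        rw [Finset.mul_sum, Finset.mul_sum]
        refine Finset.sum_le_sum fun j hj => ?_
        rw [← mul_assoc]
        gcongr
        exact hw i j hj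
    _ = C * lqENorm q (fun i => ∑ j ∈ d.nbhd d' i, d'.weight s j * e j) :=
        lqENorm_const_mul h1 _ _
    _ ≤ C * (N + N' : ℕ) * lqENorm q fun j => d'.weight s j * e j := by
        rw [mul_assoc]
        gcongr
        exact lqENorm_sum_le_mul_lqENorm h1 (R' := d'.nbhd d) (fun i j => mem_nbhd_comm)
          (fun i => by exact_mod_cast (hN i).trans (Nat.le_add_right _ _))
          (fun j => by exact_mod_cast (hN' j).trans (Nat.le_add_left _ _)) _

end AlphaModData

/-! ### Test functions and Schwartz functions as functionals -/

section TestAlgebra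

variable {n : ℕ} {p p' : ℝ≥0∞}

/-- The functional `g ↦ ∫ a g` that a Schwartz function `a` defines, as a bilinear form. -/
def schwartzFunctional : 𝓢(E n, ℂ) →ₗ[ℂ] 𝓢(E n, ℂ) →ₗ[ℂ] ℂ :=
  have hi (a g : 𝓢(E n, ℂ)) : Integrable (fun x => a x * g x) volume :=
    integrable_mul_schwartz (p := 2) (q := 2) (a.memLp _ _) g
  LinearMap.mk₂ ℂ (fun a g => ∫ x, a x * g x)
    (fun a b g => by
      rw [← integral_add (hi a g) (hi b g)]
      exact integral_congr_ae (.of_forall fun x => add_mul _ _ _))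
    (fun c a g => by
      rw [smul_eq_mul, ← integral_const_mul]
      exact integral_congr_ae (.of_forall fun x => mul_assoc _ _ _))
    (fun a g h => by
      rw [← integral_add (hi a g) (hi a h)]
      exact integral_congr_ae (.of_forall fun x => mul_add _ _ _))
    (fun c a g => by
      rw [smul_eq_mul, ← integral_const_mul]
      exact integral_congr_ae (.of_forall fun x => mul_left_comm _ _ _))

lemma schwartzFunctional_apply (a g : 𝓢(E n, ℂ)) :
    schwartzFunctional a g = ∫ x, a x * g x := rfl

lemma schwartzFunctional_fourier (a g : 𝓢(E n, ℂ)) :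
    schwartzFunctional (𝓕 a) g = schwartzFunctional a (𝓕 g) :=
  SchwartzMap.integral_fourier_mul_eq a g

lemma schwartzFunctional_fourierInv (a g : 𝓢(E n, ℂ)) :
    schwartzFunctional (𝓕⁻ a) g = schwartzFunctional a (𝓕⁻ g) := by
  have h := schwartzFunctional_fourier (𝓕⁻ a) (𝓕⁻ g)
  rw [FourierTransform.fourier_fourierInv_eq, FourierTransform.fourier_fourierInv_eq] at h
  exact h.symm

lemma distLpENorm_schwartzFunctional (hp : 1 ≤ p) (a : 𝓢(E n, ℂ)) :
    distLpENorm p (schwartzFunctional a) = eLpNorm a p volume :=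
  distLpENorm_eq_eLpNorm hp (a.memLp p volume) fun _ => rfl

lemma enorm_apply_le_distLpENorm_mul [hp1 : Fact (1 ≤ p)] [p.HolderConjugate p']
    (u : 𝓢(E n, ℂ) →ₗ[ℂ] ℂ) (g : 𝓢(E n, ℂ)) :
    ‖u g‖ₑ ≤ distLpENorm p' u * eLpNorm g p volume := by
  rcases eq_or_ne (eLpNorm g p volume) 0 with h0 | h0
  · have hg : g = 0 := by
      rw [eLpNorm_eq_zero_iff g.continuous.aestronglyMeasurable
        (zero_lt_one.trans_le hp1.out).ne'] at h0
      exact DFunLike.coe_injective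
        ((Continuous.ae_eq_iff_eq volume g.continuous continuous_const).1 h0)
    simp [hg]
  by_cases hu : distLpENorm p' u = ∞
  · rw [hu, ENNReal.top_mul h0]
    exact le_top
  obtain ⟨h, -, hh, hhu⟩ :=
    exists_memLp_eq_integral_of_distLpENorm_lt_top (lt_top_iff_ne_top.2 hu)
  have : p'.HolderConjugate p := inferInstance
  calc ‖u g‖ₑ ≤ ∫⁻ x, ‖h x * g x‖ₑ := hhu g ▸ enorm_integral_le_lintegral_enorm _
    _ ≤ eLpNorm h p' volume * eLpNorm g p volume := by
        rw [← eLpNorm_one_eq_lintegral_enorm]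
        exact eLpNorm_smul_le_mul_eLpNorm (φ := h) (f := g) (p := p') (q := p)
          g.continuous.aestronglyMeasurable hh.1
    _ = distLpENorm p' u * eLpNorm g p volume := by
        rw [distLpENorm_eq_eLpNorm (ENNReal.HolderConjugate.one_le p' p) hh hhu]

lemma distLpENorm_sum_le [Fact (1 ≤ p)] {I : Type*} (F : Finset I)
    (u : I → 𝓢(E n, ℂ) →ₗ[ℂ] ℂ) :
    distLpENorm p (∑ i ∈ F, u i) ≤ ∑ i ∈ F, distLpENorm p (u i) :=
  Finset.le_sum_of_subadditive _ (distLpENorm_zero p).le distLpENorm_add_le F u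

lemma exists_distLpENorm_sub_schwartzFunctional_le [hp1 : Fact (1 ≤ p)] (hp : p ≠ ∞)
    {u : 𝓢(E n, ℂ) →ₗ[ℂ] ℂ} (hu : distLpENorm p u ≠ ∞) {ε : ℝ≥0∞} (hε : ε ≠ 0) :
    ∃ a : 𝓢(E n, ℂ), distLpENorm p (u - schwartzFunctional a) ≤ ε := by
  obtain ⟨h, -, hh, hhu⟩ :=
    exists_memLp_eq_integral_of_distLpENorm_lt_top (lt_top_iff_ne_top.2 hu)
  obtain ⟨r, hr0, hr⟩ := ENNReal.lt_iff_exists_nnreal_btwn.1 (pos_iff_ne_zero.2 hε)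
  obtain ⟨g₀, hsupp, hsmooth, hg₀⟩ := hh.exist_eLpNorm_sub_le hp hp1.out (ε := (r : ℝ))
    (NNReal.coe_pos.2 (ENNReal.coe_pos.1 hr0))
  rw [ENNReal.ofReal_coe_nnreal] at hg₀
  set a : 𝓢(E n, ℂ) := hsupp.toSchwartzMap hsmooth
  have hpp : p.HolderConjugate p.conjExponent := ENNReal.HolderConjugate.conjExponent hp1.out
  have hrepr (g : 𝓢(E n, ℂ)) : (u - schwartzFunctional a) g = ∫ x, (h - ⇑a) x * g x := by
    rw [LinearMap.sub_apply, hhu, schwartzFunctional_apply, ← integral_sub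
      (integrable_mul_schwartz (q := p.conjExponent) hh g)
      (integrable_mul_schwartz (q := p.conjExponent) (a.memLp p volume) g)]
    exact integral_congr_ae (.of_forall fun x => (sub_mul _ _ _).symm)
  refine ⟨a, ?_⟩
  rw [distLpENorm_eq_eLpNorm hp1.out (hh.sub (a.memLp p volume)) hrepr]
  exact hg₀.trans hr.le

variable (ψ χ : 𝓓((⊤ : TopologicalSpace.Opens (E n)), ℝ))

lemma testToSchwartz_apply (φ : Test n) (x : E n) : testToSchwartz n φ x = φ x := rfl

lemma mulTest_apply (g : 𝓢(E n, ℂ)) (x : E n) : mulTest ψ g x = (ψ x : ℂ) * g x := rfl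

lemma conjTest_apply (φ : Test n) (x : E n) : conjTest φ x = conj (φ x) := rfl

lemma mulTest_mulTest_comm (g : 𝓢(E n, ℂ)) :
    mulTest ψ (testToSchwartz n (mulTest χ g)) = mulTest χ (testToSchwartz n (mulTest ψ g)) := by
  ext x
  exact mul_left_comm _ _ _

lemma schwartzFunctional_mulTest (a g : 𝓢(E n, ℂ)) :
    schwartzFunctional (testToSchwartz n (mulTest ψ a)) g =
      schwartzFunctional a (testToSchwartz n (mulTest ψ g)) := by
  refine integral_congr_ae (.of_forall fun x => ?_)
  simp only [testToSchwartz_apply, mulTest_apply]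
  ring

lemma fourierInv_freqMult (g : 𝓢(E n, ℂ)) :
    𝓕⁻ (freqMult ψ g) = testToSchwartz n (mulTest ψ (𝓕⁻ g)) :=
  FourierTransform.fourierInv_fourier_eq _

lemma freqBlock_apply (f : ZDual n) (g : 𝓢(E n, ℂ)) :
    freqBlock ψ f g = f.fourier (mulTest ψ (𝓕⁻ g)) := rfl

/-- `freqBlock ψ` as a linear map. -/
def freqBlockₗ : ZDual n →ₗ[ℂ] (𝓢(E n, ℂ) →ₗ[ℂ] ℂ) where
  toFun := freqBlock ψ
  map_add' := freqBlock_add ψ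
  map_smul' := freqBlock_smul ψ

/-- `zOfTest` as a linear map. -/
def zOfTestₗ (n : ℕ) : Test n →ₗ[ℂ] ZDual n where
  toFun := zOfTest
  map_add' φ χ := by
    ext z
    change schwartzFunctional (𝓕⁻ (testToSchwartz n (φ + χ))) z.1 = _
    rw [map_add, FourierTransform.fourierInv_add, map_add]
    rfl
  map_smul' c φ := by
    ext z
    change schwartzFunctional (𝓕⁻ (testToSchwartz n (c • φ))) z.1 = _
    rw [map_smul, FourierTransform.fourierInv_smul, map_smul]
    rfl

lemma zOfTest_fourier (φ θ : Test n) :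
    (zOfTest φ).fourier θ = schwartzFunctional (testToSchwartz n φ) (testToSchwartz n θ) := by
  change schwartzFunctional (𝓕⁻ (testToSchwartz n φ)) (𝓕 (testToSchwartz n θ)) = _
  rw [schwartzFunctional_fourierInv, FourierTransform.fourierInv_fourier_eq]

lemma freqBlock_zOfTest (φ : Test n) :
    freqBlock ψ (zOfTest φ) =
      schwartzFunctional (𝓕⁻ (testToSchwartz n (mulTest ψ (testToSchwartz n φ)))) := by
  ext g
  rw [freqBlock_apply, zOfTest_fourier, ← schwartzFunctional_mulTest,
    schwartzFunctional_fourierInv]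

lemma freqBlock_zOfTest_mulTest (a : 𝓢(E n, ℂ)) :
    freqBlock ψ (zOfTest (mulTest χ (𝓕 a))) =
      schwartzFunctional a ∘ₗ freqMult χ ∘ₗ freqMult ψ := by
  ext g
  rw [freqBlock_apply, zOfTest_fourier, schwartzFunctional_mulTest, schwartzFunctional_fourier,
    ← fourierInv_freqMult]
  rfl

/-- `conjTest` as a conjugate-linear map. -/
def conjTestₗ (n : ℕ) : Test n →ₗ⋆[ℂ] Test n where
  toFun := conjTest
  map_add' φ θ := by
    ext x
    exact map_add (starRingEnd ℂ) _ _
  map_smul' c φ := by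
    ext x
    exact map_mul (starRingEnd ℂ) _ _

lemma conjTest_conjTest (φ : Test n) : conjTest (conjTest φ) = φ := by
  ext x
  exact Complex.conj_conj _

lemma mulTest_conjTest (φ : Test n) :
    mulTest ψ (testToSchwartz n (conjTest φ)) =
      conjTest (mulTest ψ (testToSchwartz n φ)) := by
  ext x
  simp only [mulTest_apply, testToSchwartz_apply, conjTest_apply, map_mul, Complex.conj_ofReal]

/-- The complex conjugate of a Schwartz function. -/
def conjSchwartz (g : 𝓢(E n, ℂ)) : 𝓢(E n, ℂ) :=
  SchwartzMap.postcompCLM (𝕜 := ℝ) (Complex.conjCLE : ℂ →L[ℝ] ℂ) g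

lemma conjSchwartz_apply (g : 𝓢(E n, ℂ)) (x : E n) : conjSchwartz g x = conj (g x) := rfl

lemma conjSchwartz_zero : conjSchwartz (0 : 𝓢(E n, ℂ)) = 0 :=
  map_zero (SchwartzMap.postcompCLM (𝕜 := ℝ) (Complex.conjCLE : ℂ →L[ℝ] ℂ))

lemma eLpNorm_conjSchwartz (g : 𝓢(E n, ℂ)) :
    eLpNorm (conjSchwartz g) p volume = eLpNorm g p volume :=
  eLpNorm_congr_norm_ae (.of_forall fun x => by rw [conjSchwartz_apply, RCLike.norm_conj])

lemma fourier_conjSchwartz (g : 𝓢(E n, ℂ)) : 𝓕 (conjSchwartz g) = conjSchwartz (𝓕⁻ g) := by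
  ext x
  rw [conjSchwartz_apply, SchwartzMap.fourier_coe, SchwartzMap.fourierInv_coe, Real.fourier_eq,
    Real.fourierInv_eq, ← integral_conj]
  refine integral_congr_ae (.of_forall fun v => ?_)
  simp only [conjSchwartz_apply, Circle.smul_def, smul_eq_mul, map_mul,
    Circle.starRingEnd_addChar]

lemma eLpNorm_fourier_conjTest (φ : Test n) :
    eLpNorm (𝓕 (testToSchwartz n (conjTest φ)) : 𝓢(E n, ℂ)) p volume =
      eLpNorm (𝓕⁻ (testToSchwartz n φ) : 𝓢(E n, ℂ)) p volume := by
  change eLpNorm (𝓕 (conjSchwartz (testToSchwartz n φ)) : 𝓢(E n, ℂ)) p volume = _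
  rw [fourier_conjSchwartz, eLpNorm_conjSchwartz]

lemma conjTest_mulTest_fourier_conjSchwartz (g : 𝓢(E n, ℂ)) :
    conjTest (mulTest ψ (𝓕 (conjSchwartz g))) = mulTest ψ (𝓕⁻ g) := by
  ext x
  simp only [conjTest_apply, mulTest_apply, fourier_conjSchwartz, conjSchwartz_apply, map_mul,
    Complex.conj_ofReal, Complex.conj_conj]

end TestAlgebra

/-! ### Frequency blocks -/

namespace AlphaModData

variable {n : ℕ} {𝔤 : Type*} [LieRing 𝔤] [LieAlgebra ℝ 𝔤] {G : AdmissibleLieGroup n 𝔤} {α : ℝ}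
  {I κ : Type*} {p p' q q' : ℝ≥0∞} (d : AlphaModData G α I) (d' : AlphaModData G α κ)

lemma alphaModENorm_eq (s : ℝ) (p q : ℝ≥0∞) (f : ZDual n) :
    alphaModENorm d s p q f =
      lqENorm q fun i => d.weight s i * distLpENorm p (freqBlock (d.ψ i) f) := rfl

lemma mem_P_of_ψ_ne_zero {i : I} {x : E n} (h : d.ψ i x ≠ 0) : x ∈ d.P i :=
  d.isBAPU.tsupport_subset i (subset_tsupport _ h)

lemma sum_ψ_eq_one {J : Finset I} {x : E n} (h : ∀ i, x ∈ d.P i → i ∈ J) :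
    ∑ i ∈ J, d.ψ i x = 1 := by
  refine (hasSum_sum_of_ne_finset_zero fun i hi => ?_).unique (d.isBAPU.hasSum_one x)
  by_contra hne
  exact hi (h i (d.mem_P_of_ψ_ne_zero hne))

lemma sum_mulTest_eq {J : Finset I} {φ : Test n}
    (h : ∀ x, φ x ≠ 0 → ∀ i, x ∈ d.P i → i ∈ J) :
    ∑ i ∈ J, mulTest (d.ψ i) (testToSchwartz n φ) = φ := by
  ext x
  have hev : (∑ i ∈ J, mulTest (d.ψ i) (testToSchwartz n φ)) x =
      ∑ i ∈ J, (d.ψ i x : ℂ) * φ x := by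
    rw [FunLike.coe_sum, Finset.sum_apply]
    rfl
  rw [hev, ← Finset.sum_mul]
  rcases eq_or_ne (φ x) 0 with hφ | hφ
  · rw [hφ, mul_zero]
  · rw [← Complex.ofReal_sum, d.sum_ψ_eq_one (h x hφ), Complex.ofReal_one, one_mul]

lemma exists_finset_sum_mulTest_eq {K : Set (E n)} (hK : IsCompact K) :
    ∃ J : Finset I, ∀ φ : Test n, (∀ x, φ x ≠ 0 → x ∈ K) →
      ∑ i ∈ J, mulTest (d.ψ i) (testToSchwartz n φ) = φ := by
  have hfin := d.finite_setOf_inter_nonempty hK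
  exact ⟨hfin.toFinset, fun φ hφ => d.sum_mulTest_eq fun x hx i hi =>
    hfin.mem_toFinset.2 ⟨x, hφ x hx, hi⟩⟩

lemma exists_finset_sum_mulTest_eq_self (φ : Test n) :
    ∃ J : Finset I, ∑ i ∈ J, mulTest (d.ψ i) (testToSchwartz n φ) = φ := by
  obtain ⟨J, hJ⟩ := d.exists_finset_sum_mulTest_eq φ.hasCompactSupport
  exact ⟨J, hJ φ fun x hx => subset_tsupport _ hx⟩

lemma sum_nbhd_mulTest_mulTest (i : I) (g : 𝓢(E n, ℂ)) :
    ∑ j ∈ d.nbhd d' i, mulTest (d'.ψ j) (testToSchwartz n (mulTest (d.ψ i) g)) =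
      mulTest (d.ψ i) g := by
  refine d'.sum_mulTest_eq fun x hx j hj => mem_nbhd.2 ⟨x, d.mem_P_of_ψ_ne_zero fun h0 => hx ?_, hj⟩
  rw [mulTest_apply, h0, Complex.ofReal_zero, zero_mul]

lemma mulTest_mulTest_eq_zero {i : I} {j : κ} (h : j ∉ d.nbhd d' i) (g : 𝓢(E n, ℂ)) :
    mulTest (d'.ψ j) (testToSchwartz n (mulTest (d.ψ i) g)) = 0 := by
  ext x
  change (d'.ψ j x : ℂ) * ((d.ψ i x : ℂ) * g x) = 0
  by_contra hne
  simp only [mul_eq_zero, Complex.ofReal_eq_zero, not_or] at hne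
  exact h (mem_nbhd.2 ⟨x, d.mem_P_of_ψ_ne_zero hne.2.1, d'.mem_P_of_ψ_ne_zero hne.1⟩)

lemma freqMult_comp_freqMult_eq_zero {i : I} {j : κ} (h : j ∉ d.nbhd d' i) :
    freqMult (d'.ψ j) ∘ₗ freqMult (d.ψ i) = 0 := by
  refine LinearMap.ext fun g => ?_
  change fourierTest n (mulTest (d'.ψ j) (𝓕⁻ (freqMult (d.ψ i) g))) = 0
  rw [fourierInv_freqMult, d.mulTest_mulTest_eq_zero d' h, map_zero]

lemma exists_distLpENorm_comp_freqMult_le [Fact (1 ≤ p)] (hp : p ≠ ∞) :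
    ∃ C : ℝ≥0∞, C ≠ ∞ ∧ ∀ i u, distLpENorm p (u ∘ₗ freqMult (d.ψ i)) ≤ C * distLpENorm p u := by
  obtain ⟨C, hC⟩ := d.isBAPU.bounded
  exact ⟨ENNReal.ofReal C, ENNReal.ofReal_ne_top, fun i u =>
    (distLpENorm_comp_freqMult_le hp (d.ψ i) u).trans (by gcongr; exact hC i)⟩

lemma exists_alphaModENorm_le_of_freqBlock_eq (hα : α ≤ 1) (s : ℝ)
    [Fact (1 ≤ p)] [hq1 : Fact (1 ≤ q)] (hp : p ≠ ∞) :
    ∃ C : ℝ≥0∞, C ≠ ∞ ∧ ∀ (u : κ → 𝓢(E n, ℂ) →ₗ[ℂ] ℂ) (f : ZDual n),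
      (∀ i, freqBlock (d.ψ i) f =
        ∑ j ∈ d.nbhd d' i, u j ∘ₗ freqMult (d'.ψ j) ∘ₗ freqMult (d.ψ i)) →
      alphaModENorm d s p q f ≤ C * lqENorm q fun j => d'.weight s j * distLpENorm p (u j) := by
  obtain ⟨C₁, hC₁, h₁⟩ := d.exists_distLpENorm_comp_freqMult_le hp
  obtain ⟨C₂, hC₂, h₂⟩ := d'.exists_distLpENorm_comp_freqMult_le hp
  obtain ⟨C, hC, h⟩ := d.exists_lqENorm_weight_mul_sum_nbhd_le d' hα s hq1.out
  refine ⟨C₁ * C₂ * C, by finiteness, fun u f hf => ?_⟩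
  have hblock (i : I) : distLpENorm p (freqBlock (d.ψ i) f) ≤
      C₁ * C₂ * ∑ j ∈ d.nbhd d' i, distLpENorm p (u j) := by
    rw [hf i, Finset.mul_sum]
    refine (distLpENorm_sum_le _ _).trans (Finset.sum_le_sum fun j _ => ?_)
    rw [mul_assoc, ← LinearMap.comp_assoc]
    exact (h₁ i _).trans (by gcongr; exact h₂ j _)
  calc alphaModENorm d s p q f
      ≤ lqENorm q fun i => C₁ * C₂ *
          (d.weight s i * ∑ j ∈ d.nbhd d' i, distLpENorm p (u j)) := by
        refine lqENorm_mono q fun i => ?_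
        rw [mul_left_comm]
        exact mul_le_mul_right (hblock i) _
    _ ≤ C₁ * C₂ * C * lqENorm q fun j => d'.weight s j * distLpENorm p (u j) := by
        rw [lqENorm_const_mul hq1.out, mul_assoc _ C]
        gcongr
        exact h _

lemma freqBlock_zOfTest_sum {J : Finset κ} {a : κ → 𝓢(E n, ℂ)} (ha : ∀ j ∉ J, a j = 0) (i : I) :
    freqBlock (d.ψ i) (zOfTest (∑ j ∈ J, mulTest (d'.ψ j) (𝓕 (a j)))) =
      ∑ j ∈ d.nbhd d' i,
        schwartzFunctional (a j) ∘ₗ freqMult (d'.ψ j) ∘ₗ freqMult (d.ψ i) := by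
  classical
  set u := fun j => schwartzFunctional (a j) ∘ₗ freqMult (d'.ψ j) ∘ₗ freqMult (d.ψ i)
  have hJ (j : κ) (hj : j ∉ J) : u j = 0 := by
    simp only [u, ha j hj, map_zero, LinearMap.zero_comp]
  have hnbhd (j : κ) (hj : j ∉ d.nbhd d' i) : u j = 0 := by
    simp only [u, d.freqMult_comp_freqMult_eq_zero d' hj, LinearMap.comp_zero]
  calc freqBlock (d.ψ i) (zOfTest (∑ j ∈ J, mulTest (d'.ψ j) (𝓕 (a j))))
      = ∑ j ∈ J, u j := by
        change (freqBlockₗ (d.ψ i) ∘ₗ zOfTestₗ n) _ = _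
        rw [map_sum]
        exact Finset.sum_congr rfl fun j _ => freqBlock_zOfTest_mulTest _ _ _
    _ = ∑ j ∈ J ∪ d.nbhd d' i, u j :=
        Finset.sum_subset Finset.subset_union_left fun j _ => hJ j
    _ = ∑ j ∈ d.nbhd d' i, u j :=
        (Finset.sum_subset Finset.subset_union_right fun j _ => hnbhd j).symm

lemma exists_alphaModENorm_zOfTest_sum_le (hα : α ≤ 1) (s : ℝ)
    [hp1 : Fact (1 ≤ p)] [Fact (1 ≤ q)] (hp : p ≠ ∞) :
    ∃ C : ℝ≥0∞, C ≠ ∞ ∧ ∀ (J : Finset κ) (a : κ → 𝓢(E n, ℂ)), (∀ j ∉ J, a j = 0) →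
      alphaModENorm d s p q (zOfTest (∑ j ∈ J, mulTest (d'.ψ j) (𝓕 (a j)))) ≤
        C * lqENorm q fun j => d'.weight s j * eLpNorm (a j) p volume := by
  obtain ⟨C, hC, h⟩ := d.exists_alphaModENorm_le_of_freqBlock_eq (p := p) (q := q) d' hα s hp
  refine ⟨C, hC, fun J a ha => (h _ _ (d.freqBlock_zOfTest_sum d' ha)).trans_eq ?_⟩
  simp only [distLpENorm_schwartzFunctional hp1.out]

lemma exists_alphaModENorm_zOfTest_le (hα : α ≤ 1) (s : ℝ)
    [Fact (1 ≤ p)] [hq1 : Fact (1 ≤ q)] (hp : p ≠ ∞) {K : Set (E n)} (hK : IsCompact K) :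
    ∃ C : ℝ≥0∞, C ≠ ∞ ∧ ∀ φ : Test n, (∀ x, φ x ≠ 0 → x ∈ K) →
      alphaModENorm d s p q (zOfTest φ) ≤
        C * eLpNorm (𝓕⁻ (testToSchwartz n φ) : 𝓢(E n, ℂ)) p volume := by
  classical
  obtain ⟨C, hC, h⟩ := d.exists_alphaModENorm_zOfTest_sum_le (p := p) (q := q) d hα s hp
  obtain ⟨J, hJ⟩ := d.exists_finset_sum_mulTest_eq hK
  set w : I → ℝ≥0∞ := fun j => if j ∈ J then d.weight s j else 0
  have hw : lqENorm q w ≠ ∞ :=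
    lqENorm_ne_top_of_support_subset (zero_lt_one.trans_le hq1.out).ne' (fun j hj => if_neg hj)
      fun j => by unfold w; split_ifs <;> simp [d.weight_ne_top]
  refine ⟨C * lqENorm q w, by finiteness, fun φ hφ => ?_⟩
  set g : 𝓢(E n, ℂ) := 𝓕⁻ (testToSchwartz n φ)
  set a : I → 𝓢(E n, ℂ) := fun j => if j ∈ J then g else 0
  have hsum : ∑ j ∈ J, mulTest (d.ψ j) (𝓕 (a j)) = φ := by
    refine (Finset.sum_congr rfl fun j hj => ?_).trans (hJ φ hφ)
    rw [show a j = g from if_pos hj, FourierTransform.fourier_fourierInv_eq]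
  calc alphaModENorm d s p q (zOfTest φ)
      ≤ C * lqENorm q fun j => d.weight s j * eLpNorm (a j) p volume :=
        hsum ▸ h J a fun j hj => if_neg hj
    _ = C * lqENorm q fun j => eLpNorm g p volume * w j := by
        congr 2 with j
        simp only [a, w]
        split_ifs with hj
        · rw [mul_comm]
        · rw [FunLike.coe_zero, eLpNorm_zero, mul_zero, mul_zero]
    _ = C * lqENorm q w * eLpNorm g p volume := by
        rw [lqENorm_const_mul hq1.out, mul_assoc, mul_comm (eLpNorm _ _ _)]

lemma zOfTest_mem (hα : α ≤ 1) (s : ℝ) [Fact (1 ≤ p)] [Fact (1 ≤ q)] (hp : p ≠ ∞) (φ : Test n) :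
    zOfTest φ ∈ alphaModSubmodule d s p q := by
  obtain ⟨C, hC, h⟩ :=
    d.exists_alphaModENorm_zOfTest_le (p := p) (q := q) hα s hp φ.hasCompactSupport
  exact (h φ fun x hx => subset_tsupport _ hx).trans_lt
    (ENNReal.mul_lt_top hC.lt_top (SchwartzMap.memLp _ _ _).2)

section Pairing

variable [hp1 : Fact (1 ≤ p)] [p.HolderConjugate p']

lemma enorm_fourier_mulTest_mulTest_conjTest_le (f : ZDual n) (φ : Test n) (j : κ) (i : I) :
    ‖f.fourier (mulTest (d.ψ i) (testToSchwartz n (mulTest (d'.ψ j)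
      (testToSchwartz n (conjTest φ)))))‖ₑ ≤
      distLpENorm p' (freqBlock (d'.ψ j) f) * distLpENorm p (freqBlock (d.ψ i) (zOfTest φ)) := by
  have h := enorm_apply_le_distLpENorm_mul (p := p) (p' := p') (freqBlock (d'.ψ j) f)
    (𝓕 (testToSchwartz n (conjTest (mulTest (d.ψ i) (testToSchwartz n φ)))))
  rwa [freqBlock_apply, FourierTransform.fourierInv_fourier_eq, eLpNorm_fourier_conjTest,
    ← distLpENorm_schwartzFunctional hp1.out, ← freqBlock_zOfTest, ← mulTest_conjTest,
    mulTest_mulTest_comm] at h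

lemma enorm_fourier_mulTest_conjTest_le (f : ZDual n) (φ : Test n) (j : κ) :
    ‖f.fourier (mulTest (d'.ψ j) (testToSchwartz n (conjTest φ)))‖ₑ ≤
      distLpENorm p' (freqBlock (d'.ψ j) f) *
        ∑ i ∈ d'.nbhd d j, distLpENorm p (freqBlock (d.ψ i) (zOfTest φ)) := by
  rw [← d'.sum_nbhd_mulTest_mulTest d j, map_sum, Finset.mul_sum]
  exact (enorm_sum_le _ _).trans (Finset.sum_le_sum fun i _ =>
    d.enorm_fourier_mulTest_mulTest_conjTest_le d' f φ j i)

lemma exists_enorm_fourier_conjTest_le (hα : α ≤ 1) (s : ℝ) [hq1 : Fact (1 ≤ q)] (hq : q ≠ ∞)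
    [q.HolderConjugate q'] :
    ∃ C : ℝ≥0∞, C ≠ ∞ ∧ ∀ (f : ZDual n) (φ : Test n),
      ‖f.fourier (conjTest φ)‖ₑ ≤
        C * alphaModENorm d' (-s) p' q' f * alphaModENorm d s p q (zOfTest φ) := by
  obtain ⟨C, hC, h⟩ := d'.exists_lqENorm_weight_mul_sum_nbhd_le d hα s hq1.out
  refine ⟨C, hC, fun f φ => ?_⟩
  set A' : κ → ℝ≥0∞ := fun j => distLpENorm p' (freqBlock (d'.ψ j) f)
  set A : I → ℝ≥0∞ := fun i => distLpENorm p (freqBlock (d.ψ i) (zOfTest φ))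
  obtain ⟨J, hJ⟩ := d'.exists_finset_sum_mulTest_eq_self (conjTest φ)
  calc ‖f.fourier (conjTest φ)‖ₑ
      ≤ ∑ j ∈ J, A' j * ∑ i ∈ d'.nbhd d j, A i := by
        conv_lhs => rw [← hJ, map_sum]
        exact (enorm_sum_le _ _).trans (Finset.sum_le_sum fun j _ =>
          d.enorm_fourier_mulTest_conjTest_le d' f φ j)
    _ = ∑ j ∈ J, (d'.weight s j * ∑ i ∈ d'.nbhd d j, A i) * (d'.weight (-s) j * A' j) := by
        refine Finset.sum_congr rfl fun j _ => ?_
        rw [mul_mul_mul_comm, d'.weight_mul_weight_neg, one_mul, mul_comm]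
    _ ≤ lqENorm q (fun j => d'.weight s j * ∑ i ∈ d'.nbhd d j, A i) *
          lqENorm q' fun j => d'.weight (-s) j * A' j :=
        sum_mul_le_lqENorm_mul_lqENorm hq J _ _
    _ ≤ (C * lqENorm q fun i => d.weight s i * A i) *
          lqENorm q' fun j => d'.weight (-s) j * A' j := by
        gcongr
        exact h A
    _ = C * alphaModENorm d' (-s) p' q' f * alphaModENorm d s p q (zOfTest φ) := by
        rw [mul_right_comm, alphaModENorm_eq, alphaModENorm_eq]

end Pairing

end AlphaModData

/-! ### Density of the test functions -/

namespace AlphaModData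

variable {n : ℕ} {𝔤 : Type*} [LieRing 𝔤] [LieAlgebra ℝ 𝔤] {G : AdmissibleLieGroup n 𝔤} {α : ℝ}
  {I : Type*} {p q : ℝ≥0∞} (d : AlphaModData G α I)

/-- The sum of the frequency blocks of `f` over the sets of the covering that meet `P i`; its
restriction to the frequencies in `P i` is that of `f`. -/
def fatBlock (f : ZDual n) (i : I) : 𝓢(E n, ℂ) →ₗ[ℂ] ℂ :=
  ∑ m ∈ d.nbhd d i, freqBlock (d.ψ m) f

lemma fatBlock_freqMult (f : ZDual n) (i : I) (g : 𝓢(E n, ℂ)) :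
    d.fatBlock f i (freqMult (d.ψ i) g) = f.fourier (mulTest (d.ψ i) (𝓕⁻ g)) := by
  rw [fatBlock, LinearMap.sum_apply]
  simp only [freqBlock_apply, fourierInv_freqMult]
  rw [← map_sum, d.sum_nbhd_mulTest_mulTest d]

lemma freqBlock_eq_sum_fatBlock (f : ZDual n) (k : I) :
    freqBlock (d.ψ k) f =
      ∑ i ∈ d.nbhd d k, d.fatBlock f i ∘ₗ freqMult (d.ψ i) ∘ₗ freqMult (d.ψ k) := by
  ext g
  rw [LinearMap.sum_apply]
  simp only [LinearMap.comp_apply, fatBlock_freqMult, fourierInv_freqMult]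
  rw [← map_sum, d.sum_nbhd_mulTest_mulTest d, freqBlock_apply]

lemma lqENorm_weight_mul_fatBlock_ne_top (hα : α ≤ 1) (s : ℝ)
    [Fact (1 ≤ p)] [hq1 : Fact (1 ≤ q)] {f : ZDual n} (hf : alphaModENorm d s p q f ≠ ∞) :
    lqENorm q (fun i => d.weight s i * distLpENorm p (d.fatBlock f i)) ≠ ∞ := by
  obtain ⟨C, hC, h⟩ := d.exists_lqENorm_weight_mul_sum_nbhd_le d hα s hq1.out
  refine ((lqENorm_mono q fun i => ?_).trans_lt
    ((h fun i => distLpENorm p (freqBlock (d.ψ i) f)).trans_lt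
      (ENNReal.mul_lt_top hC.lt_top hf.lt_top))).ne
  gcongr
  exact distLpENorm_sum_le _ _

lemma exists_lqENorm_weight_mul_sub_schwartzFunctional_le (s : ℝ) [Fact (1 ≤ p)]
    [hq1 : Fact (1 ≤ q)] (hp : p ≠ ∞) (hq : q ≠ ∞) {u : I → 𝓢(E n, ℂ) →ₗ[ℂ] ℂ}
    (hu : lqENorm q (fun i => d.weight s i * distLpENorm p (u i)) ≠ ∞)
    {ε : ℝ≥0∞} (hε : ε ≠ 0) :
    ∃ (F : Finset I) (a : I → 𝓢(E n, ℂ)), (∀ i ∉ F, a i = 0) ∧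
      lqENorm q (fun i => d.weight s i * distLpENorm p (u i - schwartzFunctional (a i))) ≤ ε := by
  classical
  have hq0 : q ≠ 0 := (zero_lt_one.trans_le hq1.out).ne'
  have hui (i : I) : distLpENorm p (u i) ≠ ∞ := fun hi => hu <| top_le_iff.1 <| by
    simpa [hi, ENNReal.mul_top (d.weight_ne_zero s i)] using
      le_lqENorm hq0 (fun i => d.weight s i * distLpENorm p (u i)) i
  obtain ⟨F, δ, hδ, hF⟩ := exists_finset_forall_lqENorm_le hq0 hq hu hε
  choose a ha using fun i => exists_distLpENorm_sub_schwartzFunctional_le hp (hui i)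
    (ENNReal.div_ne_zero.2 ⟨hδ, d.weight_ne_top s i⟩)
  refine ⟨F, fun i => if i ∈ F then a i else 0, fun i hi => if_neg hi,
    hF _ (fun i hi => ?_) fun i hi => ?_⟩
  · simp only [if_pos hi]
    calc _ ≤ d.weight s i * (δ / d.weight s i) := by gcongr; exact ha i
      _ ≤ δ := ENNReal.mul_div_le
  · simp only [if_neg hi, map_zero, sub_zero, le_refl]

lemma exists_alphaModENorm_sub_zOfTest_le (hα : α ≤ 1) (s : ℝ)
    [Fact (1 ≤ p)] [Fact (1 ≤ q)] (hp : p ≠ ∞) (hq : q ≠ ∞) {f : ZDual n}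
    (hf : alphaModENorm d s p q f ≠ ∞) {ε : ℝ≥0∞} (hε : ε ≠ 0) :
    ∃ φ : Test n, alphaModENorm d s p q (f - zOfTest φ) ≤ ε := by
  obtain ⟨C, hC, h⟩ := d.exists_alphaModENorm_le_of_freqBlock_eq (p := p) (q := q) d hα s hp
  obtain ⟨F, a, ha, hle⟩ := d.exists_lqENorm_weight_mul_sub_schwartzFunctional_le s hp hq
    (d.lqENorm_weight_mul_fatBlock_ne_top hα s hf) (ENNReal.div_ne_zero.2 ⟨hε, hC⟩)
  -- fat blocks are needed here: localizing the blocks of `f` to `P i` once more gives blocks of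
  -- multiplier `ψ i ^ 2`, which do not add up to `f`
  refine ⟨∑ i ∈ F, mulTest (d.ψ i) (𝓕 (a i)), (h _ _ fun k => ?_).trans
    ((mul_le_mul_right hle C).trans ENNReal.mul_div_le)⟩
  change freqBlockₗ (d.ψ k) _ = _
  rw [map_sub]
  change freqBlock (d.ψ k) _ - freqBlock (d.ψ k) _ = _
  rw [d.freqBlock_zOfTest_sum d ha, d.freqBlock_eq_sum_fatBlock f k, ← Finset.sum_sub_distrib]
  exact Finset.sum_congr rfl fun i _ => (LinearMap.sub_comp _ _ _).symm

variable [Fact (1 ≤ p)] [Fact (1 ≤ q)]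

/-- The map `φ ↦ zOfTest φ` with values in the space `M^{s,α}_{p,q}(G)`. -/
def zTest (hα : α ≤ 1) (s : ℝ) (hp : p ≠ ∞) : Test n →ₗ[ℂ] AlphaModSpace d s p q :=
  (zOfTestₗ n).codRestrict (alphaModSubmodule d s p q) (d.zOfTest_mem hα s hp)

lemma enorm_alphaModSpace (s : ℝ) (f : AlphaModSpace d s p q) :
    ‖f‖ₑ = alphaModENorm d s p q f.1 := by
  rw [← ofReal_norm]
  exact ENNReal.ofReal_toReal (ne_of_lt f.2)

lemma enorm_zTest (hα : α ≤ 1) (s : ℝ) (hp : p ≠ ∞) (φ : Test n) :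
    ‖d.zTest (q := q) hα s hp φ‖ₑ = alphaModENorm d s p q (zOfTest φ) :=
  d.enorm_alphaModSpace s _

lemma denseRange_zTest (hα : α ≤ 1) (s : ℝ) (hp : p ≠ ∞) (hq : q ≠ ∞) :
    DenseRange (d.zTest (p := p) (q := q) hα s hp) := by
  intro f
  rw [EMetric.mem_closure_iff]
  intro ε hε
  obtain ⟨δ, hδ0, hδ⟩ := exists_between hε
  obtain ⟨φ, hφ⟩ := d.exists_alphaModENorm_sub_zOfTest_le hα s hp hq (ne_of_lt f.2) hδ0.ne'
  refine ⟨_, ⟨φ, rfl⟩, lt_of_le_of_lt ?_ hδ⟩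
  rw [edist_eq_enorm_sub, enorm_alphaModSpace]
  exact hφ

end AlphaModData

/-! ### Extension of pairings by density -/

section DensePairing

variable {𝕜 V X Y : Type*} [RCLike 𝕜] [AddCommGroup V] [Module 𝕜 V] [NormedAddCommGroup X]
  [NormedSpace 𝕜 X] [NormedAddCommGroup Y] [NormedSpace 𝕜 Y] {z : V →ₗ[𝕜] X}
  {T : Y →ₗ⋆[𝕜] V →ₗ[𝕜] 𝕜} {C C' : ℝ}

lemma strongDual_ext_of_denseRange (hz : DenseRange z) {ℓ ℓ' : StrongDual 𝕜 X}
    (h : ∀ φ, ℓ (z φ) = ℓ' (z φ)) : ℓ = ℓ' :=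
  DFunLike.coe_injective (hz.equalizer ℓ.continuous ℓ'.continuous (funext h))

lemma exists_conjLinear_extension_of_denseRange (hz : DenseRange z) (hC : 0 ≤ C)
    (h : ∀ f φ, ‖T f φ‖ ≤ C * ‖f‖ * ‖z φ‖) :
    ∃ Λ : Y →ₗ⋆[𝕜] StrongDual 𝕜 X, (∀ f φ, Λ f (z φ) = T f φ) ∧ ∀ f, ‖Λ f‖ ≤ C * ‖f‖ := by
  have hext (f : Y) (φ : V) : (T f).extendOfNorm z (z φ) = T f φ :=
    LinearMap.extendOfNorm_eq hz ⟨C * ‖f‖, h f⟩ φ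
  refine ⟨{ toFun := fun f => (T f).extendOfNorm z, map_add' := fun f g => ?_,
            map_smul' := fun c f => ?_ }, hext, fun f =>
    LinearMap.opNorm_extendOfNorm_le hz (by positivity) (h f)⟩
  · refine strongDual_ext_of_denseRange hz fun φ => ?_
    rw [add_apply, hext, hext, hext, map_add, LinearMap.add_apply]
  · refine strongDual_ext_of_denseRange hz fun φ => ?_
    rw [smul_apply, hext, hext, map_smulₛₗ, LinearMap.smul_apply]

lemma exists_conjLinearEquiv_of_denseRange (hz : DenseRange z) (hC : 0 ≤ C)
    (h : ∀ f φ, ‖T f φ‖ ≤ C * ‖f‖ * ‖z φ‖)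
    (h' : ∀ (ℓ : StrongDual 𝕜 X) (f : Y), T f = ℓ.toLinearMap ∘ₗ z → ‖f‖ ≤ C' * ‖ℓ‖)
    (hT : ∀ ℓ : StrongDual 𝕜 X, ∃ f, T f = ℓ.toLinearMap ∘ₗ z) :
    ∃ Λ : Y ≃L⋆[𝕜] StrongDual 𝕜 X, ∀ f φ, Λ f (z φ) = T f φ := by
  obtain ⟨Λ, hΛ, hbound⟩ := exists_conjLinear_extension_of_denseRange hz hC h
  have hbound' (f : Y) : ‖f‖ ≤ C' * ‖Λ f‖ :=
    h' (Λ f) f (LinearMap.ext fun φ => (hΛ f φ).symm)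
  have hinj : Function.Injective Λ := (injective_iff_map_eq_zero Λ).2 fun f hf => by
    simpa only [hf, norm_zero, mul_zero, norm_le_zero_iff] using hbound' f
  have hsurj : Function.Surjective Λ := fun ℓ =>
    let ⟨f, hf⟩ := hT ℓ
    ⟨f, strongDual_ext_of_denseRange hz fun φ => (hΛ f φ).trans (LinearMap.congr_fun hf φ)⟩
  let e := LinearEquiv.ofBijective Λ ⟨hinj, hsurj⟩
  refine ⟨e.toContinuousLinearEquivOfBounds C C' hbound fun ℓ => ?_, hΛ⟩
  simpa only [show Λ (e.symm ℓ) = ℓ from e.apply_symm_apply ℓ] using hbound' (e.symm ℓ)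

end DensePairing

/-! ### Continuous functionals on the test functions -/

section Functionals

variable {n : ℕ} {p p' : ℝ≥0∞}

lemma exists_zDual_fourier_eq (L : Test n →L[ℂ] ℂ) : ∃ f : ZDual n, ∀ φ, f.fourier φ = L φ := by
  let e : Test n ≃ₗ[ℂ] ZSpace n :=
    LinearEquiv.ofBijective (fourierZ n) ⟨fourierZ_injective n, fourierZ_surjective n⟩
  have he (φ : Test n) : L (e.symm (fourierZ n φ)) = L φ := congrArg L (e.symm_apply_apply φ)
  exact ⟨⟨L.toLinearMap ∘ₗ e.symm.toLinearMap,
    continuous_coinduced_dom.2 (L.continuous.congr fun φ => (he φ).symm)⟩, he⟩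

/-- The inclusion of the smooth functions supported in a fixed compact set `K` into the Schwartz
space; it makes the continuity of functionals on test functions accessible to Schwartz seminorms. -/
def supportedInToSchwartz (K : TopologicalSpace.Compacts (E n)) :
    𝓓_{K}(E n, ℂ) →ₗ[ℂ] 𝓢(E n, ℂ) where
  toFun f := f.hasCompactSupport.toSchwartzMap f.contDiff
  map_add' _ _ := rfl
  map_smul' _ _ := rfl

lemma continuous_supportedInToSchwartz (K : TopologicalSpace.Compacts (E n)) :
    Continuous (supportedInToSchwartz K) := by
  obtain ⟨R, hR⟩ := K.isCompact.isBounded.exists_norm_le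
  refine WithSeminorms.continuous_of_isBounded
    (ContDiffMapSupportedIn.withSeminorms ℂ (E n) ℂ ⊤ K)
    (schwartz_withSeminorms ℂ (E n) ℂ) _ (.of_real fun km => ?_)
  refine ⟨{km.2}, |R| ^ km.1, fun f => ?_⟩
  refine SchwartzMap.seminorm_le_bound ℂ km.1 km.2 _ (by positivity) fun x => ?_
  rw [Finset.sup_singleton]
  by_cases hx : x ∈ K
  · refine mul_le_mul ?_ ?_ (norm_nonneg _) (by positivity)
    · exact pow_le_pow_left₀ (norm_nonneg _) ((hR x hx).trans (le_abs_self R)) _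
    · exact ContDiffMapSupportedIn.norm_iteratedFDeriv_apply_le_seminorm_top ℂ
  · have h0 : iteratedFDeriv ℝ km.2 (supportedInToSchwartz K f) x = 0 :=
      f.iteratedFDeriv_zero_on_compl hx
    rw [h0, norm_zero, mul_zero]
    positivity

lemma continuous_test_of_enorm_le [Fact (1 ≤ p)] (L : Test n →ₗ[ℂ] ℂ)
    (h : ∀ K : Set (E n), IsCompact K → ∃ C : ℝ≥0∞, C ≠ ∞ ∧ ∀ φ : Test n,
      (∀ x, φ x ≠ 0 → x ∈ K) →
        ‖L φ‖ₑ ≤ C * eLpNorm (𝓕 (testToSchwartz n φ) : 𝓢(E n, ℂ)) p volume) : Continuous L := by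
  refine (TestFunction.continuous_iff_continuous_comp L).2 fun K hK => ?_
  obtain ⟨C, hC, hL⟩ := h K K.isCompact
  let L' : 𝓓_{K}(E n, ℂ) →ₗ[ℂ] ℂ := L ∘ₗ (TestFunction.ofSupportedInCLM ℂ hK).toLinearMap
  let S : 𝓢(E n, ℂ) →L[ℂ] Lp ℂ p (volume : Measure (E n)) :=
    SchwartzMap.toLpCLM ℂ ℂ p volume ∘L FourierTransform.fourierCLM ℂ 𝓢(E n, ℂ)
  let T : 𝓓_{K}(E n, ℂ) →ₗ[ℂ] Lp ℂ p (volume : Measure (E n)) :=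
    S.toLinearMap ∘ₗ supportedInToSchwartz K
  have hT : Continuous T := S.continuous.comp (continuous_supportedInToSchwartz K)
  have hLT (f : 𝓓_{K}(E n, ℂ)) : ‖L' f‖ₑ ≤ C * ‖T f‖ₑ := by
    have hT_eq : ‖T f‖ₑ = eLpNorm (𝓕 (supportedInToSchwartz K f) : 𝓢(E n, ℂ)) p volume :=
      (Lp.enorm_def _).trans (eLpNorm_congr_ae (SchwartzMap.coeFn_toLp _ _ _))
    rw [hT_eq]
    exact hL (TestFunction.ofSupportedIn hK f) fun x hx => f.support_subset hx
  have hbound (f : 𝓓_{K}(E n, ℂ)) : ‖L' f‖ ≤ C.toReal * ‖T f‖ := by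
    simpa only [ENNReal.toReal_mul, toReal_enorm] using
      ENNReal.toReal_mono (by finiteness) (hLT f)
  refine continuous_of_continuousAt_zero L' ?_
  rw [ContinuousAt, map_zero]
  refine squeeze_zero_norm hbound ?_
  simpa only [map_zero, norm_zero, mul_zero] using (hT.norm.tendsto 0).const_mul C.toReal

lemma enorm_nnreal_complex (r : NNReal) : ‖(r : ℂ)‖ₑ = r := by
  rw [enorm_eq_nnnorm, ENNReal.coe_inj]
  exact NNReal.eq ((Complex.norm_real _).trans (Real.norm_of_nonneg r.coe_nonneg))

lemma eLpNorm_schwartz_const_smul (c : ℂ) (g : 𝓢(E n, ℂ)) :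
    eLpNorm (c • g : 𝓢(E n, ℂ)) p volume = ‖c‖ₑ * eLpNorm g p volume :=
  eLpNorm_const_smul c g p volume

lemma exists_eLpNorm_le_one_apply_eq [Fact (1 ≤ p)] [p.HolderConjugate p']
    (hp : p ≠ ∞) {u : 𝓢(E n, ℂ) →ₗ[ℂ] ℂ} {N : NNReal} (hu : distLpENorm p' u = N) :
    ∃ g : 𝓢(E n, ℂ), eLpNorm g p volume ≤ 1 ∧ u g = ((N / 2 : NNReal) : ℂ) := by
  rcases eq_or_ne N 0 with rfl | hN
  · exact ⟨0, by simp, by simp⟩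
  obtain ⟨g, hg⟩ : ∃ g : 𝓢(E n, ℂ), ((N / 2 : NNReal) : ℝ≥0∞) * eLpNorm g p volume < ‖u g‖ₑ := by
    by_contra! hcon
    have hle := distLpENorm_le_of_forall_enorm_le (p' := p') hp hcon
    rw [hu, ENNReal.coe_le_coe] at hle
    exact (NNReal.half_lt_self hN).not_ge hle
  have hug : ‖u g‖ₑ ≠ 0 := (zero_le.trans_lt hg).ne'
  have hug' : u g ≠ 0 := enorm_ne_zero.1 hug
  refine ⟨(((N / 2 : NNReal) : ℂ) / u g) • g, ?_, ?_⟩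
  · rw [eLpNorm_schwartz_const_smul, ← ENNReal.mul_le_mul_iff_left hug enorm_ne_top, one_mul,
      mul_right_comm, ← enorm_mul, div_mul_cancel₀ _ hug', enorm_nnreal_complex]
    exact hg.le
  · rw [map_smul, smul_eq_mul, div_mul_cancel₀ _ hug']

end Functionals

section SequenceDuality

variable {n : ℕ} {κ : Type*} {p p' q q' : ℝ≥0∞} [Fact (1 ≤ p)] [p.HolderConjugate p']
  {u : κ → 𝓢(E n, ℂ) →ₗ[ℂ] ℂ} {w w' : κ → ℝ≥0∞} {M : ℝ≥0∞}

lemma distLpENorm_ne_top_of_forall_enorm_sum_le (hp : p ≠ ∞) (hq0 : q ≠ 0) (hq : q ≠ ∞)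
    (hw : ∀ j, w j ≠ ∞) (hM : M ≠ ∞)
    (h : ∀ (J : Finset κ) (g : κ → 𝓢(E n, ℂ)), (∀ j ∉ J, g j = 0) →
      ‖∑ j ∈ J, u j (g j)‖ₑ ≤ M * lqENorm q fun j => w j * eLpNorm (g j) p volume) (j : κ) :
    distLpENorm p' (u j) ≠ ∞ := by
  classical
  refine ne_top_of_le_ne_top (ENNReal.mul_ne_top hM (hw j))
    (distLpENorm_le_of_forall_enorm_le (p := p) hp fun g => ?_)
  have hsupp : ∀ i ∉ ({j} : Finset κ), (Pi.single j g : κ → 𝓢(E n, ℂ)) i = 0 := fun i hi =>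
    Pi.single_eq_of_ne (Finset.notMem_singleton.1 hi) _
  have hj := h {j} (Pi.single j g) hsupp
  rwa [lqENorm_eq_sum_of_support_subset hq0 hq (F := {j}) fun i hi => by
      rw [hsupp i hi, FunLike.coe_zero, eLpNorm_zero, mul_zero],
    Finset.sum_singleton, Finset.sum_singleton, Pi.single_eq_same, one_div,
    ENNReal.rpow_rpow_inv (ENNReal.toReal_ne_zero.2 ⟨hq0, hq⟩), ← mul_assoc] at hj

lemma sum_mul_le_of_forall_enorm_sum_le (hp : p ≠ ∞) {N v : κ → NNReal}
    (hN : ∀ j, distLpENorm p' (u j) = N j) (hw : ∀ j, w j * v j = 1)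
    (h : ∀ (J : Finset κ) (g : κ → 𝓢(E n, ℂ)), (∀ j ∉ J, g j = 0) →
      ‖∑ j ∈ J, u j (g j)‖ₑ ≤ M * lqENorm q fun j => w j * eLpNorm (g j) p volume)
    (F : Finset κ) (c : κ → NNReal) :
    ∑ j ∈ F, (c j : ℝ≥0∞) * ((v j * N j : NNReal) : ℝ≥0∞) ≤
      2 * M * lqENorm q ((F : Set κ).indicator fun i => (c i : ℝ≥0∞)) := by
  classical
  choose g hg1 hg using fun j => exists_eLpNorm_le_one_apply_eq hp (hN j)
  -- up to the factor 2, the functions `c j * v j • g j` are extremal for the left-hand side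
  let a (j : κ) : 𝓢(E n, ℂ) := if j ∈ F then ((c j * v j : NNReal) : ℂ) • g j else 0
  have ha_sum : ∑ j ∈ F, u j (a j) = ((∑ j ∈ F, c j * (v j * N j) / 2 : NNReal) : ℂ) := by
    push_cast
    refine Finset.sum_congr rfl fun j hj => ?_
    rw [show a j = _ from if_pos hj, map_smul, hg, smul_eq_mul]
    push_cast
    ring
  have ha_le (j : κ) : w j * eLpNorm (a j) p volume ≤
      (F : Set κ).indicator (fun i => (c i : ℝ≥0∞)) j := by
    by_cases hj : j ∈ F
    · rw [show a j = _ from if_pos hj, Set.indicator_of_mem (Finset.mem_coe.2 hj),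
        eLpNorm_schwartz_const_smul, enorm_nnreal_complex, ENNReal.coe_mul]
      calc w j * (c j * v j * eLpNorm (g j) p volume)
          ≤ w j * (c j * v j * 1) := by gcongr; exact hg1 j
        _ = c j := by rw [mul_one, mul_left_comm, hw, mul_one]
    · rw [show a j = 0 from if_neg hj, FunLike.coe_zero, eLpNorm_zero, mul_zero]
      exact zero_le
  calc ∑ j ∈ F, (c j : ℝ≥0∞) * ((v j * N j : NNReal) : ℝ≥0∞)
      = 2 * ‖∑ j ∈ F, u j (a j)‖ₑ := by
        rw [ha_sum, enorm_nnreal_complex, ← Finset.sum_div]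
        norm_cast
        rw [mul_div_cancel₀ _ two_ne_zero]
    _ ≤ 2 * (M * lqENorm q fun j => w j * eLpNorm (a j) p volume) := by
        gcongr
        exact h F a fun j hj => if_neg hj
    _ ≤ 2 * M * lqENorm q ((F : Set κ).indicator fun i => (c i : ℝ≥0∞)) := by
        rw [mul_assoc]
        gcongr
        exact lqENorm_mono q ha_le

lemma lqENorm_mul_distLpENorm_le_of_forall_enorm_sum_le [hq1 : Fact (1 ≤ q)]
    [q.HolderConjugate q'] (hp : p ≠ ∞) (hq : q ≠ ∞) (hw : ∀ j, w j * w' j = 1) (hM : M ≠ ∞)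
    (h : ∀ (J : Finset κ) (g : κ → 𝓢(E n, ℂ)), (∀ j ∉ J, g j = 0) →
      ‖∑ j ∈ J, u j (g j)‖ₑ ≤ M * lqENorm q fun j => w j * eLpNorm (g j) p volume) :
    lqENorm q' (fun j => w' j * distLpENorm p' (u j)) ≤ 2 * M := by
  have hne_top {a b : ℝ≥0∞} (hab : a * b = 1) : a ≠ ∞ := by
    rintro rfl
    rcases eq_or_ne b 0 with rfl | hb
    · simp at hab
    · simp [ENNReal.top_mul hb] at hab
  lift w' to κ → NNReal using fun j => hne_top ((mul_comm _ _).trans (hw j))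
  obtain ⟨N, hN⟩ : ∃ N : κ → NNReal, ∀ j, distLpENorm p' (u j) = N j :=
    ⟨_, fun j => (ENNReal.coe_toNNReal (distLpENorm_ne_top_of_forall_enorm_sum_le hp
      (zero_lt_one.trans_le hq1.out).ne' hq (fun j => hne_top (hw j)) hM h j)).symm⟩
  simp only [hN, ← ENNReal.coe_mul]
  exact lqENorm_le_of_forall_sum_mul_le hq (sum_mul_le_of_forall_enorm_sum_le hp hN hw h)

end SequenceDuality

/-! ### Duality -/

section Duality

variable {n : ℕ}

/-- The complex conjugate `φ ↦ conj (L (conj φ))` of a linear functional `L` on the test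
functions. -/
def conjFunctional : (Test n →ₗ[ℂ] ℂ) →ₗ⋆[ℂ] (Test n →ₗ[ℂ] ℂ) where
  toFun L := (starRingEnd ℂ).toSemilinearMap ∘ₛₗ L ∘ₛₗ conjTestₗ n
  map_add' _ _ := LinearMap.ext fun _ => map_add (starRingEnd ℂ) _ _
  map_smul' _ _ := LinearMap.ext fun _ => map_mul (starRingEnd ℂ) _ _

lemma conjFunctional_apply (L : Test n →ₗ[ℂ] ℂ) (φ : Test n) :
    conjFunctional L φ = conj (L (conjTest φ)) := rfl

lemma conjFunctional_conjFunctional (L : Test n →ₗ[ℂ] ℂ) :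
    conjFunctional (conjFunctional L) = L := by
  ext φ
  rw [conjFunctional_apply, conjFunctional_apply, Complex.conj_conj, conjTest_conjTest]

/-- The sesquilinear pairing `∫ conj f · g` of `Z'` with `Z`, read on the Fourier side: `g` is
represented by a test function `φ`, and `f` enters through its Fourier transform. -/
def pairing : ZDual n →ₗ⋆[ℂ] (Test n →ₗ[ℂ] ℂ) where
  toFun f := conjFunctional f.fourier.toLinearMap
  map_add' f g := map_add conjFunctional f.fourier.toLinearMap g.fourier.toLinearMap
  map_smul' c f := map_smulₛₗ conjFunctional c f.fourier.toLinearMap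

lemma pairing_apply (f : ZDual n) (φ : Test n) :
    pairing f φ = conj (f.fourier (conjTest φ)) := rfl

lemma pairing_mulTest (ψ : 𝓓((⊤ : TopologicalSpace.Opens (E n)), ℝ)) (f : ZDual n)
    (g : 𝓢(E n, ℂ)) :
    pairing f (mulTest ψ (𝓕 (conjSchwartz g))) = conj (freqBlock ψ f g) := by
  rw [pairing_apply, conjTest_mulTest_fourier_conjSchwartz, freqBlock_apply]

namespace AlphaModData

variable {𝔤 : Type*} [LieRing 𝔤] [LieAlgebra ℝ 𝔤] {G : AdmissibleLieGroup n 𝔤} {α : ℝ}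
  {I κ : Type*} {p p' q q' : ℝ≥0∞} (d : AlphaModData G α I) (d' : AlphaModData G α κ)
  (hα : α ≤ 1) (s : ℝ) [Fact (1 ≤ p)] [Fact (1 ≤ q)] (hp : p ≠ ∞)

lemma exists_pairing_eq (ℓ : StrongDual ℂ (AlphaModSpace d s p q)) :
    ∃ f : ZDual n, pairing f = ℓ.toLinearMap ∘ₗ d.zTest hα s hp := by
  have hcont : Continuous (conjFunctional (ℓ.toLinearMap ∘ₗ d.zTest hα s hp)) := by
    refine continuous_test_of_enorm_le (p := p) _ fun K hK => ?_
    obtain ⟨C, hC, h⟩ := d.exists_alphaModENorm_zOfTest_le (p := p) (q := q) hα s hp hK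
    refine ⟨‖ℓ‖ₑ * C, by finiteness, fun φ hφ => ?_⟩
    have hφ' := h (conjTest φ) fun x hx => hφ x fun h0 => hx <| by
      rw [conjTest_apply, h0, map_zero]
    rw [← eLpNorm_fourier_conjTest, conjTest_conjTest] at hφ'
    calc ‖conjFunctional (ℓ.toLinearMap ∘ₗ d.zTest hα s hp) φ‖ₑ
        = ‖ℓ (d.zTest hα s hp (conjTest φ))‖ₑ := RCLike.enorm_conj _
      _ ≤ ‖ℓ‖ₑ * ‖d.zTest hα s hp (conjTest φ)‖ₑ := ℓ.le_opENorm _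
      _ ≤ ‖ℓ‖ₑ * C * eLpNorm (𝓕 (testToSchwartz n φ) : 𝓢(E n, ℂ)) p volume := by
          rw [mul_assoc, enorm_zTest]
          gcongr
  obtain ⟨f, hf⟩ := exists_zDual_fourier_eq ⟨_, hcont⟩
  refine ⟨f, ?_⟩
  rw [← conjFunctional_conjFunctional (ℓ.toLinearMap ∘ₗ d.zTest hα s hp)]
  exact congrArg conjFunctional (LinearMap.ext hf)

lemma exists_enorm_sum_freqBlock_le :
    ∃ C : ℝ≥0∞, C ≠ ∞ ∧ ∀ (ℓ : StrongDual ℂ (AlphaModSpace d s p q)) (f : ZDual n),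
      pairing f = ℓ.toLinearMap ∘ₗ d.zTest hα s hp →
        ∀ (J : Finset κ) (g : κ → 𝓢(E n, ℂ)), (∀ j ∉ J, g j = 0) →
          ‖∑ j ∈ J, freqBlock (d'.ψ j) f (g j)‖ₑ ≤
            C * ‖ℓ‖ₑ * lqENorm q fun j => d'.weight s j * eLpNorm (g j) p volume := by
  obtain ⟨C, hC, h⟩ := d.exists_alphaModENorm_zOfTest_sum_le (p := p) (q := q) d' hα s hp
  refine ⟨C, hC, fun ℓ f hf J g hg => ?_⟩
  set φ := ∑ j ∈ J, mulTest (d'.ψ j) (𝓕 (conjSchwartz (g j)))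
  have hφ : ‖d.zTest (q := q) hα s hp φ‖ₑ ≤
      C * lqENorm q fun j => d'.weight s j * eLpNorm (g j) p volume := by
    simpa only [enorm_zTest, eLpNorm_conjSchwartz] using
      h J (fun j => conjSchwartz (g j)) fun j hj => by rw [hg j hj, conjSchwartz_zero]
  have hpair : ℓ (d.zTest hα s hp φ) = conj (∑ j ∈ J, freqBlock (d'.ψ j) f (g j)) := by
    refine (LinearMap.congr_fun hf φ).symm.trans ?_
    simp only [φ, map_sum, pairing_mulTest]
  calc ‖∑ j ∈ J, freqBlock (d'.ψ j) f (g j)‖ₑ = ‖ℓ (d.zTest hα s hp φ)‖ₑ := by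
        rw [hpair, RCLike.enorm_conj]
    _ ≤ ‖ℓ‖ₑ * ‖d.zTest hα s hp φ‖ₑ := ℓ.le_opENorm _
    _ ≤ C * ‖ℓ‖ₑ * lqENorm q fun j => d'.weight s j * eLpNorm (g j) p volume := by
        rw [mul_comm C, mul_assoc]
        gcongr

variable [p.HolderConjugate p'] [q.HolderConjugate q']

lemma exists_alphaModENorm_le_opENorm (hq : q ≠ ∞) :
    ∃ C : ℝ≥0∞, C ≠ ∞ ∧ ∀ (ℓ : StrongDual ℂ (AlphaModSpace d s p q)) (f : ZDual n),
      pairing f = ℓ.toLinearMap ∘ₗ d.zTest hα s hp →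
        alphaModENorm d' (-s) p' q' f ≤ C * ‖ℓ‖ₑ := by
  obtain ⟨C, hC, h⟩ := d.exists_enorm_sum_freqBlock_le (p := p) (q := q) d' hα s hp
  refine ⟨2 * C, by finiteness, fun ℓ f hf => ?_⟩
  rw [mul_assoc]
  exact lqENorm_mul_distLpENorm_le_of_forall_enorm_sum_le hp hq (d'.weight_mul_weight_neg s)
    (by finiteness) (h ℓ f hf)

variable [Fact (1 ≤ p')] [Fact (1 ≤ q')]

lemma exists_norm_pairing_le (hq : q ≠ ∞) :
    ∃ C : ℝ, 0 ≤ C ∧ ∀ (f : AlphaModSpace d' (-s) p' q') (φ : Test n),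
      ‖pairing f.1 φ‖ ≤ C * ‖f‖ * ‖d.zTest (q := q) hα s hp φ‖ := by
  obtain ⟨C, hC, h⟩ := d.exists_enorm_fourier_conjTest_le (p := p) (q := q) (p' := p') (q' := q')
    d' hα s hq
  refine ⟨C.toReal, ENNReal.toReal_nonneg, fun f φ => ?_⟩
  have hle : ‖pairing f.1 φ‖ₑ ≤ C * ‖f‖ₑ * ‖d.zTest (q := q) hα s hp φ‖ₑ := by
    rw [pairing_apply, RCLike.enorm_conj, enorm_alphaModSpace, enorm_zTest]
    exact h f.1 φ
  simpa only [ENNReal.toReal_mul, toReal_enorm] using ENNReal.toReal_mono (by finiteness) hle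

theorem exists_dual_equiv (hq : q ≠ ∞) :
    ∃ Λ : AlphaModSpace d' (-s) p' q' ≃L⋆[ℂ] StrongDual ℂ (AlphaModSpace d s p q),
      ∀ f φ, Λ f (d.zTest hα s hp φ) = pairing f.1 φ := by
  obtain ⟨C, hC0, hC⟩ := d.exists_norm_pairing_le d' (q' := q') (p' := p') hα s hp hq
  obtain ⟨C', hC', hinv⟩ := d.exists_alphaModENorm_le_opENorm d' (p' := p') (q' := q') hα s hp hq
  let T : AlphaModSpace d' (-s) p' q' →ₗ⋆[ℂ] Test n →ₗ[ℂ] ℂ :=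
    { toFun := fun f => pairing f.1
      map_add' := fun f g => map_add pairing f.1 g.1
      map_smul' := fun c f => map_smulₛₗ pairing c f.1 }
  refine exists_conjLinearEquiv_of_denseRange (T := T) (C' := C'.toReal)
    (d.denseRange_zTest hα s hp hq) hC0 hC (fun ℓ f hf => ?_) fun ℓ => ?_
  · have hle : ‖f‖ₑ ≤ C' * ‖ℓ‖ₑ := (d'.enorm_alphaModSpace (-s) f).trans_le (hinv ℓ f.1 hf)
    simpa only [ENNReal.toReal_mul, toReal_enorm] using ENNReal.toReal_mono (by finiteness) hle
  · obtain ⟨f, hf⟩ := d.exists_pairing_eq hα s hp ℓ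
    exact ⟨⟨f, (hinv ℓ f hf).trans_lt (by finiteness)⟩, hf⟩

end AlphaModData

end Duality

end GenAlphaMod

end

theorem proposition4p4_general {n : ℕ} {𝔤 : Type*} [LieRing 𝔤] [LieAlgebra ℝ 𝔤]
    (G : AdmissibleLieGroup n 𝔤) {α : ℝ} (hα : α ≤ 1) (s : ℝ)
    {p q p' q' : ℝ≥0∞} [Fact (1 ≤ p)] [Fact (1 ≤ q)] [Fact (1 ≤ p')] [Fact (1 ≤ q')]
    (hp : p < ∞) (hq : q < ∞) [p.HolderConjugate p'] [q.HolderConjugate q']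
    {I I' : Type*} (d : AlphaModData G α I) (d' : AlphaModData G α I') :
    ∃ Λ : AlphaModSpace d' (-s) p' q' ≃L⋆[ℂ] StrongDual ℂ (AlphaModSpace d s p q),
      ∀ (f : AlphaModSpace d' (-s) p' q') (φ : Test n),
        ∃ hφ : zOfTest φ ∈ alphaModSubmodule d s p q,
          Λ f ⟨zOfTest φ, hφ⟩ = conj (f.1 (fourierZ n (conjTest φ))) := by
  obtain ⟨Λ, hΛ⟩ := d.exists_dual_equiv d' (p' := p') (q' := q') hα s hp.ne hq.ne
  exact ⟨Λ, fun f φ => ⟨d.zOfTest_mem hα s hp.ne φ, hΛ f φ⟩⟩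

theorem proposition4p4 {n : ℕ} {𝔤 : Type*} [LieRing 𝔤] [LieAlgebra ℝ 𝔤]
    (G : AdmissibleLieGroup n 𝔤) {α : ℝ} (hα0 : 0 ≤ α) (hα1 : α < 1) (s : ℝ)
    {p q p' q' : ℝ≥0∞} [Fact (1 ≤ p)] [Fact (1 ≤ q)] [Fact (1 ≤ p')] [Fact (1 ≤ q')]
    (hp : p < ∞) (hq : q < ∞) (hpp' : p.HolderConjugate p') (hqq' : q.HolderConjugate q')
    {I I' : Type*} (d : AlphaModData G α I) (d' : AlphaModData G α I') :
    ∃ Λ : AlphaModSpace d' (-s) p' q' ≃L⋆[ℂ] StrongDual ℂ (AlphaModSpace d s p q),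
      ∀ (f : AlphaModSpace d' (-s) p' q') (φ : Test n),
        ∃ hφ : zOfTest φ ∈ alphaModSubmodule d s p q,
          Λ f ⟨zOfTest φ, hφ⟩ = conj (f.1 (fourierZ n (conjTest φ))) :=
  proposition4p4_general G hα1.le s hp hq d d'
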